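/- A $\mathbb{Q}$-weighted automaton of dimension $n$ over a finite alphabet $\Sigma=\{0,\dots,k-1\}$ is a triple $\mathcal{A}=(\alpha,\mu,\beta)$ with $\alpha\in\mathbb{Q}^{1\times n}$, $\mu(\sigma)\in\mathbb{Q}^{n\times n}$ for $\sigma\in\Sigma$, and $\beta\in\mathbb{Q}^{n\times 1}$ ($k,n\ge 0$). With $\mu(\sigma_1\cdots\sigma_l)=\mu(\sigma_1)\cdots\mu(\sigma_l)$, the weight of a word $w\in\Sigma^*$ is $[\![\mathcal{A}]\!](w)=\alpha\,\mu(w)\,\beta$. Two automata over $\Sigma$ are equivalent if they have the same weight on every word. An automaton is $\mathbb{Z}$-weighted if all its entries are integers, and it is minimal as a $\mathbb{Q}$-weighted automaton if no equivalent $\mathbb{Q}$-weighted automaton has smaller dimension. The procedure $\mathtt{Z\_compute}$, on input $\mathcal{A}=(\alpha,\mu,\beta)$, works as follows. 1. Start with $W_B=\{\varepsilon\}$. As long as there are $w\in W_B$ and $\sigma\in\Sigma$ with $\mu(\sigma w)\beta\notin\langle \mu(u)\beta : u\in W_B\rangle_{\mathbb{Q}}$, choose such a pair and add $\sigma w$ to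 $W_B$. Write $W_B=\{w_1,\dots,w_m\}$ and $B=[\mu(w_1)\beta\ \cdots\ \mu(w_m)\beta]$. 2. Take an automaton $\mathcal{A}'=(\alpha',\mu',\beta')$ of dimension $m$ with $\alpha'=\alpha B$, $B\beta'=\beta$ and $B\mu'(\sigma)=\mu(\sigma)B$ for all $\sigma\in\Sigma$. 3. Whenever this step meets a word $w$ with $\alpha'\mu'(w)\notin\mathbb{Z}^m$, return the word $ww_i$ for some $i$ such that the $i$-th entry of $\alpha'\mu'(w)$ is not an integer, and stop. Start with $W=\{\varepsilon\}$ and test $\varepsilon$ in this way. As long as there are $w\in W$ and $\sigma\in\Sigma$ with $\alpha'\mu'(w\sigma)\notin\langle\alpha'\mu'(u):u\in W\rangle_{\mathbb{Q}}$, choose such a pair, add $w\sigma$ to $W$ and test it. Then, as long as there are $w\in W$ and $\sigma\in\Sigma$ with $\alpha'\mu'(w\sigma)\notin\langle\alpha'\mu'(u):u\in W\rangle_{\mathbb{Z}}$, choose such a pair, add $w\sigma$ to $W$ and test it. 4. If no word was returned, take a matrix $F$ whose rows form a $\mathbb{Z}$-basis of $\langle\alpha'\mu'(w):w\in W\rangle_{\mathbb{Z}}$,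 and return an automaton $\mathcal{A}''=(\alpha'',\mu'',\beta'')$ with $\alpha''F=\alpha'$, $\beta''=F\beta'$ and $\mu''(\sigma)F=F\mu'(\sigma)$ for all $\sigma\in\Sigma$. **Theorem.** $\mathtt{Z\_compute}$ is a polynomial-time algorithm that, given a $\mathbb{Q}$-weighted automaton $\mathcal{A}$, outputs either an equivalent $\mathbb{Z}$-weighted automaton that is minimal as a $\mathbb{Q}$-weighted automaton, or a word $w$ with $[\![\mathcal{A}]\!](w)\notin\mathbb{Z}$. More precisely, there are a program $P$ and a polynomial $p$ such that for every $k$, every $n$ and every $\mathbb{Q}$-weighted automaton $\mathcal{A}$ of dimension $n$ over $\{0,\dots,k-1\}$, whose encoding (with rational entries written in binary as reduced fractions) has length $s$: (a) however the choices left open are made, an execution of $\mathtt{Z\_compute}$ on $\mathcal{A}$ has at most $p(s)$ steps, where a step is one loop iteration or one passage between stages; (b) however the choices are made, an execution never gets stuck, and it stops only with an output that is either an equivalent $\mathbb{Z}$-weighted automaton, minimal as a $\mathbb{Q}$-weighted automaton, or a word $w$ with $[\![\mathcal{A}]\!](w)\notin\mathbb{Z}$; (c) on the encoding of $\mathcal{A}$,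 the program $P$ stops within time $p(s)$ with the encoding of the output of some execution of $\mathtt{Z\_compute}$ on $\mathcal{A}$. Here programs are built by composition, pairing, conditionals and while-loops from elementary operations on binary trees with integer leaves (projections, pairing, integer constants, addition, subtraction, multiplication, integer division, comparison). Time is bit cost: every operation, and every copy of a value, is charged the length of the values it reads, and multiplications and divisions are charged the product of the lengths of the operands. -/

import Mathlib

open scoped Matrix

/-- A word over the alphabet `{0, …, k - 1}`. -/
abbrev Word (k : ℕ) : Type := List (Fin k)

/-- A `ℚ`-weighted automaton of dimension `n` over the alphabet `Fin k`. -/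
structure WeightedAutomaton (k n : ℕ) where
  /-- the initial row vector -/
  init : Fin n → ℚ
  /-- the transition matrices -/
  trans : Fin k → Matrix (Fin n) (Fin n) ℚ
  /-- the final column vector -/
  fin : Fin n → ℚ

/-- A rational number is an integer. -/
def IsInteger (q : ℚ) : Prop := ∃ z : ℤ, q = (z : ℚ)

namespace WeightedAutomaton

variable {k n : ℕ}

/-- The extension of the transition function to words,
`μ(σ₁ … σ_l) = μ(σ₁) ⋯ μ(σ_l)`, with `μ(ε) = 1`. -/
def transWord (A : WeightedAutomaton k n) (w : Word k) : Matrix (Fin n) (Fin n) ℚ :=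
  (w.map A.trans).prod

/-- The forward vector `α μ(w)`. -/
def forward (A : WeightedAutomaton k n) (w : Word k) : Fin n → ℚ :=
  A.init ᵥ* A.transWord w

/-- The backward vector `μ(w) β`. -/
def backward (A : WeightedAutomaton k n) (w : Word k) : Fin n → ℚ :=
  A.transWord w *ᵥ A.fin

/-- The weight `α μ(w) β` of the word `w`. -/
def weight (A : WeightedAutomaton k n) (w : Word k) : ℚ :=
  A.forward w ⬝ᵥ A.fin

/-- Two automata (possibly of different dimensions) compute the same function. -/
def Equivalent {m : ℕ} (A : WeightedAutomaton k n) (A' : WeightedAutomaton k m) : Prop :=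
  ∀ w : Word k, A.weight w = A'.weight w

/-- Minimal as a `ℚ`-weighted automaton: no equivalent `ℚ`-weighted automaton has
fewer states. -/
def Minimal (A : WeightedAutomaton k n) : Prop :=
  ∀ (m : ℕ) (A' : WeightedAutomaton k m), A.Equivalent A' → n ≤ m

/-- The automaton is `ℤ`-weighted: all its entries are integers. -/
def IsZWeighted (A : WeightedAutomaton k n) : Prop :=
  (∀ i, IsInteger (A.init i)) ∧ (∀ σ i j, IsInteger (A.trans σ i j)) ∧
    (∀ i, IsInteger (A.fin i))

/-- The `ℚ`-span of the backward vectors of the words in `W`. -/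
def backwardSpan (A : WeightedAutomaton k n) (W : List (Word k)) : Submodule ℚ (Fin n → ℚ) :=
  Submodule.span ℚ {v | ∃ u ∈ W, v = A.backward u}

/-- The `ℚ`-span of the forward vectors of the words in `W`. -/
def forwardSpan (A : WeightedAutomaton k n) (W : List (Word k)) : Submodule ℚ (Fin n → ℚ) :=
  Submodule.span ℚ {v | ∃ u ∈ W, v = A.forward u}

/-- The `ℤ`-span of the forward vectors of the words in `W`. -/
def forwardModule (A : WeightedAutomaton k n) (W : List (Word k)) : Submodule ℤ (Fin n → ℚ) :=
  Submodule.span ℤ {v | ∃ u ∈ W, v = A.forward u}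

/-- The forward vector of `w` is an integer vector. -/
def ForwardIntegral (A : WeightedAutomaton k n) (w : Word k) : Prop :=
  ∀ i, IsInteger (A.forward w i)

/-- The matrix whose columns are the backward vectors of the words `w₁, …, w_m`. -/
def backwardMatrix (A : WeightedAutomaton k n) (W : List (Word k)) :
    Matrix (Fin n) (Fin W.length) ℚ :=
  Matrix.of fun i j => A.backward (W.get j) i

/-- `A'` is obtained from `A` by backward conjugation with `B`. -/
def BackwardConjugate {m : ℕ} (A : WeightedAutomaton k n) (B : Matrix (Fin n) (Fin m) ℚ)
    (A' : WeightedAutomaton k m) : Prop :=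
  A'.init = A.init ᵥ* B ∧ B *ᵥ A'.fin = A.fin ∧ ∀ σ, B * A'.trans σ = A.trans σ * B

/-- `A'` is obtained from `A` by forward conjugation with `F`. -/
def ForwardConjugate {l : ℕ} (A : WeightedAutomaton k n) (F : Matrix (Fin l) (Fin n) ℚ)
    (A' : WeightedAutomaton k l) : Prop :=
  A'.init ᵥ* F = A.init ∧ A'.fin = F *ᵥ A.fin ∧ ∀ σ, A'.trans σ * F = F * A.trans σ

end WeightedAutomaton

/-- What the procedure may output: a word or an automaton. -/
inductive Outcome (k : ℕ) : Type
  | word (w : Word k) : Outcome k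
  | automaton (l : ℕ) (A : WeightedAutomaton k l) : Outcome k

/-- The specification of the output on input `A`: a word of non-integer weight, or an
equivalent `ℤ`-weighted automaton that is minimal as a `ℚ`-weighted automaton. -/
def Outcome.Correct {k n : ℕ} (A : WeightedAutomaton k n) : Outcome k → Prop
  | .word w => ¬ IsInteger (A.weight w)
  | .automaton _ A' => A'.IsZWeighted ∧ A.Equivalent A' ∧ A'.Minimal

/-! ### The procedure, as a nondeterministic transition system

The choices that the pseudo-code leaves open (which word a loop adds, which non-integer
coordinate and which `ℤ`-basis is taken) are left open here. -/

namespace ZCompute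

/-- The configurations of the procedure. `WB` is the list of words found by the backward
search, `A'` the conjugate automaton, and `W` the list of words found by the forward search. -/
inductive State (k : ℕ) : Type
  /-- in the loop that computes generators of the backward space -/
  | backwardLoop (WB : List (Word k)) : State k
  /-- the conjugate automaton has been built -/
  | conjugated (WB : List (Word k)) (A' : WeightedAutomaton k WB.length) : State k
  /-- in the loop that looks for words increasing the rank -/
  | rankLoop (WB : List (Word k)) (A' : WeightedAutomaton k WB.length)
      (W : List (Word k)) : State k
  /-- in the loop that looks for words augmenting the module -/
  | moduleLoop (WB : List (Word k)) (A' : WeightedAutomaton k WB.length)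
      (W : List (Word k)) : State k
  /-- the forward search has returned a word with a non-integer forward vector -/
  | nonInteger (WB : List (Word k)) (A' : WeightedAutomaton k WB.length) (w : Word k) : State k
  /-- the forward search has returned generators of the forward module -/
  | generators (WB : List (Word k)) (A' : WeightedAutomaton k WB.length)
      (W : List (Word k)) : State k
  /-- the procedure has stopped -/
  | output (r : Outcome k) : State k

/-- The initial configuration. -/
def start (k : ℕ) : State k := .backwardLoop [[]]

/-- One step of the procedure on input `A`. -/
inductive Step {k n : ℕ} (A : WeightedAutomaton k n) : State k → State k → Prop
  | backwardAdd (WB : List (Word k)) (w : Word k) (σ : Fin k) (hw : w ∈ WB)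
      (hnew : A.backward (σ :: w) ∉ A.backwardSpan WB) :
      Step A (.backwardLoop WB) (.backwardLoop (WB ++ [σ :: w]))
  | backwardDone (WB : List (Word k)) (A' : WeightedAutomaton k WB.length)
      (hclosed : ∀ w ∈ WB, ∀ σ : Fin k, A.backward (σ :: w) ∈ A.backwardSpan WB)
      (hconj : A.BackwardConjugate (A.backwardMatrix WB) A') :
      Step A (.backwardLoop WB) (.conjugated WB A')
  | emptyWordBad (WB : List (Word k)) (A' : WeightedAutomaton k WB.length)
      (hbad : ¬ A'.ForwardIntegral []) :
      Step A (.conjugated WB A') (.nonInteger WB A' [])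
  | emptyWordGood (WB : List (Word k)) (A' : WeightedAutomaton k WB.length)
      (hgood : A'.ForwardIntegral []) :
      Step A (.conjugated WB A') (.rankLoop WB A' [[]])
  | rankBad (WB : List (Word k)) (A' : WeightedAutomaton k WB.length) (W : List (Word k))
      (w : Word k) (σ : Fin k) (hw : w ∈ W)
      (hnew : A'.forward (w ++ [σ]) ∉ A'.forwardSpan W)
      (hbad : ¬ A'.ForwardIntegral (w ++ [σ])) :
      Step A (.rankLoop WB A' W) (.nonInteger WB A' (w ++ [σ]))
  | rankAdd (WB : List (Word k)) (A' : WeightedAutomaton k WB.length) (W : List (Word k))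
      (w : Word k) (σ : Fin k) (hw : w ∈ W)
      (hnew : A'.forward (w ++ [σ]) ∉ A'.forwardSpan W)
      (hgood : A'.ForwardIntegral (w ++ [σ])) :
      Step A (.rankLoop WB A' W) (.rankLoop WB A' (W ++ [w ++ [σ]]))
  | rankDone (WB : List (Word k)) (A' : WeightedAutomaton k WB.length) (W : List (Word k))
      (hclosed : ∀ w ∈ W, ∀ σ : Fin k, A'.forward (w ++ [σ]) ∈ A'.forwardSpan W) :
      Step A (.rankLoop WB A' W) (.moduleLoop WB A' W)
  | moduleBad (WB : List (Word k)) (A' : WeightedAutomaton k WB.length) (W : List (Word k))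
      (w : Word k) (σ : Fin k) (hw : w ∈ W)
      (hnew : A'.forward (w ++ [σ]) ∉ A'.forwardModule W)
      (hbad : ¬ A'.ForwardIntegral (w ++ [σ])) :
      Step A (.moduleLoop WB A' W) (.nonInteger WB A' (w ++ [σ]))
  | moduleAdd (WB : List (Word k)) (A' : WeightedAutomaton k WB.length) (W : List (Word k))
      (w : Word k) (σ : Fin k) (hw : w ∈ W)
      (hnew : A'.forward (w ++ [σ]) ∉ A'.forwardModule W)
      (hgood : A'.ForwardIntegral (w ++ [σ])) :
      Step A (.moduleLoop WB A' W) (.moduleLoop WB A' (W ++ [w ++ [σ]]))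
  | moduleDone (WB : List (Word k)) (A' : WeightedAutomaton k WB.length) (W : List (Word k))
      (hclosed : ∀ w ∈ W, ∀ σ : Fin k, A'.forward (w ++ [σ]) ∈ A'.forwardModule W) :
      Step A (.moduleLoop WB A' W) (.generators WB A' W)
  | returnWord (WB : List (Word k)) (A' : WeightedAutomaton k WB.length) (w : Word k)
      (i : Fin WB.length) (hi : ¬ IsInteger (A'.forward w i)) :
      Step A (.nonInteger WB A' w) (.output (.word (w ++ WB.get i)))
  | returnAutomaton (WB : List (Word k)) (A' : WeightedAutomaton k WB.length)
      (W : List (Word k)) (l : ℕ) (F : Matrix (Fin l) (Fin WB.length) ℚ)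
      (A'' : WeightedAutomaton k l)
      (hindep : LinearIndependent ℤ F.row)
      (hspan : Submodule.span ℤ (Set.range F.row) = A'.forwardModule W)
      (hconj : A'.ForwardConjugate F A'') :
      Step A (.generators WB A' W) (.output (.automaton l A''))

end ZCompute

/-! ### The machine model

First-order programs on binary trees with integer leaves, with bit cost: every operation is
charged at least the number of bits that it reads, and multiplication and division are
charged the product of the bit lengths of the two operands. -/

/-- Values: binary trees whose leaves are integers. -/
inductive Data : Type
  | int (z : ℤ) : Data
  | pair (a b : Data) : Data

namespace Data

/-- The length of a value: one unit for each node, and the binary digits of the leaves. -/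
def size : Data → ℕ
  | int z => 1 + z.natAbs.size
  | pair a b => 1 + a.size + b.size

/-- A list of values as a value. -/
def ofList (l : List Data) : Data := l.foldr pair (int 0)

/-- A rational number, as numerator and denominator in lowest terms. -/
def ofRat (q : ℚ) : Data := pair (int q.num) (int q.den)

/-- A vector, as the list of its entries. -/
def ofVector {n : ℕ} (v : Fin n → ℚ) : Data := ofList (List.ofFn fun i => ofRat (v i))

/-- A square matrix, as the list of its rows. -/
def ofMatrix {n : ℕ} (M : Matrix (Fin n) (Fin n) ℚ) : Data :=
  ofList (List.ofFn fun i => ofVector (M i))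

/-- A word, as the list of its letters. -/
def ofWord {k : ℕ} (w : Word k) : Data := ofList (w.map fun σ => int (σ.val : ℤ))

/-- The encoding of an automaton. -/
def ofAutomaton {k n : ℕ} (A : WeightedAutomaton k n) : Data :=
  ofList [int k, int n, ofVector A.init,
    ofList (List.ofFn fun σ => ofMatrix (A.trans σ)), ofVector A.fin]

/-- The encoding of an outcome, with a tag that tells words from automata. -/
def ofOutcome {k : ℕ} : Outcome k → Data
  | .word w => pair (int 0) (ofWord w)
  | .automaton _ A => pair (int 1) (ofAutomaton A)

end Data

/-- The primitive operations. -/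
inductive Op : Type
  | id | const (z : ℤ) | fst | snd | isPair | add | sub | mul | div | le

/-- The value of a primitive operation, `0` where the input has the wrong shape.
Division is integer division (with value `0` for the divisor `0`). -/
def Op.eval : Op → Data → Data
  | .id, x => x
  | .const z, _ => .int z
  | .fst, .pair a _ => a
  | .snd, .pair _ b => b
  | .isPair, .pair _ _ => .int 1
  | .add, .pair (.int a) (.int b) => .int (a + b)
  | .sub, .pair (.int a) (.int b) => .int (a - b)
  | .mul, .pair (.int a) (.int b) => .int (a * b)
  | .div, .pair (.int a) (.int b) => .int (a / b)
  | .le, .pair (.int a) (.int b) => .int (if a ≤ b then 1 else 0)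
  | _, _ => .int 0

/-- The cost of a primitive operation. -/
def Op.cost : Op → Data → ℕ
  | .const z, x => x.size + (Data.int z).size
  | .mul, .pair a b => 1 + a.size * b.size
  | .div, .pair a b => 1 + a.size * b.size
  | _, x => x.size

/-- Programs. -/
inductive Prog : Type
  /-- a primitive operation -/
  | op (o : Op) : Prog
  /-- first `f`, then `g` -/
  | comp (f g : Prog) : Prog
  /-- the pair of the results of `f` and `g` on the same input -/
  | pair (f g : Prog) : Prog
  /-- if the result of `c` is not `0` then `f` else `g` -/
  | cond (c f g : Prog) : Prog
  /-- as long as the result of `c` is not `0`, replace the current value by that of `f` -/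
  | loop (c f : Prog) : Prog

/-- `P.Runs x y t`: on input `x` the program `P` stops with output `y` after time `t`.
Keeping a copy of the current value is charged with its size. -/
inductive Prog.Runs : Prog → Data → Data → ℕ → Prop
  | op (o : Op) (x : Data) : Prog.Runs (.op o) x (o.eval x) (o.cost x)
  | comp {f g : Prog} {x y z : Data} {s t : ℕ} (hf : Prog.Runs f x y s)
      (hg : Prog.Runs g y z t) : Prog.Runs (.comp f g) x z (1 + s + t)
  | pair {f g : Prog} {x y z : Data} {s t : ℕ} (hf : Prog.Runs f x y s)
      (hg : Prog.Runs g x z t) : Prog.Runs (.pair f g) x (.pair y z) (x.size + s + t)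
  | condTrue {c f g : Prog} {x b y : Data} {s t : ℕ} (hc : Prog.Runs c x b s)
      (hb : b ≠ .int 0) (hf : Prog.Runs f x y t) :
      Prog.Runs (.cond c f g) x y (x.size + s + t)
  | condFalse {c f g : Prog} {x y : Data} {s t : ℕ} (hc : Prog.Runs c x (.int 0) s)
      (hg : Prog.Runs g x y t) : Prog.Runs (.cond c f g) x y (x.size + s + t)
  | loopDone {c f : Prog} {x : Data} {s : ℕ} (hc : Prog.Runs c x (.int 0) s) :
      Prog.Runs (.loop c f) x x (x.size + s)
  | loopStep {c f : Prog} {x b y z : Data} {s t u : ℕ} (hc : Prog.Runs c x b s)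
      (hb : b ≠ .int 0) (hf : Prog.Runs f x y t) (hl : Prog.Runs (.loop c f) y z u) :
      Prog.Runs (.loop c f) x z (x.size + s + t + u)

/-! ### Sizes -/

/-! Correctness. Conjugation gives α'μ'(w) = αμ(w)B, and the columns of B are the vectors μ(w_j)β,
so the j-th entry of a forward vector of A' is the weight of w w_j in A, whichever A' was taken
(`BackwardConjugate.forward`). A non-integer entry is therefore a non-integer weight. If the search
ends normally, the ℤ-span of the forward vectors is stable under the transitions. The rows of F are
independent over ℚ as well, so the initial vector and the transition matrices of the result are the
unique coordinates with respect to F, and these are integers. An entry of the final vector is an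
integer combination of weights of words in W, which are integers because ε is among the w_j. For
minimality, the forward vectors factor through the state space of every equivalent automaton, so the
rank of F is at most its dimension (`correct_of_forwardConjugate`).

Number of steps. The two rational searches collect independent vectors, except that ε is kept even
if its vector vanishes, in which case all vectors vanish (`IndepOrZero`). For the integral search,
let U be the r words found by the rank search, V the matrix of their integral forward vectors, and δ
= ± det(V Vᵀ), which is nonzero unless all forward vectors vanish. Integral vectors in the rational
span of the rows of V have coordinates that become integers when multiplied by δ. This turns the
module into a lattice between δℤ^r and ℤ^r. Each word added makes its image modulo δ strictly
larger, hence at least twice as large (`RankBasis.latticeCard_append`), so the number of additions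
is at most r times the bit length of δ. The words in U are short, so δ has polynomially many digits.

The program. It makes the first available choice everywhere, and it never builds A', since weights
of A suffice. It uses integer arithmetic with explicitly bounded entries. Determinants and adjugates
come from the Faddeev–LeVerrier algorithm, whose divisions are exact (`faddeev_eq`,
`Matrix.faddeev_bound`). Membership in a rational span is tested by δv = (δ-fold coordinates)·V.
Lattice bases are triangular with entries reduced modulo δ² (`Hermite.span_basis`), and membership
in a lattice is a divisibility test (`mem_span_row_iff_dvd`).

Running times are handled by the relation `PolyTime`, which is closed under composition, case
distinction, tabulation, and loops with polynomially many rounds and polynomially long states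
(`PolyTime.while_loop`). What remains to be done by hand is to bound the lengths of the loop states
and the numbers of rounds. -/

theorem Nat.size_add_le (a b : ℕ) : Nat.size (a + b) ≤ Nat.size a + Nat.size b + 1 := by
  rw [Nat.size_le]
  have ha := Nat.lt_size_self a
  have hb := Nat.lt_size_self b
  have h1 : 2 ^ Nat.size a ≤ 2 ^ (Nat.size a + Nat.size b) :=
    Nat.pow_le_pow_right (by norm_num) (by omega)
  have h2 : 2 ^ Nat.size b ≤ 2 ^ (Nat.size a + Nat.size b) :=
    Nat.pow_le_pow_right (by norm_num) (by omega)
  rw [pow_succ]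
  omega

theorem Nat.size_mul_le (a b : ℕ) : Nat.size (a * b) ≤ Nat.size a + Nat.size b := by
  rw [Nat.size_le, pow_add]
  exact Nat.mul_lt_mul'' (Nat.lt_size_self a) (Nat.lt_size_self b)

theorem Nat.size_le_self (a : ℕ) : Nat.size a ≤ a := by
  rw [Nat.size_le]; exact Nat.lt_two_pow_self

namespace Data

theorem one_le_size (x : Data) : 1 ≤ x.size := by cases x <;> simp only [size] <;> omega

theorem size_fst_le (a b : Data) : a.size ≤ (pair a b).size := by simp [size]; omega

theorem size_int_le_of_natAbs_le {z : ℤ} {b : ℕ} (h : z.natAbs < 2 ^ b) :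
    (int z).size ≤ 1 + b := by
  simp only [size]; have := Nat.size_le.2 h; omega

theorem natAbs_lt_of_size_le {z : ℤ} {b : ℕ} (h : (int z).size ≤ b) : z.natAbs < 2 ^ b := by
  refine Nat.size_le.1 ?_; simp only [size] at h; omega

theorem size_ofList (l : List Data) : (ofList l).size = 1 + (l.map fun d => 1 + d.size).sum := by
  induction l with
  | nil => simp [ofList, size]
  | cons a l ih =>
    have : ofList (a :: l) = pair a (ofList l) := rfl
    rw [this, size, ih]; simp; omega

@[simp] theorem ofList_nil : ofList [] = int 0 := rfl

theorem ofList_cons (a : Data) (l : List Data) : ofList (a :: l) = pair a (ofList l) := rfl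

theorem size_ofList_le {l : List Data} {B : ℕ} (h : ∀ d ∈ l, d.size ≤ B) :
    (ofList l).size ≤ 1 + l.length * (1 + B) := by
  rw [size_ofList]
  have := List.sum_le_card_nsmul (l.map fun d => 1 + d.size) (1 + B) (by
    intro x hx
    obtain ⟨d, hd, rfl⟩ := List.mem_map.1 hx
    have := h d hd; omega)
  simpa using this

theorem length_le_size_ofList (l : List Data) : l.length ≤ (ofList l).size := by
  induction l with
  | nil => simp
  | cons a l ih => rw [ofList_cons, size]; simp; omega

theorem size_le_of_mem {l : List Data} {d : Data} (h : d ∈ l) : d.size ≤ (ofList l).size := by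
  induction l with
  | nil => simp at h
  | cons a l ih =>
    rw [ofList_cons, size]
    rcases List.mem_cons.1 h with rfl | h
    · omega
    · have := ih h; omega

theorem size_ofList_drop_le (l : List Data) (i : ℕ) :
    (ofList (l.drop i)).size ≤ (ofList l).size := by
  induction l generalizing i with
  | nil => simp
  | cons a l ih =>
    cases i with
    | zero => simp
    | succ i => rw [List.drop_succ_cons, ofList_cons, size]; have := ih i; omega

end Data

theorem Op.size_eval_le (o : Op) (x : Data) : (o.eval x).size ≤ o.cost x := by
  have h1 := Data.one_le_size x
  cases o with
  | id => simp [eval, cost]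
  | const z => simp [eval, cost]
  | fst =>
    cases x <;> simp [eval, cost, Data.size]
    omega
  | snd => cases x <;> simp [eval, cost, Data.size]
  | isPair =>
    cases x with
    | int z => simp [eval, cost, Data.size]
    | pair a b =>
      have := a.one_le_size
      have := b.one_le_size
      simp [eval, cost, Data.size]; omega
  | add =>
    rcases x with z | ⟨a | ⟨a, a'⟩, b | ⟨b, b'⟩⟩ <;> simp [eval, cost, Data.size] <;>
      try omega
    have := Nat.size_le_size (Int.natAbs_add_le a b)
    have := Nat.size_add_le a.natAbs b.natAbs
    omega
  | sub =>
    rcases x with z | ⟨a | ⟨a, a'⟩, b | ⟨b, b'⟩⟩ <;> simp [eval, cost, Data.size] <;>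
      try omega
    have := Nat.size_le_size (Int.natAbs_sub_le a b)
    have := Nat.size_add_le a.natAbs b.natAbs
    omega
  | mul =>
    rcases x with z | ⟨a | ⟨a, a'⟩, b | ⟨b, b'⟩⟩ <;> simp [eval, cost, Data.size]
    have := Nat.size_mul_le a.natAbs b.natAbs
    rw [Int.natAbs_mul]
    nlinarith
  | div =>
    rcases x with z | ⟨a | ⟨a, a'⟩, b | ⟨b, b'⟩⟩ <;> simp [eval, cost, Data.size]
    have := Nat.size_le_size (Int.natAbs_ediv_le_natAbs a b)
    nlinarith [Nat.zero_le (b.natAbs.size), Nat.zero_le (a.natAbs.size * b.natAbs.size)]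
  | le =>
    rcases x with z | ⟨a | ⟨a, a'⟩, b | ⟨b, b'⟩⟩ <;> simp [eval, cost, Data.size] <;>
      try omega
    split_ifs <;> simp <;> omega

/-- Every operation is charged at least the length of its result, so a time bound also bounds the
output. This is what makes polynomial-time functions compose. -/
theorem Prog.Runs.size_le {P : Prog} {x y : Data} {t : ℕ} (h : P.Runs x y t) : y.size ≤ t := by
  induction h with
  | op o x => exact o.size_eval_le x
  | comp _ _ _ ih => omega
  | @pair _ _ x _ _ _ _ _ _ h1 h2 =>
    have := x.one_le_size
    simp only [Data.size]; omega
  | condTrue => omega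
  | condFalse => omega
  | loopDone => omega
  | loopStep => omega

/-! ### Polynomial bounds -/

theorem Polynomial.eval_mono_nat (p : Polynomial ℕ) {a b : ℕ} (h : a ≤ b) :
    p.eval a ≤ p.eval b := by
  rw [Polynomial.eval_eq_sum, Polynomial.eval_eq_sum]
  exact Finset.sum_le_sum fun i _ => Nat.mul_le_mul_left _ (Nat.pow_le_pow_left h i)

/-- `g` is bounded by a polynomial in the length of the encoding `e`. -/
def PolyBounded {X : Type} (e : X → Data) (g : X → ℕ) : Prop :=
  ∃ p : Polynomial ℕ, ∀ x, g x ≤ p.eval (e x).size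

namespace PolyBounded

variable {X Y : Type} {e : X → Data} {g h : X → ℕ}

theorem size (e : X → Data) : PolyBounded e fun x => (e x).size :=
  ⟨Polynomial.X, fun x => by simp⟩

theorem const (c : ℕ) : PolyBounded e fun _ => c := ⟨Polynomial.C c, fun x => by simp⟩

theorem add (hg : PolyBounded e g) (hh : PolyBounded e h) :
    PolyBounded e fun x => g x + h x := by
  obtain ⟨p, hp⟩ := hg
  obtain ⟨q, hq⟩ := hh
  exact ⟨p + q, fun x => by simpa using Nat.add_le_add (hp x) (hq x)⟩

theorem mul (hg : PolyBounded e g) (hh : PolyBounded e h) :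
    PolyBounded e fun x => g x * h x := by
  obtain ⟨p, hp⟩ := hg
  obtain ⟨q, hq⟩ := hh
  exact ⟨p * q, fun x => by simpa using Nat.mul_le_mul (hp x) (hq x)⟩

theorem mono (hh : PolyBounded e h) (hgh : ∀ x, g x ≤ h x) : PolyBounded e g := by
  obtain ⟨p, hp⟩ := hh
  exact ⟨p, fun x => (hgh x).trans (hp x)⟩

theorem reindex (hg : PolyBounded e g) (φ : Y → X) :
    PolyBounded (fun y => e (φ y)) fun y => g (φ y) := by
  obtain ⟨p, hp⟩ := hg
  exact ⟨p, fun x => hp _⟩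

/-- A bound in terms of a shorter encoding. -/
theorem of_size_le {f : X → Data} (hg : PolyBounded f g)
    (hf : PolyBounded e fun x => (f x).size) : PolyBounded e g := by
  obtain ⟨p, hp⟩ := hg
  obtain ⟨q, hq⟩ := hf
  exact ⟨p.comp q, fun x => by
    rw [Polynomial.eval_comp]; exact (hp x).trans (p.eval_mono_nat (hq x))⟩

end PolyBounded

/-! ### Functions computable in polynomial time -/

/-- Some program computes `f x` from `e x` for all `x`, in time polynomial in the length of
`e x`. -/
def PolyTime {X : Type} (e f : X → Data) : Prop :=
  ∃ (P : Prog) (p : Polynomial ℕ), ∀ x, ∃ t, P.Runs (e x) (f x) t ∧ t ≤ p.eval (e x).size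

namespace PolyTime

variable {X Y : Type} {e f g : X → Data}

theorem size (hf : PolyTime e f) : PolyBounded e fun x => (f x).size := by
  obtain ⟨P, p, h⟩ := hf
  exact ⟨p, fun x => by obtain ⟨t, ht, hb⟩ := h x; exact ht.size_le.trans hb⟩

theorem reindex (hf : PolyTime e f) (φ : Y → X) :
    PolyTime (fun y => e (φ y)) fun y => f (φ y) := by
  obtain ⟨P, p, h⟩ := hf
  exact ⟨P, p, fun y => h _⟩

theorem congr (hf : PolyTime e f) (h : ∀ x, f x = g x) : PolyTime e g := by
  rwa [show g = f from funext fun x => (h x).symm]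

theorem trans (hf : PolyTime e f) (hg : PolyTime f g) : PolyTime e g := by
  have hs := hf.size
  obtain ⟨P, p, hP⟩ := hf
  obtain ⟨Q, q, hQ⟩ := hg
  obtain ⟨r, hr⟩ := hs
  refine ⟨.comp P Q, 1 + p + q.comp r, fun x => ?_⟩
  obtain ⟨s, hs, hsb⟩ := hP x
  obtain ⟨t, ht, htb⟩ := hQ x
  refine ⟨_, .comp hs ht, ?_⟩
  have := htb.trans (q.eval_mono_nat (hr x))
  simp only [Polynomial.eval_add, Polynomial.eval_one, Polynomial.eval_comp]
  omega

theorem pair (hf : PolyTime e f) (hg : PolyTime e g) :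
    PolyTime e fun x => .pair (f x) (g x) := by
  obtain ⟨P, p, hP⟩ := hf
  obtain ⟨Q, q, hQ⟩ := hg
  refine ⟨.pair P Q, Polynomial.X + p + q, fun x => ?_⟩
  obtain ⟨s, hs, hsb⟩ := hP x
  obtain ⟨t, ht, htb⟩ := hQ x
  refine ⟨_, .pair hs ht, ?_⟩
  simp only [Polynomial.eval_add, Polynomial.eval_X]
  omega

theorem op (o : Op) (hf : PolyTime e f) : PolyTime e fun x => o.eval (f x) := by
  -- `X ^ 2` pays for the product of two component lengths in `mul` and `div`; the last summand pays
  -- for the literal written by `const`.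
  refine hf.trans ⟨.op o, 2 + Polynomial.X ^ 2 + Polynomial.X +
    (match o with | .const z => Polynomial.C (Data.int z).size | _ => 0), fun x => ⟨_, .op o _, ?_⟩⟩
  have h1 := (f x).one_le_size
  rcases o with _ | z | _ | _ | _ | _ | _ | _ | _ | _ <;>
    simp only [Op.cost, Polynomial.eval_add, Polynomial.eval_pow, Polynomial.eval_X,
      Polynomial.eval_C, Polynomial.eval_ofNat, Polynomial.eval_zero] <;> try omega
  all_goals
    cases h : f x with
    | int z => simp only; omega
    | pair a b =>
      simp only [Data.size]
      have : a.size * b.size ≤ (1 + a.size + b.size) ^ 2 := by nlinarith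
      omega

theorem id (e : X → Data) : PolyTime e e :=
  ⟨.op .id, Polynomial.X, fun x => ⟨_, .op .id _, by simp [Op.cost]⟩⟩

theorem const (d : Data) : PolyTime e fun _ => d := by
  induction d with
  | int z => exact op (.const z) (id e)
  | pair a b ha hb => exact ha.pair hb

theorem fst (h : PolyTime e fun x => .pair (f x) (g x)) : PolyTime e f := h.op .fst

theorem snd (h : PolyTime e fun x => .pair (f x) (g x)) : PolyTime e g := h.op .snd

theorem comp_fst (hf : PolyTime e f) (g : X → Data) :
    PolyTime (fun x => .pair (e x) (g x)) f := (fst (id _)).trans hf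

/-- A value computed in polynomial time from `e` can be computed from any pair with first
component `e`. -/
theorem weaken (hf : PolyTime e f) (φ : Y → X) (g : Y → Data) :
    PolyTime (fun y => .pair (e (φ y)) (g y)) fun y => f (φ y) :=
  comp_fst (hf.reindex φ) g

/-- Each branch only has to be computable on the inputs that select it, whence the subtypes: some
later branches make sense, or are fast, only under the tested condition. -/
theorem condData {c : X → Data} (hc : PolyTime e c)
    (hf : PolyTime (fun x : {x // c x ≠ .int 0} => e x) fun x => f x)
    (hg : PolyTime (fun x : {x // c x = .int 0} => e x) fun x => g x)
    {h : X → Data} (h1 : ∀ x, c x ≠ .int 0 → h x = f x) (h0 : ∀ x, c x = .int 0 → h x = g x) :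
    PolyTime e h := by
  obtain ⟨C, c', hC⟩ := hc
  obtain ⟨P, p, hP⟩ := hf
  obtain ⟨Q, q, hQ⟩ := hg
  refine ⟨.cond C P Q, Polynomial.X + c' + (p + q), fun x => ?_⟩
  obtain ⟨s, hs, hsb⟩ := hC x
  by_cases hx : c x = .int 0
  · obtain ⟨t, ht, htb⟩ := hQ ⟨x, hx⟩
    rw [h0 x hx]
    refine ⟨_, .condFalse (hx ▸ hs) ht, ?_⟩
    simp only [Polynomial.eval_add, Polynomial.eval_X] at *
    omega
  · obtain ⟨t, ht, htb⟩ := hP ⟨x, hx⟩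
    rw [h1 x hx]
    refine ⟨_, .condTrue hs hx ht, ?_⟩
    simp only [Polynomial.eval_add, Polynomial.eval_X] at *
    omega

/-- While loops: `s x i` is the value after `i` rounds, the loop stops after `n x` rounds. -/
theorem while_loop {n : X → ℕ} (hn : PolyBounded e n) {s c : X → ℕ → Data}
    (h0 : PolyTime e fun x => s x 0)
    (hsize : PolyBounded (fun p : Σ x, Fin (n x + 1) => e p.1) fun p => (s p.1 p.2).size)
    (hc : PolyTime (fun p : Σ x, Fin (n x + 1) => .pair (e p.1) (s p.1 p.2))
      fun p => c p.1 p.2)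
    (hc1 : ∀ x i, i < n x → c x i ≠ .int 0) (hc0 : ∀ x, c x (n x) = .int 0)
    (hs : PolyTime (fun p : Σ x, Fin (n x) => .pair (e p.1) (s p.1 p.2))
      fun p => s p.1 (p.2 + 1)) :
    PolyTime e fun x => s x (n x) := by
  -- The loop carries the input along with the state, since the guard and the body may need it.
  have hF : PolyTime (fun p : Σ x, Fin (n x) => .pair (e p.1) (s p.1 p.2))
      fun p => .pair (e p.1) (s p.1 (p.2 + 1)) := (fst (id _)).pair hs
  refine ((id e).pair h0).trans ?_
  suffices h : PolyTime (fun x => .pair (e x) (s x 0)) fun x => .pair (e x) (s x (n x)) from h.snd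
  obtain ⟨C, c', hC⟩ := hc
  obtain ⟨F, f', hF⟩ := hF
  obtain ⟨z, hz⟩ := hsize
  obtain ⟨m, hm⟩ := hn
  -- `Z` bounds the length of the value in every round and `B` the cost of one round. The factor `m
  -- + 1` accounts for the last evaluation of the guard.
  let Z : Polynomial ℕ := 1 + Polynomial.X + z
  let B : Polynomial ℕ := Z + c'.comp Z + f'.comp Z
  refine ⟨.loop C F, (m + 1) * B, fun x => ?_⟩
  have hZ : ∀ i : ℕ, i ≤ n x → (Data.pair (e x) (s x i)).size ≤ Z.eval (e x).size := by
    intro i hi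
    have := hz ⟨x, i, by omega⟩
    simp only [Data.size, Z, Polynomial.eval_add, Polynomial.eval_one, Polynomial.eval_X] at *
    omega
  have key : ∀ j i : ℕ, i + j = n x → ∃ t, (Prog.loop C F).Runs (.pair (e x) (s x i))
      (.pair (e x) (s x (n x))) t ∧ t ≤ (j + 1) * B.eval (e x).size := by
    intro j
    induction j with
    | zero =>
      intro i hi
      obtain rfl : i = n x := by omega
      obtain ⟨t, ht, htb⟩ := hC ⟨x, n x, by omega⟩
      simp only [hc0] at ht
      refine ⟨_, .loopDone ht, ?_⟩
      have h1 := hZ (n x) le_rfl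
      have h2 := htb.trans (c'.eval_mono_nat h1)
      simp only [B, Polynomial.eval_add, Polynomial.eval_comp] at *
      omega
    | succ j ih =>
      intro i hi
      obtain ⟨t, ht, htb⟩ := hC ⟨x, i, by omega⟩
      obtain ⟨u, hu, hub⟩ := hF ⟨x, i, by omega⟩
      obtain ⟨v, hv, hvb⟩ := ih (i + 1) (by omega)
      refine ⟨_, .loopStep ht (hc1 x i (by omega)) hu hv, ?_⟩
      have h1 := hZ i (by omega)
      have h2 := htb.trans (c'.eval_mono_nat h1)
      have h3 := hub.trans (f'.eval_mono_nat h1)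
      rw [add_mul, one_mul]
      simp only [B, Polynomial.eval_add, Polynomial.eval_comp] at *
      omega
  obtain ⟨t, ht, htb⟩ := key (n x) 0 (by omega)
  refine ⟨t, ht, htb.trans ?_⟩
  rw [Polynomial.eval_mul, Polynomial.eval_add (p := m), Polynomial.eval_one]
  have h1 : (e x).size ≤ (Data.pair (e x) (s x 0)).size := Data.size_fst_le _ _
  exact Nat.mul_le_mul (Nat.add_le_add_right ((hm x).trans (m.eval_mono_nat h1)) 1)
    (B.eval_mono_nat h1)

end PolyTime

/-! ### Integers and decisions -/

/-- The natural numbers `n x` are computable in polynomial time and polynomially bounded. -/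
def PolyTimeNat {X : Type} (e : X → Data) (n : X → ℕ) : Prop :=
  PolyTime e (fun x => .int (n x)) ∧ PolyBounded e n

open Classical in
/-- The truth value of `p x` is computable in polynomial time. -/
def PolyTimeDec {X : Type} (e : X → Data) (p : X → Prop) : Prop :=
  PolyTime e fun x => .int (if p x then 1 else 0)

/-- The integer `z x` is computable in polynomial time. -/
def PolyTimeInt {X : Type} (e : X → Data) (z : X → ℤ) : Prop := PolyTime e fun x => .int (z x)

section

variable {X Y : Type} {e f g : X → Data}

namespace PolyTimeInt

variable {a b : X → ℤ}

theorem congr (ha : PolyTimeInt e a) (h : ∀ x, a x = b x) : PolyTimeInt e b :=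
  PolyTime.congr ha fun x => by rw [h]

theorem const (z : ℤ) : PolyTimeInt e fun _ => z := PolyTime.const (.int z)

theorem add (ha : PolyTimeInt e a) (hb : PolyTimeInt e b) : PolyTimeInt e fun x => a x + b x :=
  (PolyTime.pair ha hb).op .add

theorem sub (ha : PolyTimeInt e a) (hb : PolyTimeInt e b) : PolyTimeInt e fun x => a x - b x :=
  (PolyTime.pair ha hb).op .sub

theorem mul (ha : PolyTimeInt e a) (hb : PolyTimeInt e b) : PolyTimeInt e fun x => a x * b x :=
  (PolyTime.pair ha hb).op .mul

theorem div (ha : PolyTimeInt e a) (hb : PolyTimeInt e b) : PolyTimeInt e fun x => a x / b x :=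
  (PolyTime.pair ha hb).op .div

theorem neg (ha : PolyTimeInt e a) : PolyTimeInt e fun x => -a x :=
  ((const 0).sub ha).congr fun x => by simp

theorem mod (ha : PolyTimeInt e a) (hb : PolyTimeInt e b) : PolyTimeInt e fun x => a x % b x :=
  (ha.sub (hb.mul (ha.div hb))).congr fun _ => (Int.emod_def _ _).symm

theorem le (ha : PolyTimeInt e a) (hb : PolyTimeInt e b) : PolyTimeDec e fun x => a x ≤ b x :=
  ((PolyTime.pair ha hb).op .le).congr fun x => by simp [Op.eval]

theorem size (ha : PolyTimeInt e a) : PolyBounded e fun x => (Data.int (a x)).size :=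
  PolyTime.size ha

end PolyTimeInt

namespace PolyTimeDec

variable {p q : X → Prop}

theorem congr (hp : PolyTimeDec e p) (h : ∀ x, p x ↔ q x) : PolyTimeDec e q :=
  by
  rwa [show q = p from funext fun x => propext (h x).symm]

theorem ite (hp : PolyTimeDec e p) [DecidablePred p]
    (hf : PolyTime (fun x : {x // p x} => e x) fun x => f x)
    (hg : PolyTime (fun x : {x // ¬ p x} => e x) fun x => g x) :
    PolyTime e fun x => if p x then f x else g x := by
  -- `PolyTimeDec` is stated with classical decidability; all instances agree.
  obtain rfl : ‹DecidablePred p› = fun x => Classical.propDecidable _ := Subsingleton.elim _ _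
  refine PolyTime.condData hp (f := f) (g := g) ?_ ?_ ?_ ?_
  · exact hf.reindex (fun x : {x // Data.int (@_root_.ite _ (p x) (Classical.propDecidable _) 1 0) ≠ .int 0} =>
      ⟨x.1, by have := x.2; by_contra h; simp [h] at this⟩)
  · exact hg.reindex (fun x : {x // Data.int (@_root_.ite _ (p x) (Classical.propDecidable _) 1 0) = .int 0} =>
      ⟨x.1, by have := x.2; intro h; simp [h] at this⟩)
  · intro x hx
    rw [if_pos]; by_contra h; simp [h] at hx
  · intro x hx
    rw [if_neg]; intro h; simp [h] at hx

theorem ite' (hp : PolyTimeDec e p) [DecidablePred p] (hf : PolyTime e f) (hg : PolyTime e g) :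
    PolyTime e fun x => if p x then f x else g x :=
  hp.ite (hf.reindex _) (hg.reindex _)

theorem not (hp : PolyTimeDec e p) : PolyTimeDec e fun x => ¬ p x := by
  classical
  exact (hp.ite' (PolyTime.const (.int 0)) (PolyTime.const (.int 1))).congr fun x => by
    by_cases h : p x <;> simp [h]

theorem and (hp : PolyTimeDec e p) (hq : PolyTimeDec e q) : PolyTimeDec e fun x => p x ∧ q x := by
  classical
  exact (hp.ite' hq (PolyTime.const (.int 0))).congr fun x => by
    by_cases h : p x <;> simp [h]

theorem reindex (hp : PolyTimeDec e p) (φ : Y → X) :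
    PolyTimeDec (fun y => e (φ y)) fun y => p (φ y) := PolyTime.reindex hp φ

end PolyTimeDec

theorem PolyTime.trans_dec {p : X → Prop} (hf : PolyTime e f) (hp : PolyTimeDec f p) :
    PolyTimeDec e p := hf.trans hp

theorem PolyBounded.trans {n : X → ℕ} (hf : PolyTime e f) (hn : PolyBounded f n) :
    PolyBounded e n := hn.of_size_le hf.size

theorem PolyTime.trans_nat {n : X → ℕ} (hf : PolyTime e f) (hn : PolyTimeNat f n) :
    PolyTimeNat e n := ⟨hf.trans hn.1, hn.2.trans hf⟩

theorem PolyTimeInt.eq {a b : X → ℤ} (ha : PolyTimeInt e a) (hb : PolyTimeInt e b) :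
    PolyTimeDec e fun x => a x = b x :=
  ((ha.le hb).and (hb.le ha)).congr fun _ => le_antisymm_iff.symm

theorem PolyTimeInt.lt {a b : X → ℤ} (ha : PolyTimeInt e a) (hb : PolyTimeInt e b) :
    PolyTimeDec e fun x => a x < b x :=
  (hb.le ha).not.congr fun x => by simp

theorem PolyTimeInt.dvd {a b : X → ℤ} (ha : PolyTimeInt e a) (hb : PolyTimeInt e b) :
    PolyTimeDec e fun x => a x ∣ b x :=
  ((hb.mod ha).eq (.const 0)).congr fun _ => Int.dvd_iff_emod_eq_zero.symm

namespace PolyTimeNat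

variable {m n : X → ℕ}

theorem int (hn : PolyTimeNat e n) : PolyTimeInt e fun x => (n x : ℤ) := hn.1

theorem const (c : ℕ) : PolyTimeNat e fun _ => c := ⟨PolyTimeInt.const c, .const c⟩

theorem add (hm : PolyTimeNat e m) (hn : PolyTimeNat e n) : PolyTimeNat e fun x => m x + n x :=
  ⟨(hm.int.add hn.int).congr fun x => by push_cast; rfl, hm.2.add hn.2⟩

theorem mul (hm : PolyTimeNat e m) (hn : PolyTimeNat e n) : PolyTimeNat e fun x => m x * n x :=
  ⟨(hm.int.mul hn.int).congr fun x => by push_cast; rfl, hm.2.mul hn.2⟩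

theorem div (hm : PolyTimeNat e m) (hn : PolyTimeNat e n) : PolyTimeNat e fun x => m x / n x :=
  ⟨(hm.int.div hn.int).congr fun x => by push_cast; rfl,
    hm.2.mono fun _ => Nat.div_le_self _ _⟩

theorem mod (hm : PolyTimeNat e m) (hn : PolyTimeNat e n) : PolyTimeNat e fun x => m x % n x :=
  ⟨(hm.int.mod hn.int).congr fun x => by push_cast; rfl,
    hm.2.mono fun _ => Nat.mod_le _ _⟩

theorem sub (hm : PolyTimeNat e m) (hn : PolyTimeNat e n) : PolyTimeNat e fun x => m x - n x := by
  refine ⟨?_, hm.2.mono fun _ => Nat.sub_le _ _⟩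
  refine ((hn.int.le hm.int).ite' (hm.int.sub hn.int) (PolyTimeInt.const 0)).congr fun x => ?_
  simp only
  split_ifs with h
  · rw [Nat.cast_sub (by exact_mod_cast h)]
  · rw [Nat.sub_eq_zero_of_le (by push Not at h; exact_mod_cast h.le : m x ≤ n x)]; rfl

theorem reindex (hn : PolyTimeNat e n) (φ : Y → X) :
    PolyTimeNat (fun y => e (φ y)) fun y => n (φ y) := ⟨hn.1.reindex φ, hn.2.reindex φ⟩

theorem lt (hm : PolyTimeNat e m) (hn : PolyTimeNat e n) : PolyTimeDec e fun x => m x < n x :=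
  (hm.int.lt hn.int).congr fun x => by simp

theorem eq (hm : PolyTimeNat e m) (hn : PolyTimeNat e n) : PolyTimeDec e fun x => m x = n x :=
  (hm.int.eq hn.int).congr fun x => by simp

theorem congr (hm : PolyTimeNat e m) (h : ∀ x, m x = n x) : PolyTimeNat e n := by
  rwa [show n = m from funext fun x => (h x).symm]

end PolyTimeNat

/-! ### Bounded loops -/

/-- The encoding of a context extended by an index. -/
def withIndex (e : X → Data) (n : X → ℕ) (p : Σ x, Fin (n x)) : Data :=
  .pair (e p.1) (.int ((p.2 : ℕ) : ℤ))

theorem PolyTime.indexed {n : X → ℕ} (hf : PolyTime e f) :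
    PolyTime (withIndex e n) fun p => f p.1 := hf.weaken _ _

theorem PolyTimeNat.index {n : X → ℕ} (hn : PolyBounded e n) :
    PolyTimeNat (withIndex e n) fun p => p.2 := by
  refine ⟨(PolyTime.id _).snd, ?_⟩
  have h : PolyBounded (withIndex e n) fun p => n p.1 :=
    (hn.reindex Sigma.fst).trans ((PolyTime.id e).indexed)
  exact h.mono fun p => p.2.2.le

theorem PolyBounded.indexed {m n : X → ℕ} (hm : PolyBounded e m) :
    PolyBounded (withIndex e n) fun p => m p.1 :=
  (hm.reindex Sigma.fst).trans ((PolyTime.id e).indexed)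

theorem PolyTimeNat.indexed {m n : X → ℕ} (hm : PolyTimeNat e m) :
    PolyTimeNat (withIndex e n) fun p => m p.1 := ⟨PolyTime.indexed hm.1, hm.2.indexed⟩

theorem PolyTimeInt.indexed {z : X → ℤ} {n : X → ℕ} (hz : PolyTimeInt e z) :
    PolyTimeInt (withIndex e n) fun p => z p.1 := PolyTime.indexed hz

/-- Loops with a fixed number of rounds. -/
theorem PolyTime.iter {n : X → ℕ} (hn : PolyTimeNat e n) {s : X → ℕ → Data}
    (h0 : PolyTime e fun x => s x 0)
    (hsize : PolyBounded (fun p : Σ x, Fin (n x + 1) => e p.1) fun p => (s p.1 p.2).size)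
    (hs : PolyTime (fun p : Σ x, Fin (n x) => .pair (withIndex e n p) (s p.1 p.2))
      fun p => s p.1 (p.2 + 1)) :
    PolyTime e fun x => s x (n x) := by
  have h : PolyTime e fun x => .pair (.int (n x)) (s x (n x)) := by
    -- The round number is kept in the state and compared with `n x`, which the guard recomputes.
    refine PolyTime.while_loop (s := fun x i => .pair (.int i) (s x i))
      (c := fun x i => .int (if i < n x then 1 else 0)) hn.2 ?_ ?_ ?_ ?_ ?_ ?_
    · exact (PolyTime.const (.int 0)).pair h0
    · refine (((PolyBounded.size _).mul (.const 0)).add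
        (((hn.2.reindex (Sigma.fst : (Σ x, Fin (n x + 1)) → X)).add (.const 2)).add hsize)).mono ?_
      rintro ⟨x, i⟩
      have h1 : Nat.size i ≤ i := Nat.size_le_self _
      have h2 := i.2
      simp only [Data.size, Int.natAbs_natCast]
      omega
    · have hi : PolyTimeInt (fun p : Σ x, Fin (n x + 1) =>
          .pair (e p.1) (.pair (.int (p.2 : ℕ)) (s p.1 p.2))) fun p => ((p.2 : ℕ) : ℤ) :=
        (PolyTime.id _).snd.fst
      exact PolyTime.congr (hi.lt (hn.1.weaken Sigma.fst _)) fun p => by simp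
    · intro x i hi; simp [hi]
    · intro x; simp
    · have hid := PolyTime.id (fun p : Σ x, Fin (n x) =>
          .pair (e p.1) (.pair (.int (p.2 : ℕ)) (s p.1 p.2)))
      have hi : PolyTimeInt (fun p : Σ x, Fin (n x) =>
          .pair (e p.1) (.pair (.int (p.2 : ℕ)) (s p.1 p.2))) fun p => ((p.2 : ℕ) : ℤ) :=
        hid.snd.fst
      refine PolyTime.pair ((hi.add (.const 1)).congr fun p => by push_cast; rfl) ?_
      exact ((hid.fst.pair hid.snd.fst).pair hid.snd.snd).trans hs
  exact h.snd

/-- Loops that are iterated until a fixed point is reached. -/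
theorem PolyTime.while_fixpoint {K : X → ℕ} (hK : PolyBounded e K) {s : X → ℕ → Data}
    {p : X → ℕ → Prop}
    (h0 : PolyTime e fun x => s x 0)
    (hsize : PolyBounded (fun p : Σ x, Fin (K x + 1) => e p.1) fun p => (s p.1 p.2).size)
    (hp : PolyTimeDec (fun p : Σ x, Fin (K x + 1) => .pair (e p.1) (s p.1 p.2))
      fun q => p q.1 q.2)
    (hp1 : ∀ x i, ¬ p x i → s x (i + 1) = s x i ∧ ¬ p x (i + 1)) (hpK : ∀ x, ¬ p x (K x))
    (hs : PolyTime (fun p : Σ x, Fin (K x) => .pair (e p.1) (s p.1 p.2))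
      fun p => s p.1 (p.2 + 1)) :
    PolyTime e fun x => s x (K x) := by
  classical
  have hex : ∀ x, ∃ i, ¬ p x i := fun x => ⟨_, hpK x⟩
  -- The first round at which the guard fails. From there on the states are constant, so the value
  -- after `K x` rounds is obtained although `K` is only bounded and not assumed computable.
  let n : X → ℕ := fun x => Nat.find (hex x)
  have hn : ∀ x, n x ≤ K x := fun x => Nat.find_min' _ (hpK x)
  have hstable : ∀ x j, s x (n x + j) = s x (n x) ∧ ¬ p x (n x + j) := by
    intro x j
    induction j with
    | zero => exact ⟨rfl, Nat.find_spec (hex x)⟩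
    | succ j ih =>
      have := hp1 x _ ih.2
      exact ⟨this.1.trans ih.1, this.2⟩
  have main : PolyTime e fun x => s x (n x) := by
    refine PolyTime.while_loop (c := fun x i => .int (if p x i then 1 else 0))
      (hK.mono hn) h0 ?_ ?_ ?_ ?_ ?_
    · exact hsize.reindex fun q : Σ x, Fin (n x + 1) =>
        ⟨q.1, ⟨q.2, by have := hn q.1; have := q.2.2; omega⟩⟩
    · exact PolyTime.reindex hp fun q : Σ x, Fin (n x + 1) =>
        ⟨q.1, ⟨q.2, by have := hn q.1; have := q.2.2; omega⟩⟩
    · intro x i hi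
      have : p x i := not_not.1 (Nat.find_min (hex x) hi)
      simp [this]
    · intro x
      have := Nat.find_spec (hex x)
      simp only [n]; rw [if_neg this]
    · exact hs.reindex fun q : Σ x, Fin (n x) =>
        ⟨q.1, ⟨q.2, by have := hn q.1; have := q.2.2; omega⟩⟩
  refine main.congr fun x => ?_
  have := (hstable x (K x - n x)).1
  rw [Nat.add_sub_cancel' (hn x)] at this
  exact this.symm

end

section

variable {X Y : Type} {e f g : X → Data}

/-! ### Lists -/

namespace PolyBounded

/-- The length of an index below `n x` is at most `n x` up to a constant, so a bound that involves
the index can be replaced by one that depends on `x` alone. -/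
theorem exists_bound {n : X → ℕ} {h : (Σ x, Fin (n x)) → ℕ} (hh : PolyBounded (withIndex e n) h)
    (hn : PolyBounded e n) :
    ∃ B : X → ℕ, PolyBounded e B ∧ ∀ x i, h ⟨x, i⟩ ≤ B x := by
  obtain ⟨p, hp⟩ := hh
  obtain ⟨q, hq⟩ := hn
  refine ⟨fun x => p.eval ((2 + Polynomial.X + q).eval (e x).size),
    ⟨p.comp (2 + Polynomial.X + q), fun x => by rw [Polynomial.eval_comp]⟩, fun x i => ?_⟩
  refine (hp ⟨x, i⟩).trans (p.eval_mono_nat ?_)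
  have h1 : Nat.size i ≤ i := Nat.size_le_self _
  have h2 := hq x
  have h3 := i.2
  simp only [withIndex, Data.size, Polynomial.eval_add, Polynomial.eval_X, Polynomial.eval_ofNat,
    Int.natAbs_natCast]
  omega

theorem sigma {B n : X → ℕ} (hB : PolyBounded e B) {h : (Σ x, Fin (n x)) → ℕ}
    (hh : ∀ x i, h ⟨x, i⟩ ≤ B x) : PolyBounded (fun p : Σ x, Fin (n x) => e p.1) h :=
  (hB.reindex Sigma.fst).mono fun p => hh p.1 p.2

end PolyBounded

theorem Data.size_ofList_append_le (l₁ l₂ : List Data) :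
    (ofList (l₁ ++ l₂)).size ≤ (ofList l₁).size + (ofList l₂).size := by
  simp only [Data.size_ofList, List.map_append, List.sum_append]; omega

namespace PolyTime

theorem nth {l : X → List Data} (hl : PolyTime e fun x => .ofList (l x)) {i : X → ℕ}
    (hi : PolyTimeNat e i) : PolyTime e fun x => (l x).getD (i x) (.int 0) := by
  have h : PolyTime e fun x => .ofList ((l x).drop (i x)) := by
    refine iter (s := fun x j => .ofList ((l x).drop j)) hi hl
      (hl.size.sigma fun x j => Data.size_ofList_drop_le _ _) ?_
    refine ((id _).snd.op .snd).congr ?_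
    rintro ⟨x, j, hj⟩
    -- `Op.snd` sends the empty list `int 0` to itself, as `drop` does; likewise `Op.fst` yields the
    -- default `int 0` below.
    change Op.snd.eval (.ofList ((l x).drop j)) = .ofList ((l x).drop (j + 1))
    rw [← List.drop_drop]
    cases (l x).drop j <;> rfl
  refine (h.op .fst).congr fun x => ?_
  rw [List.getD_eq_getElem?_getD, ← List.head?_drop]
  cases (l x).drop (i x) <;> rfl

/-- The loop removes heads and counts them. Its guard is `isPair`, which is nonzero exactly on the
encodings of nonempty lists. -/
theorem length {l : X → List Data} (hl : PolyTime e fun x => .ofList (l x)) :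
    PolyTimeNat e fun x => (l x).length := by
  have hb : PolyBounded e fun x => (l x).length :=
    hl.size.mono fun x => Data.length_le_size_ofList _
  refine ⟨?_, hb⟩
  have h : PolyTime e fun x => .pair (.ofList ((l x).drop (l x).length)) (.int (l x).length) := by
    refine while_loop (s := fun x i => .pair (.ofList ((l x).drop i)) (.int i))
      (c := fun x i => Op.isPair.eval (.ofList ((l x).drop i))) hb (hl.pair (const (.int 0))) ?_
      ((id _).snd.fst.op .isPair) ?_ ?_ ?_
    · refine PolyBounded.sigma ((hl.size.add hb).add (.const 2)) ?_
      rintro x ⟨i, hi⟩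
      have h1 := Data.size_ofList_drop_le (l x) i
      have h2 := Nat.size_le_self i
      simp only [Data.size, Int.natAbs_natCast]
      omega
    · intro x i hi
      cases h : (l x).drop i with
      | nil => simp at h; omega
      | cons a t => simp [Data.ofList_cons, Op.eval]
    · intro x; simp [Op.eval]
    · refine pair (((id _).snd.fst.op .snd).congr ?_) ?_
      · rintro ⟨x, j, hj⟩
        change Op.snd.eval (.ofList ((l x).drop j)) = .ofList ((l x).drop (j + 1))
        rw [← List.drop_drop]
        cases (l x).drop j <;> rfl
      · have hi : PolyTimeInt (fun p : Σ x, Fin (l x).length =>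
          .pair (e p.1) (.pair (.ofList ((l p.1).drop p.2)) (.int (p.2 : ℕ)))) fun p =>
            ((p.2 : ℕ) : ℤ) := (id _).snd.snd
        exact (hi.add (.const 1)).congr fun p => by push_cast; rfl
  exact h.snd

/-- Lists grow at the front only, so the entries are produced from the last to the first, with index
`Fin.rev i` in round `i`. Starting from `l` instead of the empty list makes concatenation a special
case. -/
theorem tabulate_append {n : X → ℕ} (hn : PolyTimeNat e n) {g : (x : X) → Fin (n x) → Data}
    (hg : PolyTime (withIndex e n) fun p => g p.1 p.2) {l : X → List Data}
    (hl : PolyTime e fun x => .ofList (l x)) :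
    PolyTime e fun x => .ofList (List.ofFn (g x) ++ l x) := by
  obtain ⟨B, hB, hgB⟩ := hg.size.exists_bound hn.2
  have h := iter (s := fun x i => .ofList ((List.ofFn (g x)).drop (n x - i) ++ l x)) (e := e) hn
    (hl.congr fun x => by simp [List.drop_of_length_le]) ?_ ?_
  · exact h.congr fun x => by simp
  · refine PolyBounded.sigma (((PolyBounded.const 1).add
      (hn.2.mul ((PolyBounded.const 1).add hB))).add hl.size) ?_
    rintro x ⟨i, hi⟩
    refine (Data.size_ofList_append_le _ _).trans (Nat.add_le_add_right ?_ _)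
    refine (Data.size_ofList_drop_le _ _).trans ((Data.size_ofList_le (B := B x) ?_).trans ?_)
    · intro d hd
      obtain ⟨j, rfl⟩ := List.mem_ofFn.1 hd
      exact hgB x j
    · simp
  · have hrev : PolyTime (withIndex e n) fun p => withIndex e n ⟨p.1, p.2.rev⟩ := by
      refine pair (fst (id _)) ?_
      exact ((hn.indexed.sub (.const 1)).sub (PolyTimeNat.index hn.2)).1.congr fun p => by
        rw [Fin.val_rev, show n p.1 - (p.2 + 1) = n p.1 - 1 - p.2 by omega]
    have h2 : PolyTime (withIndex e n) fun p => g p.1 p.2.rev :=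
      hrev.trans (hg.reindex fun p : Σ x, Fin (n x) => ⟨p.1, p.2.rev⟩)
    refine ((h2.comp_fst _).pair (id _).snd).congr ?_
    rintro ⟨x, i, hi⟩
    rw [← Data.ofList_cons]
    simp only
    rw [List.drop_eq_getElem_cons (i := n x - (i + 1)) (by simp; omega), List.cons_append]
    congr 2
    · simp only [List.getElem_ofFn]; congr 1
    · congr 2; omega

theorem tabulate {n : X → ℕ} (hn : PolyTimeNat e n) {g : (x : X) → Fin (n x) → Data}
    (hg : PolyTime (withIndex e n) fun p => g p.1 p.2) :
    PolyTime e fun x => .ofList (List.ofFn (g x)) :=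
  (tabulate_append hn hg (l := fun _ => []) (const (.int 0))).congr fun x => by simp

theorem nthFn {n : X → ℕ} {g : (x : X) → Fin (n x) → Data}
    (hg : PolyTime e fun x => .ofList (List.ofFn (g x))) {i : (x : X) → Fin (n x)}
    (hi : PolyTime e fun x => .int ((i x : ℕ) : ℤ)) : PolyTime e fun x => g x (i x) := by
  have hb : PolyBounded e fun x => (i x : ℕ) := hg.size.mono fun x => by
    have := Data.length_le_size_ofList (List.ofFn (g x))
    have h2 := (i x).2
    simp at this; omega
  exact (nth hg ⟨hi, hb⟩).congr fun x => by
    rw [List.getD_eq_getElem _ _ (by simp)]; simp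

/-- The entry of a tabulated function at the loop index. -/
theorem nthFn_index {n : X → ℕ} {g : (x : X) → Fin (n x) → Data}
    (hg : PolyTime e fun x => .ofList (List.ofFn (g x))) :
    PolyTime (withIndex e n) fun p => g p.1 p.2 :=
  nthFn (g := fun p : Σ x, Fin (n x) => g p.1) (i := fun p => p.2) hg.indexed (id _).snd

theorem append {l₁ l₂ : X → List Data} (h₁ : PolyTime e fun x => .ofList (l₁ x))
    (h₂ : PolyTime e fun x => .ofList (l₂ x)) : PolyTime e fun x => .ofList (l₁ x ++ l₂ x) :=
  (tabulate_append h₁.length (g := fun x i => (l₁ x)[i])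
    (nthFn_index (g := fun x i => (l₁ x)[i]) (h₁.congr fun x => by simp)) h₂).congr fun x => by simp

end PolyTime

/-! ### Finite sums, products, quantifiers and searches -/

theorem PolyTimeInt.indexedSum_aux {n : X → ℕ} {z : (x : X) → Fin (n x) → ℤ} (x : X) (B : ℕ)
    (hB : ∀ i, (z x i).natAbs < 2 ^ B) (i : ℕ) :
    (∑ j ∈ Finset.range i, if h : j < n x then z x ⟨j, h⟩ else 0).natAbs ≤ i * 2 ^ B := by
  induction i with
  | zero => simp
  | succ i ih =>
    rw [Finset.sum_range_succ, add_mul, one_mul]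
    refine (Int.natAbs_add_le _ _).trans (Nat.add_le_add ih ?_)
    split_ifs with h
    · exact (hB _).le
    · simp

theorem PolyTimeInt.exists_bound {n : X → ℕ} (hn : PolyBounded e n) {z : (x : X) → Fin (n x) → ℤ}
    (hz : PolyTimeInt (withIndex e n) fun p => z p.1 p.2) :
    ∃ B : X → ℕ, PolyBounded e B ∧ ∀ x i, (z x i).natAbs < 2 ^ B x := by
  obtain ⟨B, hB, h⟩ := hz.size.exists_bound hn
  exact ⟨B, hB, fun x i => Data.natAbs_lt_of_size_le (h x i)⟩

/-- If the terms are below `2 ^ B`, the partial sums are at most `n * 2 ^ B < 2 ^ (n + B)`, so the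
states of the loop stay short. -/
theorem PolyTimeInt.sum {n : X → ℕ} (hn : PolyTimeNat e n) {z : (x : X) → Fin (n x) → ℤ}
    (hz : PolyTimeInt (withIndex e n) fun p => z p.1 p.2) :
    PolyTimeInt e fun x => ∑ i, z x i := by
  obtain ⟨B, hB, hzB⟩ := hz.exists_bound hn.2
  have h := PolyTime.iter (e := e) hn
    (s := fun x i => .int (∑ j ∈ Finset.range i, if h : j < n x then z x ⟨j, h⟩ else 0))
    (PolyTime.const (.int 0)) ?_ ?_
  · refine PolyTime.congr h fun x => ?_
    rw [Finset.sum_range]; simp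
  · refine PolyBounded.sigma ((PolyBounded.const 1).add (hn.2.add hB)) ?_
    rintro x ⟨i, hi⟩
    refine Data.size_int_le_of_natAbs_le ((PolyTimeInt.indexedSum_aux x _ (hzB x) i).trans_lt ?_)
    rw [pow_add]
    exact Nat.mul_lt_mul_of_pos_right ((show i ≤ n x by omega).trans_lt Nat.lt_two_pow_self)
      (by positivity)
  · have h1 : PolyTimeInt _ _ := (PolyTime.id (fun p : Σ x, Fin (n x) => .pair (withIndex e n p)
      (.int (∑ j ∈ Finset.range p.2, if h : j < n p.1 then z p.1 ⟨j, h⟩ else 0)))).snd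
    refine PolyTimeInt.congr (h1.add (PolyTime.comp_fst hz _)) ?_
    rintro ⟨x, i, hi⟩
    rw [Finset.sum_range_succ]; simp [hi]

/-- The bit lengths of the factors add up: partial products are at most `2 ^ (n * B)`. -/
theorem PolyTimeInt.prod {n : X → ℕ} (hn : PolyTimeNat e n) {z : (x : X) → Fin (n x) → ℤ}
    (hz : PolyTimeInt (withIndex e n) fun p => z p.1 p.2) :
    PolyTimeInt e fun x => ∏ i, z x i := by
  obtain ⟨B, hB, hzB⟩ := hz.exists_bound hn.2
  have h := PolyTime.iter (e := e) hn
    (s := fun x i => .int (∏ j ∈ Finset.range i, if h : j < n x then z x ⟨j, h⟩ else 1))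
    (PolyTime.const (.int 1)) ?_ ?_
  · refine PolyTime.congr h fun x => ?_
    rw [Finset.prod_range]; simp
  · refine PolyBounded.sigma ((PolyBounded.const 1).add ((PolyBounded.const 1).add
      (hn.2.mul hB))) ?_
    rintro x ⟨i, hi⟩
    refine Data.size_int_le_of_natAbs_le ?_
    have key : ∀ i : ℕ, (∏ j ∈ Finset.range i,
        if h : j < n x then z x ⟨j, h⟩ else 1).natAbs ≤ 2 ^ (i * B x) := by
      intro i
      induction i with
      | zero => simp
      | succ i ih =>
        rw [Finset.prod_range_succ, Int.natAbs_mul, add_mul, one_mul, pow_add]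
        refine Nat.mul_le_mul ih ?_
        split_ifs with h
        · exact (hzB _ _).le
        · simpa using Nat.one_le_two_pow
    refine (key i).trans_lt (Nat.pow_lt_pow_right (by norm_num) ?_)
    have : i * B x ≤ n x * B x := Nat.mul_le_mul_right _ (by omega)
    omega
  · have h1 : PolyTimeInt _ _ := (PolyTime.id (fun p : Σ x, Fin (n x) => .pair (withIndex e n p)
      (.int (∏ j ∈ Finset.range p.2, if h : j < n p.1 then z p.1 ⟨j, h⟩ else 1)))).snd
    refine PolyTimeInt.congr (h1.mul (PolyTime.comp_fst hz _)) ?_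
    rintro ⟨x, i, hi⟩
    rw [Finset.prod_range_succ]; simp [hi]

theorem PolyTimeInt.pow {z : X → ℤ} (hz : PolyTimeInt e z) {n : X → ℕ} (hn : PolyTimeNat e n) :
    PolyTimeInt e fun x => z x ^ n x :=
  (PolyTimeInt.prod hn (z := fun x _ => z x) hz.indexed).congr fun x => by simp

/-- The failures are counted and their number is compared with zero. -/
theorem PolyTimeDec.forall {n : X → ℕ} (hn : PolyTimeNat e n) {p : (x : X) → Fin (n x) → Prop}
    (hp : PolyTimeDec (withIndex e n) fun q => p q.1 q.2) :
    PolyTimeDec e fun x => ∀ i, p x i := by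
  classical
  have h : PolyTimeInt (withIndex e n) fun q => if p q.1 q.2 then 0 else 1 :=
    (hp.ite' (PolyTime.const (.int 0)) (PolyTime.const (.int 1))).congr fun q => by
      by_cases h : p q.1 q.2 <;> simp [h]
  refine ((PolyTimeInt.sum hn (z := fun x i => if p x i then 0 else 1) h).eq (.const 0)).congr
    fun x => ?_
  rw [Finset.sum_eq_zero_iff_of_nonneg (fun i _ => by split_ifs <;> simp)]
  simp

theorem PolyTimeDec.exists {n : X → ℕ} (hn : PolyTimeNat e n) {p : (x : X) → Fin (n x) → Prop}
    (hp : PolyTimeDec (withIndex e n) fun q => p q.1 q.2) :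
    PolyTimeDec e fun x => ∃ i, p x i :=
  (PolyTimeDec.forall hn (p := fun x i => ¬ p x i) hp.not).not.congr fun x => by simp

open Classical in
/-- The first index at which `p` holds, or `n`. -/
noncomputable def firstIndex {n : ℕ} (p : Fin n → Prop) : ℕ :=
  Nat.find (p := fun i => ∀ h : i < n, p ⟨i, h⟩) ⟨n, fun h => absurd h (lt_irrefl n)⟩

open Classical in
theorem firstIndex_le {n : ℕ} (p : Fin n → Prop) : firstIndex p ≤ n :=
  Nat.find_min' _ fun h => absurd h (lt_irrefl n)

open Classical in
theorem firstIndex_spec {n : ℕ} (p : Fin n → Prop) (h : firstIndex p < n) :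
    p ⟨firstIndex p, h⟩ := by
  exact Nat.find_spec (p := fun i => ∀ h : i < n, p ⟨i, h⟩)
    ⟨n, fun h => absurd h (lt_irrefl n)⟩ h

open Classical in
theorem not_of_lt_firstIndex {n : ℕ} (p : Fin n → Prop) (i : Fin n) (h : i < firstIndex p) :
    ¬ p i := by
  intro hp
  exact Nat.find_min (p := fun i => ∀ h : i < n, p ⟨i, h⟩)
    ⟨n, fun h => absurd h (lt_irrefl n)⟩ h fun _ => hp

theorem firstIndex_lt_iff {n : ℕ} (p : Fin n → Prop) : firstIndex p < n ↔ ∃ i, p i :=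
  ⟨fun h => ⟨_, firstIndex_spec p h⟩, fun ⟨i, hi⟩ => by
    by_contra h
    exact not_of_lt_firstIndex p i (i.2.trans_le (not_lt.1 h)) hi⟩

theorem PolyTimeDec.firstIndex {n : X → ℕ} (hn : PolyTimeNat e n)
    {p : (x : X) → Fin (n x) → Prop} (hp : PolyTimeDec (withIndex e n) fun q => p q.1 q.2) :
    PolyTimeNat e fun x => firstIndex (p x) := by
  classical
  have hb : PolyBounded e fun x => _root_.firstIndex (p x) := hn.2.mono fun x => firstIndex_le _
  refine ⟨?_, hb⟩
  refine PolyTime.while_loop (s := fun x i => .int i)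
    (c := fun x i => .int (if ∃ h : i < n x, ¬ p x ⟨i, h⟩ then 1 else 0)) hb
    (PolyTime.const (.int 0)) ?_ ?_ ?_ ?_ ?_
  · refine PolyBounded.sigma ((PolyBounded.const 1).add hn.2) ?_
    rintro x ⟨i, hi⟩
    have h1 := Nat.size_le_self i
    have h2 := firstIndex_le (p x)
    simp only [Data.size, Int.natAbs_natCast]
    omega
  · have hi : PolyTimeInt (fun q : Σ x, Fin (_root_.firstIndex (p x) + 1) =>
        .pair (e q.1) (.int ((q.2 : ℕ) : ℤ))) fun q => ((q.2 : ℕ) : ℤ) := (PolyTime.id _).snd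
    have hlt : PolyTimeDec (fun q : Σ x, Fin (_root_.firstIndex (p x) + 1) =>
        .pair (e q.1) (.int ((q.2 : ℕ) : ℤ))) fun q => (q.2 : ℕ) < n q.1 :=
      (hi.lt (hn.1.weaken Sigma.fst _)).congr fun q => by simp
    -- The guard may also be evaluated at the index `n x`, where `p` has no value, so the range
    -- check has to come first.
    refine PolyTime.congr (hlt.ite (f := fun q => .int (if ∃ h : (q.2 : ℕ) < n q.1, ¬ p q.1 ⟨q.2, h⟩
      then 1 else 0)) (g := fun _ => .int 0) ?_ (PolyTime.const _)) ?_
    · refine PolyTime.congr (hp.not.reindex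
        (fun q : {q : Σ x, Fin (_root_.firstIndex (p x) + 1) // (q.2 : ℕ) < n q.1} =>
        (⟨q.1.1, ⟨q.1.2, q.2⟩⟩ : Σ x, Fin (n x)))) ?_
      rintro ⟨q, hq⟩
      simp [hq]
    · rintro ⟨x, i⟩
      by_cases h : (i : ℕ) < n x <;> simp [h]
  · intro x i hi
    have h1 : i < n x := hi.trans_le (firstIndex_le _)
    simp [h1, not_of_lt_firstIndex (p x) ⟨i, h1⟩ hi]
  · intro x
    have : ¬ ∃ h : _root_.firstIndex (p x) < n x, ¬ p x ⟨_root_.firstIndex (p x), h⟩ := by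
      rintro ⟨h, h'⟩
      exact h' (firstIndex_spec _ h)
    simp only [this, if_false]
  · have hi : PolyTimeInt (fun q : Σ x, Fin (_root_.firstIndex (p x)) =>
        .pair (e q.1) (.int ((q.2 : ℕ) : ℤ))) fun q => ((q.2 : ℕ) : ℤ) := (PolyTime.id _).snd
    exact (hi.add (.const 1)).congr fun q => by push_cast; rfl

end

/-! ### The Faddeev–LeVerrier algorithm -/

section

open Polynomial

/-- Jacobi's formula for `X - A`. When the Leibniz expansion is differentiated one factor at a time,
the factor of row `i` becomes `1` if the permutation fixes `i` and `0` otherwise, and what is left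
is the `i`-th diagonal cofactor. -/
theorem Matrix.derivative_charpoly {R : Type*} [CommRing R] {n : Type*} [Fintype n] [DecidableEq n]
    (A : Matrix n n R) : derivative A.charpoly = (A.charmatrix.adjugate).trace := by
  have h : ∀ i, A.charmatrix.adjugate i i = ∑ σ : Equiv.Perm n, ((Equiv.Perm.sign σ : ℤ) : R[X]) *
      ((∏ j ∈ Finset.univ.erase i, A.charmatrix j (σ j)) *
        derivative (A.charmatrix i (σ i))) := by
    intro i
    rw [Matrix.adjugate_apply, ← Matrix.det_transpose, Matrix.det_apply']
    refine Finset.sum_congr rfl fun σ _ => ?_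
    rw [← Finset.prod_erase_mul _ _ (Finset.mem_univ i)]
    congr 2
    · refine Finset.prod_congr rfl fun j hj => ?_
      rw [Matrix.transpose_apply, Matrix.updateRow_ne (Finset.ne_of_mem_erase hj)]
    · rw [Matrix.transpose_apply, Matrix.updateRow_self, Matrix.charmatrix_apply]
      by_cases hσ : σ i = i
      · simp [hσ]
      · simp [hσ, Matrix.diagonal_apply_ne _ (Ne.symm hσ)]
  rw [Matrix.trace, Matrix.charpoly, ← Matrix.det_transpose, Matrix.det_apply']
  simp only [Matrix.diag_apply, h, Matrix.transpose_apply]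
  rw [Finset.sum_comm, derivative_sum]
  refine Finset.sum_congr rfl fun σ _ => ?_
  rw [← Finset.mul_sum, derivative_mul, derivative_prod_finset]
  simp

namespace Matrix

variable {r : ℕ} (A : Matrix (Fin r) (Fin r) ℤ)

/-- The coefficients of the adjugate of the characteristic matrix. -/
noncomputable def adjCoeff (j : ℕ) : Matrix (Fin r) (Fin r) ℤ :=
  (matPolyEquiv A.charmatrix.adjugate).coeff j

/-- The identity `M * adj M = det M` for the characteristic matrix, read in the ring of polynomials
with matrix coefficients. Comparing coefficients gives the recursion of the algorithm. -/
theorem adjCoeff_rec_aux :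
    (X - C A) * matPolyEquiv A.charmatrix.adjugate =
      A.charpoly.map (algebraMap ℤ (Matrix (Fin r) (Fin r) ℤ)) := by
  rw [← matPolyEquiv_charmatrix, ← map_mul, Matrix.mul_adjugate, ← matPolyEquiv_smul_one]
  rfl

theorem adjCoeff_succ (j : ℕ) :
    adjCoeff A j = A * adjCoeff A (j + 1) + A.charpoly.coeff (j + 1) • 1 := by
  have h := congrArg (fun p => p.coeff (j + 1)) (adjCoeff_rec_aux A)
  simp only [sub_mul, coeff_sub, coeff_X_mul, coeff_C_mul, coeff_map] at h
  rw [Algebra.algebraMap_eq_smul_one] at h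
  rw [← h, adjCoeff, adjCoeff]; abel

theorem mul_adjCoeff_zero : A * adjCoeff A 0 = -(A.charpoly.coeff 0 • 1) := by
  have h := congrArg (fun p => p.coeff 0) (adjCoeff_rec_aux A)
  simp only [sub_mul, coeff_sub, coeff_C_mul, coeff_map] at h
  rw [Algebra.algebraMap_eq_smul_one] at h
  rw [← h, adjCoeff]; simp

/-- Beyond the degree of the characteristic polynomial the recursion reads `Bⱼ = A Bⱼ₊₁`, so one
nonzero coefficient would force all later ones to be nonzero. -/
theorem adjCoeff_eq_zero {j : ℕ} (hj : r ≤ j) : adjCoeff A j = 0 := by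
  by_contra hne
  have key : ∀ d, adjCoeff A (j + d) ≠ 0 := by
    intro d
    induction d with
    | zero => exact hne
    | succ d ih =>
      intro h0
      apply ih
      have : A.charpoly.coeff (j + d + 1) = 0 := by
        apply coeff_eq_zero_of_natDegree_lt
        rw [charpoly_natDegree_eq_dim, Fintype.card_fin]; omega
      rw [adjCoeff_succ, this, add_assoc, h0]; simp
  exact key ((matPolyEquiv A.charmatrix.adjugate).natDegree + 1)
    (coeff_eq_zero_of_natDegree_lt (by omega))

theorem trace_adjCoeff (j : ℕ) :
    (adjCoeff A j).trace = A.charpoly.coeff (j + 1) * (j + 1) := by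
  rw [← coeff_derivative, Matrix.derivative_charpoly]
  simp [adjCoeff, Matrix.trace, matPolyEquiv_coeff_apply]

/-- Traces in the recursion, compared with the derivative of the characteristic polynomial,
determine its next coefficient. The factor `k + 1` is the divisor in `faddeev`. -/
theorem trace_mul_adjCoeff {j k : ℕ} (h : j + (k + 1) = r) :
    (A * adjCoeff A j).trace = -A.charpoly.coeff j * (k + 1) := by
  cases j with
  | zero =>
    rw [mul_adjCoeff_zero]
    obtain rfl : r = k + 1 := by omega
    rw [trace_neg, trace_smul, trace_one]
    simp
  | succ j =>
    have h1 := trace_adjCoeff A j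
    rw [adjCoeff_succ, trace_add, trace_smul, trace_one, Fintype.card_fin] at h1
    have h2 : (r : ℤ) = j + 1 + (k + 1) := by rw [← h]; push_cast; ring
    rw [h2, smul_eq_mul] at h1
    linear_combination h1

/-- The states of the Faddeev–LeVerrier algorithm. -/
def faddeev : ℕ → Matrix (Fin r) (Fin r) ℤ × ℤ
  | 0 => (0, 1)
  | k + 1 =>
    (A * (faddeev k).1 + (faddeev k).2 • 1,
      -(A * (A * (faddeev k).1 + (faddeev k).2 • 1)).trace / (k + 1))

/-- Both sides satisfy the same recursion, downwards from `j = r`; by `trace_mul_adjCoeff` the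
integer division is exact. -/
theorem faddeev_eq {j k : ℕ} (h : j + k = r) :
    faddeev A k = (adjCoeff A j, A.charpoly.coeff j) := by
  induction k generalizing j with
  | zero =>
    obtain rfl : j = r := by omega
    rw [adjCoeff_eq_zero A le_rfl]
    have := A.charpoly_monic.coeff_natDegree
    rw [charpoly_natDegree_eq_dim, Fintype.card_fin] at this
    rw [this]; rfl
  | succ k ih =>
    rw [faddeev, ih (j := j + 1) (by omega)]
    simp only [← adjCoeff_succ]
    rw [trace_mul_adjCoeff A h]
    congr 1
    rw [neg_mul, neg_neg, Int.mul_ediv_cancel _ (by positivity)]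

/-- A matrix `N` and an integer `δ = ± det A` with `A * N = N * A = δ`. -/
def pseudoInv : Matrix (Fin r) (Fin r) ℤ := (faddeev A r).1

/-- See `pseudoInv`. -/
def pseudoDet : ℤ := -(faddeev A r).2

theorem mul_pseudoInv : A * pseudoInv A = pseudoDet A • 1 := by
  rw [pseudoInv, pseudoDet, faddeev_eq A (zero_add r), mul_adjCoeff_zero, neg_smul]

theorem pseudoDet_eq : pseudoDet A = -((-1) ^ r * A.det) := by
  rw [pseudoDet, faddeev_eq A (zero_add r), det_eq_sign_charpoly_coeff, Fintype.card_fin,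
    ← mul_assoc, ← mul_pow]
  simp

theorem pseudoDet_ne_zero_iff : pseudoDet A ≠ 0 ↔ A.det ≠ 0 := by
  rw [pseudoDet_eq]; simp

/-- Every matrix in the algorithm is a polynomial in `A`. -/
theorem faddeev_mul_comm (k : ℕ) : (faddeev A k).1 * A = A * (faddeev A k).1 := by
  induction k with
  | zero => simp [faddeev]
  | succ k ih => 
    simp only [faddeev, add_mul, mul_add, Matrix.mul_assoc, ih, smul_mul_assoc, mul_smul_comm,
      one_mul, mul_one]

theorem pseudoInv_mul : pseudoInv A * A = pseudoDet A • 1 := by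
  rw [pseudoInv, faddeev_mul_comm]; exact mul_pseudoInv A

end Matrix
end

/-! ### Linear algebra in polynomial time -/

/-- An integer vector as a value. -/
def encodeVec {n : ℕ} (v : Fin n → ℤ) : Data := .ofList (List.ofFn fun i => .int (v i))

/-- An integer matrix as a value. -/
def encodeMat {m n : ℕ} (M : Matrix (Fin m) (Fin n) ℤ) : Data :=
  .ofList (List.ofFn fun i => encodeVec (M i))

theorem natAbs_sum_le {ι : Type*} (s : Finset ι) (f : ι → ℤ) (B : ℕ)
    (h : ∀ i ∈ s, (f i).natAbs ≤ B) : (∑ i ∈ s, f i).natAbs ≤ s.card * B := by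
  classical
  induction s using Finset.induction_on with
  | empty => simp
  | insert a s ha ih =>
    rw [Finset.sum_insert ha, Finset.card_insert_of_notMem ha, add_mul, one_mul, add_comm]
    exact (Int.natAbs_add_le _ _).trans (Nat.add_le_add
      (ih fun i hi => h i (Finset.mem_insert_of_mem hi)) (h a (Finset.mem_insert_self a s)))

theorem size_encodeVec_le {n b : ℕ} {v : Fin n → ℤ} (h : ∀ i, (v i).natAbs ≤ 2 ^ b) :
    (encodeVec v).size ≤ 1 + n * (b + 3) := by
  refine (Data.size_ofList_le (B := b + 2) ?_).trans (by simp; ring_nf; rfl)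
  intro d hd
  obtain ⟨i, rfl⟩ := List.mem_ofFn.1 hd
  refine (Data.size_int_le_of_natAbs_le (b := b + 1) ?_).trans (by omega)
  exact (h i).trans_lt (Nat.pow_lt_pow_right (by norm_num) (by omega))

theorem size_encodeMat_le {m n b : ℕ} {M : Matrix (Fin m) (Fin n) ℤ}
    (h : ∀ i j, (M i j).natAbs ≤ 2 ^ b) : (encodeMat M).size ≤ 1 + m * (2 + n * (b + 3)) := by
  refine (Data.size_ofList_le (B := 1 + n * (b + 3)) ?_).trans (by simp; ring_nf; rfl)
  intro d hd
  obtain ⟨i, rfl⟩ := List.mem_ofFn.1 hd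
  exact size_encodeVec_le (h i)

theorem natAbs_lt_size_encodeVec {n : ℕ} (v : Fin n → ℤ) (i : Fin n) :
    (v i).natAbs < 2 ^ (encodeVec v).size :=
  Data.natAbs_lt_of_size_le (Data.size_le_of_mem (List.mem_ofFn.2 ⟨i, rfl⟩))

theorem natAbs_lt_size_encodeMat {m n : ℕ} (M : Matrix (Fin m) (Fin n) ℤ) (i : Fin m) (j : Fin n) :
    (M i j).natAbs < 2 ^ (encodeMat M).size :=
  (natAbs_lt_size_encodeVec (M i) j).trans_le (Nat.pow_le_pow_right (by norm_num)
    (Data.size_le_of_mem (List.mem_ofFn.2 ⟨i, rfl⟩)))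

theorem le_size_encodeMat {m n : ℕ} (M : Matrix (Fin m) (Fin n) ℤ) : m ≤ (encodeMat M).size := by
  have h := Data.length_le_size_ofList (List.ofFn fun i => encodeVec (M i))
  rwa [List.length_ofFn] at h

section

variable {X : Type} {e : X → Data} {l m n : X → ℕ}

/-- The integer vector `v x` is computable in polynomial time. -/
def PolyTimeVec (e : X → Data) {n : X → ℕ} (v : (x : X) → Fin (n x) → ℤ) : Prop :=
  PolyTime e fun x => encodeVec (v x)

/-- The integer matrix `M x` is computable in polynomial time. -/
def PolyTimeMat (e : X → Data) {m n : X → ℕ} (M : (x : X) → Matrix (Fin (m x)) (Fin (n x)) ℤ) :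
    Prop :=
  PolyTime e fun x => encodeMat (M x)

namespace PolyTimeVec

variable {v w : (x : X) → Fin (n x) → ℤ}

theorem of_entries (hn : PolyTimeNat e n) (h : PolyTimeInt (withIndex e n) fun p => v p.1 p.2) :
    PolyTimeVec e v := PolyTime.tabulate hn (g := fun x i => .int (v x i)) h

theorem apply (hv : PolyTimeVec e v) {i : (x : X) → Fin (n x)}
    (hi : PolyTimeInt e fun x => ((i x : ℕ) : ℤ)) : PolyTimeInt e fun x => v x (i x) :=
  PolyTime.nthFn (g := fun x i => .int (v x i)) hv hi

theorem entry (hv : PolyTimeVec e v) : PolyTimeInt (withIndex e n) fun p => v p.1 p.2 :=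
  PolyTime.nthFn_index (g := fun x i => .int (v x i)) hv

theorem indexed (hv : PolyTimeVec e v) : PolyTimeVec (withIndex e m) fun p => v p.1 :=
  PolyTime.indexed hv

theorem congr (hv : PolyTimeVec e v) (h : ∀ x i, v x i = w x i) : PolyTimeVec e w :=
  PolyTime.congr hv fun x => by rw [show w x = v x from funext fun i => (h x i).symm]

theorem dot (hn : PolyTimeNat e n) (hv : PolyTimeVec e v) (hw : PolyTimeVec e w) :
    PolyTimeInt e fun x => v x ⬝ᵥ w x :=
  PolyTimeInt.sum hn (z := fun x i => v x i * w x i) (hv.entry.mul hw.entry)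

theorem smul (hn : PolyTimeNat e n) {z : X → ℤ} (hz : PolyTimeInt e z) (hv : PolyTimeVec e v) :
    PolyTimeVec e fun x => z x • v x :=
  of_entries hn (v := fun x => z x • v x) (hz.indexed.mul hv.entry)

theorem eq (hn : PolyTimeNat e n) (hv : PolyTimeVec e v) (hw : PolyTimeVec e w) :
    PolyTimeDec e fun x => v x = w x :=
  (PolyTimeDec.forall hn (p := fun x i => v x i = w x i) (hv.entry.eq hw.entry)).congr
    fun _ => funext_iff.symm

end PolyTimeVec

namespace PolyTimeMat

variable {M N : (x : X) → Matrix (Fin (m x)) (Fin (n x)) ℤ}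

theorem of_rows (hm : PolyTimeNat e m) (h : PolyTimeVec (withIndex e m) fun p => M p.1 p.2) :
    PolyTimeMat e M := PolyTime.tabulate hm (g := fun x i => encodeVec (M x i)) h

theorem apply (hM : PolyTimeMat e M) {i : (x : X) → Fin (m x)} {j : (x : X) → Fin (n x)}
    (hi : PolyTimeInt e fun x => ((i x : ℕ) : ℤ)) (hj : PolyTimeInt e fun x => ((j x : ℕ) : ℤ)) :
    PolyTimeInt e fun x => M x (i x) (j x) :=
  PolyTimeVec.apply (v := fun x => M x (i x))
    (PolyTime.nthFn (g := fun x i => encodeVec (M x i)) hM hi) hj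

theorem row (hM : PolyTimeMat e M) : PolyTimeVec (withIndex e m) fun p => M p.1 p.2 :=
  PolyTime.nthFn_index (g := fun x i => encodeVec (M x i)) hM

theorem row_apply (hM : PolyTimeMat e M) {i : (x : X) → Fin (m x)}
    (hi : PolyTimeInt e fun x => ((i x : ℕ) : ℤ)) : PolyTimeVec e fun x => M x (i x) :=
  PolyTime.nthFn (g := fun x i => encodeVec (M x i)) hM hi

theorem indexed (hM : PolyTimeMat e M) : PolyTimeMat (withIndex e l) fun p => M p.1 :=
  PolyTime.indexed hM

theorem congr (hM : PolyTimeMat e M) (h : ∀ x, M x = N x) : PolyTimeMat e N :=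
  PolyTime.congr hM fun x => by rw [h]

theorem of_entries (hm : PolyTimeNat e m) (hn : PolyTimeNat e n)
    (h : PolyTimeInt (withIndex (withIndex e m) fun p => n p.1) fun p => M p.1.1 p.1.2 p.2) :
    PolyTimeMat e M :=
  of_rows hm (PolyTimeVec.of_entries (v := fun p : Σ x, Fin (m x) => M p.1 p.2) hn.indexed h)

theorem outerIndex (hm : PolyBounded e m) (n : X → ℕ) :
    PolyTimeNat (withIndex (withIndex e m) fun p => n p.1) fun p => p.1.2 :=
  (PolyTimeNat.index hm).indexed

theorem entry (hm : PolyBounded e m) (hn : PolyTimeNat e n) (hM : PolyTimeMat e M) :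
    PolyTimeInt (withIndex (withIndex e m) fun p => n p.1) fun p => M p.1.1 p.1.2 p.2 :=
  hM.indexed.indexed.apply (outerIndex hm n).int (PolyTimeNat.index hn.2.indexed).int

theorem transpose (hm : PolyTimeNat e m) (hn : PolyTimeNat e n) (hM : PolyTimeMat e M) :
    PolyTimeMat e fun x => (M x)ᵀ :=
  of_entries hn hm (M := fun x => (M x)ᵀ) (hM.indexed.indexed.apply
    (i := fun p : Σ p : (Σ x, Fin (n x)), Fin (m p.1) => p.2)
    (PolyTimeNat.index hm.2.indexed).int (outerIndex hn.2 m).int)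

theorem add (hm : PolyTimeNat e m) (hn : PolyTimeNat e n) (hM : PolyTimeMat e M)
    (hN : PolyTimeMat e N) : PolyTimeMat e fun x => M x + N x :=
  of_entries hm hn (M := fun x => M x + N x) ((hM.entry hm.2 hn).add (hN.entry hm.2 hn))

theorem scalar (hm : PolyTimeNat e m) {z : X → ℤ} (hz : PolyTimeInt e z) :
    PolyTimeMat e fun x => z x • (1 : Matrix (Fin (m x)) (Fin (m x)) ℤ) := by
  classical
  refine of_entries hm hm (M := fun x => z x • (1 : Matrix (Fin (m x)) (Fin (m x)) ℤ)) ?_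
  refine PolyTime.congr (((outerIndex hm.2 m).eq (PolyTimeNat.index hm.2.indexed)).ite'
    hz.indexed.indexed (PolyTimeInt.const 0)) fun p => ?_
  by_cases h : p.1.2 = p.2
  · simp [h]
  · have : ¬ (p.1.2 : ℕ) = p.2 := fun h' => h (Fin.ext h')
    simp [h, this]

theorem mul {L : (x : X) → Matrix (Fin (l x)) (Fin (m x)) ℤ} (hl : PolyTimeNat e l)
    (hm : PolyTimeNat e m) (hn : PolyTimeNat e n) (hL : PolyTimeMat e L) (hM : PolyTimeMat e M) :
    PolyTimeMat e fun x => L x * M x := by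
  refine of_entries hl hn (M := fun x => L x * M x) ?_
  refine PolyTimeInt.congr (PolyTimeInt.sum hm.indexed.indexed (z := fun p k =>
    L p.1.1 p.1.2 k * M p.1.1 k p.2) (PolyTimeInt.mul ?_ ?_))
    fun p => (Matrix.mul_apply).symm
  · exact hL.indexed.indexed.indexed.apply (outerIndex hl.2 n).indexed.int
      (PolyTimeNat.index hm.2.indexed.indexed).int
  · exact hM.indexed.indexed.indexed.apply (PolyTimeNat.index hm.2.indexed.indexed).int
      (PolyTimeNat.index hn.2.indexed).indexed.int

theorem mulVec {v : (x : X) → Fin (n x) → ℤ} (hm : PolyTimeNat e m) (hn : PolyTimeNat e n)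
    (hM : PolyTimeMat e M) (hv : PolyTimeVec e v) : PolyTimeVec e fun x => M x *ᵥ v x :=
  PolyTimeVec.of_entries hm (v := fun x => M x *ᵥ v x) (PolyTimeVec.dot hn.indexed hM.row hv.indexed)

theorem vecMul {v : (x : X) → Fin (m x) → ℤ} (hm : PolyTimeNat e m) (hn : PolyTimeNat e n)
    (hv : PolyTimeVec e v) (hM : PolyTimeMat e M) : PolyTimeVec e fun x => v x ᵥ* M x :=
  ((hM.transpose hm hn).mulVec hn hm hv).congr fun x i => by rw [Matrix.mulVec_transpose]

theorem trace {M : (x : X) → Matrix (Fin (m x)) (Fin (m x)) ℤ} (hm : PolyTimeNat e m)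
    (hM : PolyTimeMat e M) : PolyTimeInt e fun x => (M x).trace :=
  PolyTimeInt.sum hm (z := fun x i => M x i i) (hM.indexed.apply (PolyTimeNat.index hm.2).int
    (PolyTimeNat.index hm.2).int)

end PolyTimeMat

/-- With `E = 2 ^ S`, one round turns a common bound `b` into `(E² + 1) b` for the matrix and into
`2 E⁵ b` for the scalar, because the trace of a product has `r²` terms and `r ≤ E`. Hence each round
adds at most `5 * S + 1` bits. -/
theorem Matrix.faddeev_bound {r S : ℕ} (A : Matrix (Fin r) (Fin r) ℤ) (hr : r ≤ 2 ^ S)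
    (hA : ∀ i j, (A i j).natAbs ≤ 2 ^ S) (k : ℕ) :
    (∀ i j, ((A.faddeev k).1 i j).natAbs ≤ 2 ^ (k * (5 * S + 1))) ∧
      (A.faddeev k).2.natAbs ≤ 2 ^ (k * (5 * S + 1)) := by
  induction k with
  | zero => simp [faddeev]
  | succ k ih =>
    set b := 2 ^ (k * (5 * S + 1)) with hb
    set E := 2 ^ S with hE
    have hE1 : 1 ≤ E := Nat.one_le_two_pow
    have hpow : 2 ^ ((k + 1) * (5 * S + 1)) = E ^ 5 * 2 * b := by
      rw [hb, hE, add_mul, one_mul, pow_add, pow_add, ← pow_mul]; ring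
    have hM : ∀ i j, ((A * (A.faddeev k).1 + (A.faddeev k).2 • 1) i j).natAbs ≤ (E ^ 2 + 1) * b := by
      intro i j
      rw [add_apply, mul_apply, smul_apply, add_mul, one_mul]
      refine (Int.natAbs_add_le _ _).trans (Nat.add_le_add ?_ ?_)
      · refine (natAbs_sum_le _ _ (E * b) fun l _ => ?_).trans ?_
        · rw [Int.natAbs_mul]; exact Nat.mul_le_mul (hA _ _) (ih.1 _ _)
        · rw [Finset.card_univ, Fintype.card_fin, pow_two, mul_assoc]
          exact Nat.mul_le_mul_right _ hr
      · rw [smul_eq_mul, Int.natAbs_mul]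
        by_cases h : i = j
        · subst h; rw [one_apply_eq]; simpa using ih.2
        · simp [h]
    have hEE : E ^ 2 + 1 ≤ 2 * E ^ 2 := by have := Nat.one_le_pow 2 E hE1; omega
    have hM' : (E ^ 2 + 1) * b ≤ 2 * E ^ 2 * b := Nat.mul_le_mul_right _ hEE
    refine ⟨fun i j => ?_, ?_⟩
    · rw [hpow]
      refine (hM i j).trans (hM'.trans (Nat.mul_le_mul_right _ ?_))
      have := Nat.pow_le_pow_right hE1 (show 2 ≤ 5 by norm_num)
      omega
    · rw [hpow]
      refine (Int.natAbs_ediv_le_natAbs _ _).trans ?_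
      rw [Int.natAbs_neg]
      refine (natAbs_sum_le _ _ (E * (E * (2 * E ^ 2 * b))) fun i _ => ?_).trans ?_
      · rw [diag_apply, mul_apply]
        refine (natAbs_sum_le _ _ (E * (2 * E ^ 2 * b)) fun l _ => ?_).trans ?_
        · rw [Int.natAbs_mul]; exact Nat.mul_le_mul (hA _ _) ((hM _ _).trans hM')
        · rw [Finset.card_univ, Fintype.card_fin]
          exact Nat.mul_le_mul_right _ hr
      · rw [Finset.card_univ, Fintype.card_fin]
        refine (Nat.mul_le_mul_right _ hr).trans (le_of_eq (by ring))

theorem PolyTimeMat.faddeev {A : (x : X) → Matrix (Fin (m x)) (Fin (m x)) ℤ}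
    (hm : PolyTimeNat e m) (hA : PolyTimeMat e A) :
    PolyTime e fun x => .pair (encodeMat ((A x).faddeev (m x)).1) (.int ((A x).faddeev (m x)).2) := by
  refine PolyTime.iter hm (s := fun x k => .pair (encodeMat ((A x).faddeev k).1)
    (.int ((A x).faddeev k).2)) ?_ ?_ ?_
  · refine PolyTime.pair ?_ (PolyTime.const (.int 1))
    exact (PolyTimeMat.scalar hm (.const 0)).congr fun x => by simp [Matrix.faddeev]
  · let S : X → ℕ := fun x => (encodeMat (A x)).size
    have hS : PolyBounded e S := PolyTime.size hA
    have hb := hm.2.mul (((PolyBounded.const 5).mul hS).add (.const 1))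
    refine PolyBounded.sigma (B := fun x => 1 + (1 + m x * (2 + m x * (m x * (5 * S x + 1) + 3))) +
      (1 + (m x * (5 * S x + 1) + 1))) (((PolyBounded.const 1).add ((PolyBounded.const 1).add
      (hm.2.mul ((PolyBounded.const 2).add (hm.2.mul (hb.add (.const 3))))))).add
        ((PolyBounded.const 1).add (hb.add (.const 1)))) ?_
    rintro x ⟨k, hk⟩
    have hmS : m x ≤ 2 ^ S x := (le_size_encodeMat (A x)).trans Nat.lt_two_pow_self.le
    obtain ⟨h1, h2⟩ := (A x).faddeev_bound hmS (fun i j => (natAbs_lt_size_encodeMat _ i j).le) k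
    have hle : 2 ^ (k * (5 * S x + 1)) ≤ 2 ^ (m x * (5 * S x + 1)) :=
      Nat.pow_le_pow_right (by norm_num) (Nat.mul_le_mul_right _ (by omega))
    have h3 := size_encodeMat_le fun i j => (h1 i j).trans hle
    have h4 := Data.size_int_le_of_natAbs_le (((h2.trans hle)).trans_lt
      (Nat.pow_lt_pow_right (by norm_num) (Nat.lt_succ_self _)))
    simp only [Data.size] at h4 ⊢
    omega
  · have hid := PolyTime.id (fun p : Σ x, Fin (m x) => .pair (withIndex e m p)
      (.pair (encodeMat ((A p.1).faddeev p.2).1) (.int ((A p.1).faddeev p.2).2)))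
    have hm' : PolyTimeNat (fun p : Σ x, Fin (m x) => .pair (withIndex e m p)
      (.pair (encodeMat ((A p.1).faddeev p.2).1) (.int ((A p.1).faddeev p.2).2)))
        fun p => m p.1 := hid.fst.trans_nat hm.indexed
    have hk : PolyTimeNat (fun p : Σ x, Fin (m x) => .pair (withIndex e m p)
      (.pair (encodeMat ((A p.1).faddeev p.2).1) (.int ((A p.1).faddeev p.2).2)))
        fun p => p.2 := hid.fst.trans_nat (PolyTimeNat.index hm.2)
    have hA' : PolyTimeMat (fun p : Σ x, Fin (m x) => .pair (withIndex e m p)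
      (.pair (encodeMat ((A p.1).faddeev p.2).1) (.int ((A p.1).faddeev p.2).2)))
        fun p => A p.1 := hid.fst.trans hA.indexed
    have hM : PolyTimeMat _ fun p : Σ x, Fin (m x) => ((A p.1).faddeev p.2).1 := hid.snd.fst
    have hc : PolyTimeInt _ fun p : Σ x, Fin (m x) => ((A p.1).faddeev p.2).2 := hid.snd.snd
    have hM' := (hA'.mul hm' hm' hm' hM).add hm' hm' (PolyTimeMat.scalar hm' hc)
    refine PolyTime.pair hM' ?_
    exact ((PolyTimeMat.trace hm' (hA'.mul hm' hm' hm' hM')).neg.div (hk.int.add (.const 1)))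

theorem PolyTimeMat.pseudoInv {A : (x : X) → Matrix (Fin (m x)) (Fin (m x)) ℤ}
    (hm : PolyTimeNat e m) (hA : PolyTimeMat e A) : PolyTimeMat e fun x => (A x).pseudoInv :=
  (hA.faddeev hm).fst

theorem PolyTimeMat.pseudoDet {A : (x : X) → Matrix (Fin (m x)) (Fin (m x)) ℤ}
    (hm : PolyTimeNat e m) (hA : PolyTimeMat e A) : PolyTimeInt e fun x => (A x).pseudoDet :=
  PolyTimeInt.neg (hA.faddeev hm).snd

end

/-! ### Deciding membership in the span of integer vectors -/

namespace Matrix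

variable {r n : ℕ} (V : Matrix (Fin r) (Fin n) ℤ)

/-- A nonzero integer if the rows of `V` are independent. -/
def gramDet : ℤ := (V * Vᵀ).pseudoDet

/-- The coordinates of `v` with respect to the rows of `V`, multiplied by `gramDet V`. -/
def coords (v : Fin n → ℤ) : Fin r → ℤ := v ᵥ* Vᵀ ᵥ* (V * Vᵀ).pseudoInv

/-- A test for membership of `v` in the span of the rows of `V`. -/
def SpanTest (v : Fin n → ℤ) : Prop := V.gramDet • v = V.coords v ᵥ* V

theorem coords_vecMul (c : Fin r → ℤ) : V.coords (c ᵥ* V) = V.gramDet • c := by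
  rw [coords, vecMul_vecMul, vecMul_vecMul, ← Matrix.mul_assoc, mul_pseudoInv, vecMul_smul,
    vecMul_one, gramDet]

/-- `coords` as a linear map. -/
def coordsHom : (Fin n → ℤ) →ₗ[ℤ] (Fin r → ℤ) where
  toFun := V.coords
  map_add' v w := by simp [coords, add_vecMul]
  map_smul' z v := by simp only [coords, smul_vecMul, RingHom.id_apply]

@[simp] theorem coordsHom_apply (v : Fin n → ℤ) : V.coordsHom v = V.coords v := rfl

theorem vecMul_map_intCast {m n : ℕ} (M : Matrix (Fin m) (Fin n) ℤ) (v : Fin m → ℤ) (j : Fin n) :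
    (((v ᵥ* M) j : ℤ) : ℚ) = ((fun i => (v i : ℚ)) ᵥ* M.map (Int.cast : ℤ → ℚ)) j := by
  simp [vecMul, dotProduct]

/-- If `c V Vᵀ = 0`, then `c V` has square length zero, so `c V = 0`, and `c = 0` by independence.
-/
theorem gramDet_ne_zero (hV : LinearIndependent ℚ fun i j => (V i j : ℚ)) : V.gramDet ≠ 0 := by
  rw [gramDet, pseudoDet_ne_zero_iff]
  intro h
  obtain ⟨c, hc0, hc⟩ := exists_vecMul_eq_zero_iff.2 h
  have h1 : c ᵥ* V ⬝ᵥ c ᵥ* V = 0 := by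
    rw [← vecMul_vecMul] at hc
    have h2 := congrArg (· ⬝ᵥ c) hc
    simp only [zero_dotProduct] at h2
    rwa [vecMul_transpose, ← dotProduct_comm, dotProduct_mulVec] at h2
  rw [dotProduct_self_eq_zero] at h1
  apply hc0
  rw [Fintype.linearIndependent_iff] at hV
  ext i
  have := hV (fun i => (c i : ℚ)) (by
    ext j
    have h3 := vecMul_map_intCast V c j
    rw [h1] at h3
    simp only [vecMul, dotProduct, map_apply, Pi.zero_apply, Int.cast_zero] at h3
    simpa [Finset.sum_apply] using h3.symm) i
  exact_mod_cast this

theorem mem_span_of_spanTest (h0 : V.gramDet ≠ 0) {v : Fin n → ℤ} (h : V.SpanTest v) :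
    (fun j => (v j : ℚ)) ∈ Submodule.span ℚ (Set.range fun i j => (V i j : ℚ)) := by
  have h0' : (V.gramDet : ℚ) ≠ 0 := by exact_mod_cast h0
  refine (Submodule.smul_mem_iff _ h0').1 ?_
  rw [Submodule.mem_span_range_iff_exists_fun]
  refine ⟨fun i => (V.coords v i : ℚ), ?_⟩
  ext j
  have h1 := congrArg (Int.cast : ℤ → ℚ) (congrFun h j)
  rw [vecMul_map_intCast] at h1
  simp only [Pi.smul_apply, smul_eq_mul, Int.cast_mul, vecMul, dotProduct, map_apply] at h1
  simpa [Finset.sum_apply] using h1.symm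

/-- For `v = c V` with rational `c`, the vector `coords v` equals `gramDet V • c`. No nondegeneracy
is needed in this direction. -/
theorem spanTest_of_mem_span {v : Fin n → ℤ}
    (h : (fun j => (v j : ℚ)) ∈ Submodule.span ℚ (Set.range fun i j => (V i j : ℚ))) :
    V.SpanTest v := by
  obtain ⟨c, hc⟩ := Submodule.mem_span_range_iff_exists_fun ℚ |>.1 h
  have hv : (fun j => (v j : ℚ)) = c ᵥ* V.map (Int.cast : ℤ → ℚ) := by
    rw [← hc]; ext j; simp [vecMul, dotProduct, Finset.sum_apply]
  have hcast : ∀ i, (V.coords v i : ℚ) = V.gramDet * c i := by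
    intro i
    have hmul : V.map (Int.cast : ℤ → ℚ) * (Vᵀ * (V * Vᵀ).pseudoInv).map (Int.cast : ℤ → ℚ) =
      (V * (Vᵀ * (V * Vᵀ).pseudoInv)).map (Int.cast : ℤ → ℚ) :=
      (Matrix.map_mul (f := Int.castRingHom ℚ)).symm
    rw [coords, vecMul_vecMul, vecMul_map_intCast, hv, vecMul_vecMul, hmul, ← Matrix.mul_assoc,
      mul_pseudoInv, gramDet, show ((V * Vᵀ).pseudoDet • (1 : Matrix (Fin r) (Fin r) ℤ)).map
        (Int.cast : ℤ → ℚ) = ((V * Vᵀ).pseudoDet : ℚ) • 1 by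
          ext a b
          simp only [Matrix.map_apply, Matrix.smul_apply, one_apply, smul_eq_mul, Int.cast_mul]
          split_ifs <;> simp, vecMul_smul, vecMul_one]
    rfl
  ext j
  have : (((V.gramDet • v) j : ℤ) : ℚ) = ((V.coords v ᵥ* V) j : ℤ) := by
    rw [vecMul_map_intCast]
    simp only [hcast, Pi.smul_apply, smul_eq_mul, Int.cast_mul]
    rw [show (v j : ℚ) = (c ᵥ* V.map (Int.cast : ℤ → ℚ)) j from congrFun hv j]
    simp [vecMul, dotProduct, Finset.mul_sum, mul_assoc]
  exact_mod_cast this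

theorem spanTest_iff (h0 : V.gramDet ≠ 0) (v : Fin n → ℤ) : V.SpanTest v ↔
    (fun j => (v j : ℚ)) ∈ Submodule.span ℚ (Set.range fun i j => (V i j : ℚ)) :=
  ⟨V.mem_span_of_spanTest h0, V.spanTest_of_mem_span⟩

end Matrix

section

variable {X : Type} {e : X → Data} {m n : X → ℕ} {V : (x : X) → Matrix (Fin (m x)) (Fin (n x)) ℤ}
  {v : (x : X) → Fin (n x) → ℤ}

theorem PolyTimeMat.gramDet (hm : PolyTimeNat e m) (hn : PolyTimeNat e n) (hV : PolyTimeMat e V) :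
    PolyTimeInt e fun x => (V x).gramDet :=
  (hV.mul hm hn hm (hV.transpose hm hn)).pseudoDet hm

theorem PolyTimeMat.coords (hm : PolyTimeNat e m) (hn : PolyTimeNat e n) (hV : PolyTimeMat e V)
    (hv : PolyTimeVec e v) : PolyTimeVec e fun x => (V x).coords (v x) :=
  PolyTimeMat.vecMul hm hm (PolyTimeMat.vecMul hn hm hv (hV.transpose hm hn))
    ((hV.mul hm hn hm (hV.transpose hm hn)).pseudoInv hm)

theorem PolyTimeMat.spanTest (hm : PolyTimeNat e m) (hn : PolyTimeNat e n) (hV : PolyTimeMat e V)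
    (hv : PolyTimeVec e v) : PolyTimeDec e fun x => (V x).SpanTest (v x) :=
  PolyTimeVec.eq hn (hv.smul hn (hV.gramDet hm hn))
    (PolyTimeMat.vecMul hm hn (hV.coords hm hn hv) hV)

end

/-! ### Bases of lattices -/

namespace Hermite

variable {r : ℕ}

/-- Reduction modulo `d` of all coordinates but the `i`-th one. -/
def reduce (d : ℤ) (i : Fin r) (v : Fin r → ℤ) : Fin r → ℤ :=
  fun j => if j = i then v j else v j % d

/-- One step of the Euclidean algorithm on two vectors, at coordinate `i`. -/
def euclidStep (d : ℤ) (i : Fin r) (p : (Fin r → ℤ) × (Fin r → ℤ)) : (Fin r → ℤ) × (Fin r → ℤ) :=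
  if p.2 i = 0 then p else (p.2, reduce d i (p.1 - (p.1 i / p.2 i) • p.2))

/-- The number of steps after which the Euclidean algorithm has stopped. -/
def rounds (d : ℤ) : ℕ := 2 * d.natAbs.size + 1

/-- The Euclidean algorithm on two vectors, at coordinate `i`. -/
def euclid (d : ℤ) (i : Fin r) (p : (Fin r → ℤ) × (Fin r → ℤ)) : (Fin r → ℤ) × (Fin r → ℤ) :=
  (euclidStep d i)^[rounds d] p

theorem euclidStep_snd_apply {d : ℤ} {i : Fin r} {p : (Fin r → ℤ) × (Fin r → ℤ)} (h : p.2 i ≠ 0) :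
    (euclidStep d i p).2 i = p.1 i % p.2 i := by
  simp only [euclidStep, if_neg h, reduce, if_true, Pi.sub_apply, Pi.smul_apply, smul_eq_mul]
  rw [Int.emod_def, mul_comm]

theorem euclidStep_fst {d : ℤ} {i : Fin r} {p : (Fin r → ℤ) × (Fin r → ℤ)} (h : p.2 i ≠ 0) :
    (euclidStep d i p).1 = p.2 := by
  simp only [euclidStep, if_neg h]

/-- Both vectors have entries between `0` and `d`. -/
def InRange (d : ℤ) (v : Fin r → ℤ) : Prop := ∀ j, 0 ≤ v j ∧ v j ≤ d

theorem inRange_emod {d : ℤ} (hd : 0 < d) (v : Fin r → ℤ) : InRange d fun j => v j % d :=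
  fun _ => ⟨Int.emod_nonneg _ hd.ne', (Int.emod_lt_of_pos _ hd).le⟩

/-- The entry at `i` is a remainder and all other entries are reduced modulo `d`, so large quotients
cannot blow up the vectors. -/
theorem inRange_euclidStep {d : ℤ} (hd : 0 < d) (i : Fin r) {p : (Fin r → ℤ) × (Fin r → ℤ)}
    (h1 : InRange d p.1) (h2 : InRange d p.2) :
    InRange d (euclidStep d i p).1 ∧ InRange d (euclidStep d i p).2 := by
  by_cases h : p.2 i = 0
  · simp only [euclidStep, if_pos h]; exact ⟨h1, h2⟩
  · rw [euclidStep_fst h]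
    refine ⟨h2, fun j => ?_⟩
    by_cases hj : j = i
    · subst hj
      rw [euclidStep_snd_apply h]
      have hpos : 0 < p.2 j := lt_of_le_of_ne (h2 j).1 (Ne.symm h)
      exact ⟨Int.emod_nonneg _ h, (Int.emod_lt_of_pos _ hpos).le.trans (h2 j).2⟩
    · simp only [euclidStep, if_neg h, reduce, if_neg hj]
      exact ⟨Int.emod_nonneg _ hd.ne', (Int.emod_lt_of_pos _ hd).le⟩

theorem inRange_iterate {d : ℤ} (hd : 0 < d) (i : Fin r) {p : (Fin r → ℤ) × (Fin r → ℤ)}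
    (h1 : InRange d p.1) (h2 : InRange d p.2) (k : ℕ) :
    InRange d ((euclidStep d i)^[k] p).1 ∧ InRange d ((euclidStep d i)^[k] p).2 := by
  induction k with
  | zero => exact ⟨h1, h2⟩
  | succ k ih => rw [Function.iterate_succ_apply']; exact inRange_euclidStep hd i ih.1 ih.2

/-- From the second round on, the entries `a ≥ b` at `i` satisfy `2 (a mod b) ≤ a` as long as `b >
0`, so their product is at least halved in each round. The product starts below `2 ^ (2 * size d)`
and is at least `1` while `b > 0`. The first round only establishes the order, which is the extra
`1` in `rounds`. -/
theorem euclid_snd_apply {d : ℤ} (hd : 0 < d) (i : Fin r) {p : (Fin r → ℤ) × (Fin r → ℤ)}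
    (h1 : InRange d p.1) (h2 : InRange d p.2) : (euclid d i p).2 i = 0 := by
  have key : ∀ k, ((euclidStep d i)^[k + 1] p).2 i ≤ ((euclidStep d i)^[k + 1] p).1 i ∧
      ((euclidStep d i)^[k + 1] p).1 i * ((euclidStep d i)^[k + 1] p).2 i * 2 ^ k ≤ d * d := by
    intro k
    induction k with
    | zero =>
      obtain ⟨h1', h2'⟩ := inRange_iterate hd i h1 h2 1
      refine ⟨?_, ?_⟩
      · simp only [zero_add, Function.iterate_one]
        by_cases h : p.2 i = 0
        · simp only [euclidStep, if_pos h]; rw [h]; exact (h1 i).1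
        · rw [euclidStep_fst h, euclidStep_snd_apply h]
          exact (Int.emod_lt_of_pos _ (lt_of_le_of_ne (h2 i).1 (Ne.symm h))).le
      · simpa using mul_le_mul (h1' i).2 (h2' i).2 (h2' i).1 hd.le
    | succ k ih =>
      obtain ⟨h1', h2'⟩ := inRange_iterate hd i h1 h2 (k + 1)
      rw [Function.iterate_succ_apply']
      set q := (euclidStep d i)^[k + 1] p
      by_cases h : q.2 i = 0
      · simp only [euclidStep, if_pos h]
        refine ⟨ih.1, ?_⟩
        rw [h]; simp; positivity
      · rw [euclidStep_fst h, euclidStep_snd_apply h]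
        have hpos : 0 < q.2 i := lt_of_le_of_ne (h2' i).1 (Ne.symm h)
        have hlt := Int.emod_lt_of_pos (q.1 i) hpos
        refine ⟨hlt.le, le_trans ?_ ih.2⟩
        have hq : 1 ≤ q.1 i / q.2 i := by
          rw [Int.le_ediv_iff_mul_le hpos]; simpa using ih.1
        have h3 := Int.emod_add_mul_ediv (q.1 i) (q.2 i)
        have h4 : q.2 i ≤ q.2 i * (q.1 i / q.2 i) := le_mul_of_one_le_right hpos.le hq
        have h5 : 2 * (q.1 i % q.2 i) ≤ q.1 i := by linarith
        calc q.2 i * (q.1 i % q.2 i) * 2 ^ (k + 1)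
            = (2 * (q.1 i % q.2 i)) * (q.2 i * 2 ^ k) := by ring
          _ ≤ q.1 i * (q.2 i * 2 ^ k) := mul_le_mul_of_nonneg_right h5 (by positivity)
          _ = _ := by ring
  obtain ⟨k1, k2⟩ := key (2 * d.natAbs.size)
  obtain ⟨h1', h2'⟩ := inRange_iterate hd i h1 h2 (2 * d.natAbs.size + 1)
  rw [euclid, rounds]
  set q := (euclidStep d i)^[2 * d.natAbs.size + 1] p
  by_contra h
  have hpos : 0 < q.2 i := lt_of_le_of_ne (h2' i).1 (Ne.symm h)
  have hlt : d < 2 ^ d.natAbs.size := by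
    have := Nat.lt_size_self d.natAbs
    zify at this
    rwa [abs_of_pos hd] at this
  have h6 : (1 : ℤ) ≤ q.1 i * q.2 i := by nlinarith
  have h7 : d * d < 2 ^ (2 * d.natAbs.size) := by
    rw [two_mul, pow_add]; exact mul_lt_mul'' hlt hlt hd.le hd.le
  nlinarith [pow_pos (show (0 : ℤ) < 2 by norm_num) (2 * d.natAbs.size)]

/-! The lattice is preserved. -/

/-- The entries before `i` vanish, the entry at `i` is left alone, and the change at a later `j` is
a multiple of `Pi.single j d`, which lies in `L`. -/
theorem sub_reduce_mem {d : ℤ} {i : Fin r} {L : Submodule ℤ (Fin r → ℤ)}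
    (hL : ∀ j, i < j → Pi.single j d ∈ L) {v : Fin r → ℤ} (hv : ∀ j < i, v j = 0) :
    v - reduce d i v ∈ L := by
  have : v - reduce d i v = ∑ j, (if i < j then v j / d else 0) • (Pi.single j d : Fin r → ℤ) := by
    ext l
    rw [Finset.sum_apply, Finset.sum_eq_single l]
    · rcases lt_trichotomy l i with h | h | h
      · simp [reduce, h.ne, hv l h]
      · simp [reduce, h]
      · simp only [reduce, h.ne', if_false, Pi.sub_apply, h, if_true, Pi.smul_apply,
          Pi.single_eq_same, smul_eq_mul]
        rw [Int.emod_def]; ring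
    · intro j _ hj; simp [Pi.single_eq_of_ne (Ne.symm hj)]
    · simp
  rw [this]
  refine Submodule.sum_mem _ fun j _ => ?_
  split_ifs with h
  · exact L.smul_mem _ (hL j h)
  · simp

/-- A division step with exchange of the two vectors is unimodular, and the reduction modulo `d`
only subtracts an element of `L`, which will be the span of other rows. -/
theorem euclidStep_invariant {d : ℤ} {i : Fin r} {L : Submodule ℤ (Fin r → ℤ)}
    (hL : ∀ j, i < j → Pi.single j d ∈ L) {p : (Fin r → ℤ) × (Fin r → ℤ)}
    (h1 : ∀ j < i, p.1 j = 0) (h2 : ∀ j < i, p.2 j = 0) :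
    (∀ j < i, (euclidStep d i p).1 j = 0) ∧ (∀ j < i, (euclidStep d i p).2 j = 0) ∧
    Submodule.span ℤ {(euclidStep d i p).1, (euclidStep d i p).2} ⊔ L =
      Submodule.span ℤ {p.1, p.2} ⊔ L := by
  by_cases h : p.2 i = 0
  · simp only [euclidStep, if_pos h]; exact ⟨h1, h2, trivial⟩
  simp only [euclidStep, if_neg h]
  have h3 : ∀ j < i, (p.1 - (p.1 i / p.2 i) • p.2) j = 0 := fun j hj => by simp [h1 j hj, h2 j hj]
  refine ⟨h2, fun j hj => ?_, ?_⟩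
  · simp only [reduce, if_neg hj.ne, h3 j hj, Int.zero_emod]
  · have hm := sub_reduce_mem hL h3
    set u := p.1 - (p.1 i / p.2 i) • p.2 with hu
    have e1 : reduce d i u = p.1 - (p.1 i / p.2 i) • p.2 - (u - reduce d i u) := by
      rw [← hu]; abel
    have e2 : p.1 = reduce d i u + (p.1 i / p.2 i) • p.2 + (u - reduce d i u) := by
      rw [hu]; abel
    apply le_antisymm
    · refine sup_le (Submodule.span_le.2 ?_) le_sup_right
      have hp1 : p.1 ∈ Submodule.span ℤ {p.1, p.2} ⊔ L :=
        Submodule.mem_sup_left (Submodule.subset_span (by simp))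
      have hp2 : p.2 ∈ Submodule.span ℤ {p.1, p.2} ⊔ L :=
        Submodule.mem_sup_left (Submodule.subset_span (by simp))
      rintro x (rfl | rfl)
      · exact hp2
      · rw [e1]
        exact sub_mem (sub_mem hp1 (Submodule.smul_mem _ _ hp2)) (Submodule.mem_sup_right hm)
    · refine sup_le (Submodule.span_le.2 ?_) le_sup_right
      have hp1 : p.2 ∈ Submodule.span ℤ {p.2, reduce d i u} ⊔ L :=
        Submodule.mem_sup_left (Submodule.subset_span (by simp))
      have hp2 : reduce d i u ∈ Submodule.span ℤ {p.2, reduce d i u} ⊔ L :=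
        Submodule.mem_sup_left (Submodule.subset_span (by simp))
      rintro x (rfl | rfl)
      · rw [e2]
        exact add_mem (add_mem hp2 (Submodule.smul_mem _ _ hp1)) (Submodule.mem_sup_right hm)
      · exact hp1

theorem euclid_invariant {d : ℤ} {i : Fin r} {L : Submodule ℤ (Fin r → ℤ)}
    (hL : ∀ j, i < j → Pi.single j d ∈ L) {p : (Fin r → ℤ) × (Fin r → ℤ)}
    (h1 : ∀ j < i, p.1 j = 0) (h2 : ∀ j < i, p.2 j = 0) :
    (∀ j < i, (euclid d i p).1 j = 0) ∧ (∀ j < i, (euclid d i p).2 j = 0) ∧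
    Submodule.span ℤ {(euclid d i p).1, (euclid d i p).2} ⊔ L =
      Submodule.span ℤ {p.1, p.2} ⊔ L := by
  rw [euclid]
  induction rounds d with
  | zero => exact ⟨h1, h2, rfl⟩
  | succ k ih =>
    rw [Function.iterate_succ_apply']
    obtain ⟨a, b, c⟩ := euclidStep_invariant hL ih.1 ih.2.1
    exact ⟨a, b, c.trans ih.2.2⟩

/-- The states of the insertion of the vector `c` into the triangular basis `H`. -/
def insertState (d : ℤ) (H : Matrix (Fin r) (Fin r) ℤ) (c : Fin r → ℤ) :
    ℕ → Matrix (Fin r) (Fin r) ℤ × (Fin r → ℤ)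
  | 0 => (H, fun j => c j % d)
  | i + 1 =>
    if h : i < r then
      (Matrix.updateRow (insertState d H c i).1 ⟨i, h⟩
        (euclid d ⟨i, h⟩ ((insertState d H c i).1 ⟨i, h⟩, (insertState d H c i).2)).1,
        (euclid d ⟨i, h⟩ ((insertState d H c i).1 ⟨i, h⟩, (insertState d H c i).2)).2)
    else insertState d H c i

/-- Insertion of a vector into a triangular basis. -/
def insertRow (d : ℤ) (H : Matrix (Fin r) (Fin r) ℤ) (c : Fin r → ℤ) : Matrix (Fin r) (Fin r) ℤ :=
  (insertState d H c r).1

theorem inRange_insertState {d : ℤ} (hd : 0 < d) {H : Matrix (Fin r) (Fin r) ℤ} (c : Fin r → ℤ)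
    (hH : ∀ k, InRange d (H k)) (i : ℕ) :
    (∀ k, InRange d ((insertState d H c i).1 k)) ∧ InRange d (insertState d H c i).2 := by
  induction i with
  | zero => exact ⟨hH, inRange_emod hd c⟩
  | succ i ih =>
    by_cases h : i < r
    · simp only [insertState, dif_pos h]
      obtain ⟨h1, h2⟩ := inRange_iterate hd ⟨i, h⟩
        (p := ((insertState d H c i).1 ⟨i, h⟩, (insertState d H c i).2)) (ih.1 _) ih.2 (rounds d)
      refine ⟨fun k => ?_, h2⟩
      by_cases hk : k = ⟨i, h⟩
      · rw [hk, Matrix.updateRow_self]; exact h1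
      · rw [Matrix.updateRow_ne hk]; exact ih.1 k
    · simpa only [insertState, dif_neg h] using ih

/-- `H` is upper triangular, and its last rows generate the corresponding multiples of `d`. -/
def Good (d : ℤ) (H : Matrix (Fin r) (Fin r) ℤ) : Prop :=
  (∀ k, ∀ j < k, H k j = 0) ∧ ∀ j, Pi.single j d ∈ Submodule.span ℤ (H.row '' {k | j ≤ k})

theorem insertState_invariant {d : ℤ} (hd : 0 < d) {H : Matrix (Fin r) (Fin r) ℤ} (c : Fin r → ℤ)
    (hR : ∀ k, InRange d (H k)) (hH : Good d H) (i : ℕ) :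
    (∀ k : Fin r, i ≤ k → (insertState d H c i).1 k = H k) ∧
    (∀ k, ∀ j < k, (insertState d H c i).1 k j = 0) ∧
    (∀ j : Fin r, j < i → (insertState d H c i).2 j = 0) := by
  induction i with
  | zero => exact ⟨fun k _ => rfl, hH.1, fun j hj => absurd hj (Nat.not_lt_zero _)⟩
  | succ i ih =>
    obtain ⟨h1, h2, h3⟩ := ih
    by_cases h : i < r
    · simp only [insertState, dif_pos h]
      have hr := inRange_insertState hd c hR i
      -- Only the vanishing entries are needed here, so the lattice may be everything.
      obtain ⟨e1, e2, -⟩ := euclid_invariant (d := d) (i := ⟨i, h⟩) (L := (⊤ : Submodule ℤ (Fin r → ℤ)))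
        (p := ((insertState d H c i).1 ⟨i, h⟩, (insertState d H c i).2)) (fun _ _ => Submodule.mem_top)
        (h2 ⟨i, h⟩) (fun j hj => h3 j hj)
      have e3 := euclid_snd_apply hd ⟨i, h⟩
        (p := ((insertState d H c i).1 ⟨i, h⟩, (insertState d H c i).2)) (hr.1 _) hr.2
      refine ⟨fun k hk => ?_, fun k j hj => ?_, fun j hj => ?_⟩
      · rw [Matrix.updateRow_ne (by rintro rfl; simp at hk)]
        exact h1 k (by omega)
      · by_cases hk : k = ⟨i, h⟩
        · subst hk; rw [Matrix.updateRow_self]; exact e1 j hj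
        · rw [Matrix.updateRow_ne hk]; exact h2 k j hj
      · rcases Nat.lt_succ_iff_lt_or_eq.1 hj with hj | hj
        · exact e2 j hj
        · obtain rfl : j = ⟨i, h⟩ := Fin.ext hj
          exact e3
    · simp only [insertState, dif_neg h]
      exact ⟨fun k hk => absurd k.2 (by omega), h2, fun j hj => h3 j (by have := j.2; omega)⟩

theorem image_updateRow (H : Matrix (Fin r) (Fin r) ℤ) (i : Fin r) (v : Fin r → ℤ)
    {s : Set (Fin r)} (hi : i ∈ s) :
    (H.updateRow i v).row '' s = insert v (H.row '' (s \ {i})) := by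
  conv_lhs => rw [← Set.insert_sdiff_self_of_mem hi, Set.image_insert_eq]
  congr 1
  · exact Matrix.updateRow_self
  · exact Set.image_congr fun k hk => Matrix.updateRow_ne hk.2

theorem span_insert_insert (a b : Fin r → ℤ) (s : Set (Fin r → ℤ)) :
    Submodule.span ℤ (insert b (insert a s)) = Submodule.span ℤ {a, b} ⊔ Submodule.span ℤ s := by
  rw [← Submodule.span_union, Set.insert_comm]; simp [Set.insert_union]

/-- Round `i` changes only row `i` and the vector in transit. Its reductions modulo `d` are harmless
because the rows after `i` are still those of `H`, and these generate `Pi.single j d` for `j > i`.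
All tails from `t ≤ i` on are considered in order to carry `Good` along. -/
theorem span_insertState_succ {d : ℤ} (hd : 0 < d) {H : Matrix (Fin r) (Fin r) ℤ} (c : Fin r → ℤ)
    (hR : ∀ k, InRange d (H k)) (hH : Good d H) {i : ℕ} {t : Fin r} (hti : t ≤ i) :
    Submodule.span ℤ (insert (insertState d H c (i + 1)).2
      ((insertState d H c (i + 1)).1.row '' {k | t ≤ k})) =
    Submodule.span ℤ (insert (insertState d H c i).2 ((insertState d H c i).1.row '' {k | t ≤ k})) := by
  by_cases h : i < r
  · obtain ⟨h1, h2, h3⟩ := insertState_invariant hd c hR hH i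
    have hmem : (⟨i, h⟩ : Fin r) ∈ {k | t ≤ k} := hti
    have hL : ∀ j, (⟨i, h⟩ : Fin r) < j → Pi.single j d ∈
        Submodule.span ℤ ((insertState d H c i).1.row '' ({k | t ≤ k} \ {⟨i, h⟩})) := by
      intro j hj
      refine Submodule.span_mono ?_ (hH.2 j)
      rintro _ ⟨k, hk, rfl⟩
      have hik : (⟨i, h⟩ : Fin r) < k := hj.trans_le hk
      exact ⟨k, ⟨le_trans hmem hik.le, hik.ne'⟩, h1 k hik.le⟩
    obtain ⟨-, -, e⟩ := euclid_invariant (d := d) (i := ⟨i, h⟩) hL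
        (p := ((insertState d H c i).1 ⟨i, h⟩, (insertState d H c i).2)) (h2 ⟨i, h⟩)
        (fun j hj => h3 j hj)
    simp only [insertState, dif_pos h]
    rw [image_updateRow _ _ _ hmem, span_insert_insert, e, ← span_insert_insert]
    congr 2
    conv_rhs => rw [← Set.insert_sdiff_self_of_mem hmem, Set.image_insert_eq]
    rfl
  · simp only [insertState, dif_neg h]

theorem span_insertState {d : ℤ} (hd : 0 < d) {H : Matrix (Fin r) (Fin r) ℤ} (c : Fin r → ℤ)
    (hR : ∀ k, InRange d (H k)) (hH : Good d H) {i : ℕ} {t : Fin r} (hti : t ≤ i) (j : ℕ) :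
    Submodule.span ℤ (insert (insertState d H c (i + j)).2
      ((insertState d H c (i + j)).1.row '' {k | t ≤ k})) =
    Submodule.span ℤ (insert (insertState d H c i).2 ((insertState d H c i).1.row '' {k | t ≤ k})) := by
  induction j with
  | zero => rfl
  | succ j ih => rw [← ih, ← add_assoc, span_insertState_succ hd c hR hH (by omega)]

theorem span_insertRow_aux {d : ℤ} (hd : 0 < d) {H : Matrix (Fin r) (Fin r) ℤ} (c : Fin r → ℤ)
    (hR : ∀ k, InRange d (H k)) (hH : Good d H) {i : ℕ} {t : Fin r} (hti : t ≤ i) (hir : i ≤ r) :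
    Submodule.span ℤ ((insertRow d H c).row '' {k | t ≤ k}) =
    Submodule.span ℤ (insert (insertState d H c i).2 ((insertState d H c i).1.row '' {k | t ≤ k})) := by
  rw [← span_insertState hd c hR hH hti (r - i), Nat.add_sub_cancel' hir]
  have h0 : (insertState d H c r).2 = 0 :=
    funext fun j => (insertState_invariant hd c hR hH r).2.2 j j.2
  rw [h0, Submodule.span_insert_zero]; rfl

/-- When round `j` begins, the rows from `j` on are untouched and generate `Pi.single j d`. The
later rounds preserve the span of these rows and the vector in transit, and that vector ends up as
zero. -/
theorem good_insertRow {d : ℤ} (hd : 0 < d) {H : Matrix (Fin r) (Fin r) ℤ} (c : Fin r → ℤ)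
    (hR : ∀ k, InRange d (H k)) (hH : Good d H) : Good d (insertRow d H c) := by
  refine ⟨(insertState_invariant hd c hR hH r).2.1, fun j => ?_⟩
  rw [span_insertRow_aux hd c hR hH (i := j) le_rfl j.2.le]
  refine Submodule.span_mono ?_ (hH.2 j)
  rintro _ ⟨k, hk, rfl⟩
  exact Set.mem_insert_of_mem _ ⟨k, hk, (insertState_invariant hd c hR hH j).1 k hk⟩

theorem span_insertRow {d : ℤ} (hd : 0 < d) {H : Matrix (Fin r) (Fin r) ℤ} (c : Fin r → ℤ)
    (hR : ∀ k, InRange d (H k)) (hH : Good d H) :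
    Submodule.span ℤ (Set.range (insertRow d H c).row) = Submodule.span ℤ (insert c (Set.range H.row)) := by
  cases r with
  | zero => exact Subsingleton.elim _ _
  | succ r =>
    have huniv : {k : Fin (r + 1) | 0 ≤ k} = Set.univ := Set.eq_univ_of_forall fun k => Fin.zero_le k
    have h := span_insertRow_aux hd c hR hH (i := 0) (t := 0) le_rfl (Nat.zero_le _)
    rw [huniv, Set.image_univ, Set.image_univ] at h
    rw [h]
    simp only [insertState]
    have hd' : ∀ j, Pi.single j d ∈ Submodule.span ℤ (Set.range H.row) := fun j =>
      Submodule.span_mono (Set.image_subset_range _ _) (hH.2 j)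
    -- The vector is inserted after reduction modulo `d`; the difference is a combination of the
    -- vectors `Pi.single j d`.
    have hc : c - (fun j => c j % d) ∈ Submodule.span ℤ (Set.range H.row) := by
      have : c - (fun j => c j % d) = ∑ j, (c j / d) • (Pi.single j d : Fin (r + 1) → ℤ) := by
        ext l
        rw [Finset.sum_apply, Finset.sum_eq_single l]
        · simp only [Pi.sub_apply, Pi.smul_apply, Pi.single_eq_same, smul_eq_mul]
          rw [Int.emod_def]; ring
        · intro j _ hj; simp [Pi.single_eq_of_ne (Ne.symm hj)]
        · simp
      rw [this]
      exact Submodule.sum_mem _ fun j _ => Submodule.smul_mem _ _ (hd' j)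
    rw [Submodule.span_insert, Submodule.span_insert]
    apply le_antisymm
    · refine sup_le ?_ le_sup_right
      rw [Submodule.span_singleton_le_iff_mem]
      rw [show (fun j => c j % d) = c - (c - fun j => c j % d) by abel]
      exact sub_mem (Submodule.mem_sup_left (Submodule.mem_span_singleton_self _))
        (Submodule.mem_sup_right hc)
    · refine sup_le ?_ le_sup_right
      rw [Submodule.span_singleton_le_iff_mem]
      have h1 := add_mem (Submodule.mem_sup_left (Submodule.mem_span_singleton_self
        fun j => c j % d)) (Submodule.mem_sup_right hc)
      rwa [add_sub_cancel] at h1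

/-- The states of the computation of a basis of the lattice that is generated by the rows of `C`
and the multiples of `d`. -/
def basisState {N : ℕ} (d : ℤ) (C : Matrix (Fin N) (Fin r) ℤ) : ℕ → Matrix (Fin r) (Fin r) ℤ
  | 0 => d • 1
  | k + 1 => if h : k < N then insertRow d (basisState d C k) (C ⟨k, h⟩) else basisState d C k

/-- A basis of the lattice that is generated by the rows of `C` and the multiples of `d`. -/
def basis {N : ℕ} (d : ℤ) (C : Matrix (Fin N) (Fin r) ℤ) : Matrix (Fin r) (Fin r) ℤ :=
  basisState d C N

theorem basisState_spec {N : ℕ} {d : ℤ} (hd : 0 < d) (C : Matrix (Fin N) (Fin r) ℤ) (k : ℕ) :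
    (∀ i, InRange d (basisState d C k i)) ∧ Good d (basisState d C k) ∧
    Submodule.span ℤ (Set.range (basisState d C k).row) =
      Submodule.span ℤ (Set.range (fun j => (Pi.single j d : Fin r → ℤ)) ∪
        C.row '' {j | (j : ℕ) < k}) := by
  induction k with
  | zero =>
    have h : basisState d C 0 = fun j => (Pi.single j d : Fin r → ℤ) := by
      ext i j
      by_cases hij : i = j
      · subst hij; simp [basisState]
      · simp [basisState, hij, Ne.symm hij]
    refine ⟨fun i j => ?_, ⟨fun k j hj => ?_, fun j => Submodule.subset_span ?_⟩, ?_⟩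
    · rw [h]
      by_cases hij : i = j
      · subst hij; simp [hd.le]
      · simp [Ne.symm hij, hd.le]
    · rw [h]; simp [hj.ne]
    · exact ⟨j, by simp, by rw [h]; rfl⟩
    · rw [show {j : Fin N | (j : ℕ) < 0} = ∅ from Set.eq_empty_of_forall_notMem fun j hj =>
        absurd hj (Nat.not_lt_zero _), Set.image_empty, Set.union_empty, h]
      rfl
  | succ k ih =>
    by_cases h : k < N
    · simp only [basisState, dif_pos h]
      refine ⟨(inRange_insertState hd _ ih.1 r).1, good_insertRow hd _ ih.1 ih.2.1, ?_⟩
      rw [span_insertRow hd _ ih.1 ih.2.1, Submodule.span_insert, ih.2.2, ← Submodule.span_insert]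
      congr 1
      ext v
      simp only [Set.mem_insert_iff, Set.mem_union, Set.mem_image, Set.mem_ofPred_eq]
      constructor
      · rintro (rfl | h1 | ⟨j, hj, rfl⟩)
        · exact Or.inr ⟨⟨k, h⟩, by simp, rfl⟩
        · exact Or.inl h1
        · exact Or.inr ⟨j, Nat.lt_succ_of_lt hj, rfl⟩
      · rintro (h1 | ⟨j, hj, rfl⟩)
        · exact Or.inr (Or.inl h1)
        · rcases Nat.lt_succ_iff_lt_or_eq.1 hj with hj | hj
          · exact Or.inr (Or.inr ⟨j, hj, rfl⟩)
          · left; congr 1; exact Fin.ext hj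
    · simp only [basisState, dif_neg h]
      refine ⟨ih.1, ih.2.1, ih.2.2.trans ?_⟩
      congr 3
      ext j
      have := j.2
      simp only [Set.mem_ofPred_eq]; omega

theorem span_basis {N : ℕ} {d : ℤ} (hd : 0 < d) (C : Matrix (Fin N) (Fin r) ℤ) :
    Submodule.span ℤ (Set.range (basis d C).row) =
      Submodule.span ℤ (Set.range (fun j => (Pi.single j d : Fin r → ℤ)) ∪ Set.range C.row) := by
  rw [basis, (basisState_spec hd C N).2.2]
  congr 2
  rw [← Set.image_univ]
  congr 1
  ext j; simp

end Hermite

/-! ### Polynomial running time of the lattice reduction -/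

section

variable {X : Type} {e : X → Data} {r : X → ℕ} {d : X → ℤ}

namespace Hermite

theorem InRange.natAbs_le {r : ℕ} {d : ℤ} {v : Fin r → ℤ} (h : InRange d v) (j : Fin r) :
    (v j).natAbs ≤ 2 ^ (Data.int d).size := by
  have h1 : (v j).natAbs ≤ d.natAbs := by
    have := h j; omega
  exact h1.trans (Data.natAbs_lt_of_size_le le_rfl).le

theorem polyTime_reduce (hr : PolyTimeNat e r) (hd : PolyTimeInt e d) {i : (x : X) → Fin (r x)}
    (hi : PolyTimeInt e fun x => ((i x : ℕ) : ℤ)) {v : (x : X) → Fin (r x) → ℤ}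
    (hv : PolyTimeVec e v) : PolyTimeVec e fun x => reduce (d x) (i x) (v x) := by
  classical
  refine PolyTimeVec.of_entries hr (v := fun x => reduce (d x) (i x) (v x)) ?_
  refine PolyTime.congr (((PolyTimeNat.index hr.2).int.eq hi.indexed).ite' hv.entry
    (hv.entry.mod hd.indexed)) fun p => ?_
  by_cases h : p.2 = i p.1
  · simp [reduce, h]
  · have : ¬ (p.2 : ℕ) = i p.1 := fun h' => h (Fin.ext h')
    simp [reduce, h, this]

theorem polyTime_euclidStep (hr : PolyTimeNat e r) (hd : PolyTimeInt e d)
    {i : (x : X) → Fin (r x)} (hi : PolyTimeInt e fun x => ((i x : ℕ) : ℤ))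
    {p : (x : X) → (Fin (r x) → ℤ) × (Fin (r x) → ℤ)} (h1 : PolyTimeVec e fun x => (p x).1)
    (h2 : PolyTimeVec e fun x => (p x).2) :
    PolyTime e fun x => .pair (encodeVec (euclidStep (d x) (i x) (p x)).1)
      (encodeVec (euclidStep (d x) (i x) (p x)).2) := by
  classical
  have h1i := h1.apply hi
  have h2i := h2.apply hi
  have hsub : PolyTimeVec e fun x => (p x).1 - ((p x).1 (i x) / (p x).2 (i x)) • (p x).2 :=
    PolyTimeVec.of_entries hr (v := fun x => (p x).1 - ((p x).1 (i x) / (p x).2 (i x)) • (p x).2)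
      (h1.entry.sub ((h1i.div h2i).indexed.mul h2.entry))
  refine ((h2i.eq (.const 0)).ite' (PolyTime.pair h1 h2)
    (PolyTime.pair h2 (polyTime_reduce hr hd hi hsub))).congr fun x => ?_
  by_cases h : (p x).2 (i x) = 0 <;> simp [euclidStep, h]

theorem polyBounded_rounds (hd : PolyTimeInt e d) : PolyBounded e fun x => rounds (d x) :=
  ((PolyBounded.const 2).mul hd.size).mono fun x => by
    simp only [rounds, Data.size]; omega

/-- The loop states are short because all entries stay between `0` and `d`, and the number of rounds
is linear in the bit length of `d`. -/
theorem polyTime_euclid (hr : PolyTimeNat e r) (hd : PolyTimeInt e d) (hd0 : ∀ x, 0 < d x)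
    {i : (x : X) → Fin (r x)} (hi : PolyTimeInt e fun x => ((i x : ℕ) : ℤ))
    {p : (x : X) → (Fin (r x) → ℤ) × (Fin (r x) → ℤ)} (h1 : PolyTimeVec e fun x => (p x).1)
    (h2 : PolyTimeVec e fun x => (p x).2) (h1r : ∀ x, InRange (d x) (p x).1)
    (h2r : ∀ x, InRange (d x) (p x).2) :
    PolyTime e fun x => .pair (encodeVec (euclid (d x) (i x) (p x)).1)
      (encodeVec (euclid (d x) (i x) (p x)).2) := by
  have hK := polyBounded_rounds hd
  refine PolyTime.while_fixpoint (K := fun x => rounds (d x)) hK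
    (s := fun x k => .pair (encodeVec ((euclidStep (d x) (i x))^[k] (p x)).1)
      (encodeVec ((euclidStep (d x) (i x))^[k] (p x)).2))
    (p := fun x k => ((euclidStep (d x) (i x))^[k] (p x)).2 (i x) ≠ 0)
    (PolyTime.pair h1 h2) ?_ ?_ ?_ ?_ ?_
  · have hb : PolyBounded e fun x => 1 + r x * ((Data.int (d x)).size + 3) :=
      (PolyBounded.const 1).add (hr.2.mul (hd.size.add (.const 3)))
    refine PolyBounded.sigma (((PolyBounded.const 1).add hb).add hb) ?_
    rintro x ⟨k, hk⟩
    obtain ⟨a, b⟩ := inRange_iterate (hd0 x) (i x) (h1r x) (h2r x) k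
    exact Nat.add_le_add (Nat.add_le_add_left (size_encodeVec_le a.natAbs_le) 1)
      (size_encodeVec_le b.natAbs_le)
  · have hid := PolyTime.id (fun q : Σ x, Fin (rounds (d x) + 1) => .pair (e q.1)
      (.pair (encodeVec ((euclidStep (d q.1) (i q.1))^[q.2] (p q.1)).1)
        (encodeVec ((euclidStep (d q.1) (i q.1))^[q.2] (p q.1)).2)))
    have hv : PolyTimeVec _ fun q : Σ x, Fin (rounds (d x) + 1) =>
      ((euclidStep (d q.1) (i q.1))^[q.2] (p q.1)).2 := hid.snd.snd
    exact ((hv.apply (i := fun q => i q.1) (hi.weaken _ _)).eq (.const 0)).not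
  · intro x k hk
    rw [not_not] at hk
    have : (euclidStep (d x) (i x))^[k + 1] (p x) = (euclidStep (d x) (i x))^[k] (p x) := by
      rw [Function.iterate_succ_apply', euclidStep, if_pos hk]
    simp only [this]
    exact ⟨trivial, not_not.2 hk⟩
  · intro x
    exact not_not.2 (euclid_snd_apply (hd0 x) (i x) (h1r x) (h2r x))
  · have hid := PolyTime.id (fun q : Σ x, Fin (rounds (d x)) => .pair (e q.1)
      (.pair (encodeVec ((euclidStep (d q.1) (i q.1))^[q.2] (p q.1)).1)
        (encodeVec ((euclidStep (d q.1) (i q.1))^[q.2] (p q.1)).2)))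
    have hr' : PolyTimeNat (fun q : Σ x, Fin (rounds (d x)) => .pair (e q.1)
      (.pair (encodeVec ((euclidStep (d q.1) (i q.1))^[q.2] (p q.1)).1)
        (encodeVec ((euclidStep (d q.1) (i q.1))^[q.2] (p q.1)).2))) fun q => r q.1 :=
      hid.fst.trans_nat (hr.reindex Sigma.fst)
    have hu : PolyTimeVec _ fun q : Σ x, Fin (rounds (d x)) =>
      ((euclidStep (d q.1) (i q.1))^[q.2] (p q.1)).1 := hid.snd.fst
    have hv : PolyTimeVec _ fun q : Σ x, Fin (rounds (d x)) =>
      ((euclidStep (d q.1) (i q.1))^[q.2] (p q.1)).2 := hid.snd.snd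
    refine (polyTime_euclidStep (i := fun q => i q.1) hr' (hd.weaken _ _) (hi.weaken _ _)
      hu hv).congr fun q => ?_
    simp only [Function.iterate_succ_apply']

theorem polyTime_updateRow {r m : X → ℕ} {M : (x : X) → Matrix (Fin (r x)) (Fin (m x)) ℤ}
    (hr : PolyTimeNat e r) (hM : PolyTimeMat e M) {i : (x : X) → Fin (r x)}
    (hi : PolyTimeInt e fun x => ((i x : ℕ) : ℤ)) {v : (x : X) → Fin (m x) → ℤ}
    (hv : PolyTimeVec e v) : PolyTimeMat e fun x => (M x).updateRow (i x) (v x) := by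
  classical
  refine PolyTimeMat.of_rows hr (M := fun x => (M x).updateRow (i x) (v x)) ?_
  refine PolyTime.congr (((PolyTimeNat.index hr.2).int.eq hi.indexed).ite' hv.indexed hM.row)
    fun p => ?_
  by_cases h : p.2 = i p.1
  · simp only [h, if_true, Matrix.updateRow_self]
  · have : ¬ ((p.2 : ℕ) : ℤ) = ((i p.1 : ℕ) : ℤ) := fun h' => h (Fin.ext (by exact_mod_cast h'))
    simp only [this, if_false, Matrix.updateRow_ne h]

theorem polyTime_insertRow (hr : PolyTimeNat e r) (hd : PolyTimeInt e d) (hd0 : ∀ x, 0 < d x)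
    {H : (x : X) → Matrix (Fin (r x)) (Fin (r x)) ℤ} (hH : PolyTimeMat e H)
    (hHr : ∀ x k, InRange (d x) (H x k)) {c : (x : X) → Fin (r x) → ℤ} (hc : PolyTimeVec e c) :
    PolyTimeMat e fun x => insertRow (d x) (H x) (c x) := by
  suffices h : PolyTime e fun x => .pair (encodeMat (insertState (d x) (H x) (c x) (r x)).1)
    (encodeVec (insertState (d x) (H x) (c x) (r x)).2) from h.fst
  refine PolyTime.iter hr (s := fun x i => .pair (encodeMat (insertState (d x) (H x) (c x) i).1)
    (encodeVec (insertState (d x) (H x) (c x) i).2)) ?_ ?_ ?_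
  · exact PolyTime.pair hH (PolyTimeVec.of_entries hr (v := fun x j => c x j % d x)
      (hc.entry.mod hd.indexed))
  · refine PolyBounded.sigma (B := fun x => 1 + (1 + r x * (2 + r x * ((Data.int (d x)).size + 3))) +
      (1 + r x * ((Data.int (d x)).size + 3))) (((PolyBounded.const 1).add ((PolyBounded.const 1).add
      (hr.2.mul ((PolyBounded.const 2).add (hr.2.mul (hd.size.add (.const 3))))))).add
        ((PolyBounded.const 1).add (hr.2.mul (hd.size.add (.const 3))))) ?_
    rintro x ⟨i, hi⟩
    obtain ⟨a, b⟩ := inRange_insertState (hd0 x) (c x) (hHr x) i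
    exact Nat.add_le_add (Nat.add_le_add_left (size_encodeMat_le fun k => (a k).natAbs_le) 1)
      (size_encodeVec_le b.natAbs_le)
  · have hid := PolyTime.id (fun q : Σ x, Fin (r x) => .pair (withIndex e r q)
      (.pair (encodeMat (insertState (d q.1) (H q.1) (c q.1) q.2).1)
        (encodeVec (insertState (d q.1) (H q.1) (c q.1) q.2).2)))
    have hr' : PolyTimeNat _ fun q : Σ x, Fin (r x) => r q.1 := hid.fst.trans_nat hr.indexed
    have hi : PolyTimeNat _ fun q : Σ x, Fin (r x) => (q.2 : ℕ) :=
      hid.fst.trans_nat (PolyTimeNat.index hr.2)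
    have hd' : PolyTimeInt _ fun q : Σ x, Fin (r x) => d q.1 := hid.fst.trans hd.indexed
    have hM : PolyTimeMat _ fun q : Σ x, Fin (r x) =>
      (insertState (d q.1) (H q.1) (c q.1) q.2).1 := hid.snd.fst
    have hv : PolyTimeVec _ fun q : Σ x, Fin (r x) =>
      (insertState (d q.1) (H q.1) (c q.1) q.2).2 := hid.snd.snd
    have hE := polyTime_euclid (i := fun q => q.2) (p := fun q =>
      ((insertState (d q.1) (H q.1) (c q.1) q.2).1 q.2,
        (insertState (d q.1) (H q.1) (c q.1) q.2).2)) hr' hd' (fun q => hd0 q.1) hi.int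
      (hM.row_apply hi.int) hv (fun q => (inRange_insertState (hd0 q.1) _ (hHr q.1) _).1 _)
      (fun q => (inRange_insertState (hd0 q.1) _ (hHr q.1) _).2)
    refine (PolyTime.pair (polyTime_updateRow (i := fun q => q.2) hr' hM hi.int hE.fst)
      hE.snd).congr ?_
    rintro ⟨x, i, hix⟩
    simp only [insertState, dif_pos hix]

theorem polyTime_basis (hr : PolyTimeNat e r) (hd : PolyTimeInt e d) (hd0 : ∀ x, 0 < d x)
    {N : X → ℕ} (hN : PolyTimeNat e N) {C : (x : X) → Matrix (Fin (N x)) (Fin (r x)) ℤ}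
    (hC : PolyTimeMat e C) : PolyTimeMat e fun x => basis (d x) (C x) := by
  refine PolyTime.iter hN (s := fun x k => encodeMat (basisState (d x) (C x) k)) ?_ ?_ ?_
  · exact PolyTimeMat.scalar hr hd
  · refine PolyBounded.sigma (B := fun x => (1 + r x * (2 + r x * ((Data.int (d x)).size + 3))))
      ((PolyBounded.const 1).add
      (hr.2.mul ((PolyBounded.const 2).add (hr.2.mul (hd.size.add (.const 3)))))) ?_
    rintro x ⟨k, hk⟩
    exact size_encodeMat_le fun i => ((basisState_spec (hd0 x) (C x) k).1 i).natAbs_le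
  · have hid := PolyTime.id (fun q : Σ x, Fin (N x) => .pair (withIndex e N q)
      (encodeMat (basisState (d q.1) (C q.1) q.2)))
    have hr' : PolyTimeNat _ fun q : Σ x, Fin (N x) => r q.1 := hid.fst.trans_nat hr.indexed
    have hi : PolyTimeNat _ fun q : Σ x, Fin (N x) => (q.2 : ℕ) :=
      hid.fst.trans_nat (PolyTimeNat.index hN.2)
    have hd' : PolyTimeInt _ fun q : Σ x, Fin (N x) => d q.1 := hid.fst.trans hd.indexed
    have hM : PolyTimeMat _ fun q : Σ x, Fin (N x) => basisState (d q.1) (C q.1) q.2 := hid.snd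
    have hC' : PolyTimeMat _ fun q : Σ x, Fin (N x) => C q.1 := hid.fst.trans hC.indexed
    refine PolyTimeMat.congr (polyTime_insertRow hr' hd' (fun q => hd0 q.1) hM
      (fun q => (basisState_spec (hd0 q.1) (C q.1) q.2).1)
      (hC'.row_apply (i := fun q => q.2) hi.int)) ?_
    rintro ⟨x, k, hk⟩
    simp only [basisState, dif_pos hk]

end Hermite

end

/-! ### Integer versions of the data of an automaton -/

/-- The integer `D * q` for a multiple `D` of the denominator of `q`. -/
def scaleRat (D : ℤ) (q : ℚ) : ℤ := q.num * (D / q.den)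

theorem cast_scaleRat {D : ℤ} {q : ℚ} (h : (q.den : ℤ) ∣ D) : (scaleRat D q : ℚ) = D * q := by
  have h0 : (q.den : ℚ) ≠ 0 := by exact_mod_cast q.den_ne_zero
  have h0' : ((q.den : ℤ) : ℚ) ≠ 0 := by exact_mod_cast h0
  rw [scaleRat, Int.cast_mul, Int.cast_div h h0']
  nth_rewrite 3 [← Rat.num_div_den q]
  push_cast
  ring

namespace WeightedAutomaton

variable {k n : ℕ} (A : WeightedAutomaton k n)

/-- A common denominator of all entries. -/
def denom : ℤ :=
  (∏ i, ((A.init i).den : ℤ)) * (∏ σ, ∏ i, ∏ j, ((A.trans σ i j).den : ℤ)) *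
    ∏ i, ((A.fin i).den : ℤ)

theorem denom_pos : 0 < A.denom := by
  have h : ∀ q : ℚ, (0 : ℤ) < q.den := fun q => by exact_mod_cast q.den_pos
  refine mul_pos (mul_pos (Finset.prod_pos fun i _ => h _) (Finset.prod_pos fun σ _ =>
    Finset.prod_pos fun i _ => Finset.prod_pos fun j _ => h _)) (Finset.prod_pos fun i _ => h _)

/-- The initial vector, times `denom`. -/
def intInit : Fin n → ℤ := fun i => scaleRat A.denom (A.init i)

/-- The transition matrices, times `denom`. -/
def intTrans (σ : Fin k) : Matrix (Fin n) (Fin n) ℤ := fun i j => scaleRat A.denom (A.trans σ i j)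

/-- The final vector, times `denom`. -/
def intFin : Fin n → ℤ := fun i => scaleRat A.denom (A.fin i)

/-- The products of the matrices `intTrans σ`. -/
def intWord (w : Word k) : Matrix (Fin n) (Fin n) ℤ := (w.map A.intTrans).prod

/-- A multiple of the backward vector. -/
def intBackward (w : Word k) : Fin n → ℤ := A.intWord w *ᵥ A.intFin

/-- A multiple of the weight. -/
def numer (w : Word k) : ℤ := A.intInit ⬝ᵥ A.intBackward w

theorem cast_intInit (i : Fin n) : (A.intInit i : ℚ) = A.denom * A.init i :=
  cast_scaleRat (Dvd.dvd.mul_right (Dvd.dvd.mul_right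
    (Finset.dvd_prod_of_mem (fun i => ((A.init i).den : ℤ)) (Finset.mem_univ i)) _) _)

theorem cast_intFin (i : Fin n) : (A.intFin i : ℚ) = A.denom * A.fin i :=
  cast_scaleRat (Dvd.dvd.mul_left
    (Finset.dvd_prod_of_mem (fun i => ((A.fin i).den : ℤ)) (Finset.mem_univ i)) _)

theorem cast_intTrans (σ : Fin k) (i j : Fin n) :
    (A.intTrans σ i j : ℚ) = A.denom * A.trans σ i j :=
  cast_scaleRat (Dvd.dvd.mul_right (Dvd.dvd.mul_left
    (((Finset.dvd_prod_of_mem (fun j => ((A.trans σ i j).den : ℤ)) (Finset.mem_univ j)).trans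
    (Finset.dvd_prod_of_mem (fun i => ∏ j, ((A.trans σ i j).den : ℤ)) (Finset.mem_univ i))).trans
    (Finset.dvd_prod_of_mem (fun σ => ∏ i, ∏ j, ((A.trans σ i j).den : ℤ))
      (Finset.mem_univ σ))) _) _)

/-- Each transition matrix contributes one factor `denom`. The vectors at the two ends contribute
one factor each, which accounts for the exponents `length + 1` and `length + 2` below. -/
theorem cast_intWord (w : Word k) (i j : Fin n) :
    (A.intWord w i j : ℚ) = (A.denom : ℚ) ^ w.length * A.transWord w i j := by
  induction w generalizing i j with
  | nil => by_cases h : i = j <;> simp [intWord, transWord, h]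
  | cons σ w ih =>
    have h1 : A.intWord (σ :: w) = A.intTrans σ * A.intWord w := by simp [intWord]
    have h2 : A.transWord (σ :: w) = A.trans σ * A.transWord w := by simp [transWord]
    rw [h1, h2, Matrix.mul_apply, Matrix.mul_apply, Int.cast_sum, Finset.mul_sum]
    refine Finset.sum_congr rfl fun l _ => ?_
    rw [Int.cast_mul, ih, cast_intTrans, List.length_cons, pow_succ]; ring

theorem cast_intBackward (w : Word k) (i : Fin n) :
    (A.intBackward w i : ℚ) = (A.denom : ℚ) ^ (w.length + 1) * A.backward w i := by
  simp only [intBackward, backward, Matrix.mulVec, dotProduct, Int.cast_sum, Int.cast_mul,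
    cast_intWord, cast_intFin, Finset.mul_sum]
  exact Finset.sum_congr rfl fun l _ => by ring

theorem weight_eq (w : Word k) : A.weight w = A.init ⬝ᵥ A.backward w := by
  rw [weight, forward, backward, Matrix.dotProduct_mulVec]

theorem cast_numer (w : Word k) :
    (A.numer w : ℚ) = (A.denom : ℚ) ^ (w.length + 2) * A.weight w := by
  rw [weight_eq]
  simp only [numer, dotProduct, Int.cast_sum, Int.cast_mul, cast_intInit, cast_intBackward,
    Finset.mul_sum]
  exact Finset.sum_congr rfl fun l _ => by ring

end WeightedAutomaton

/-- A list of words as a value. -/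
def encodeWords {k : ℕ} (W : List (Word k)) : Data := .ofList (W.map Data.ofWord)

/-- One more letter means sums of `n ≤ 2 ^ n` terms with one more factor, hence at most `B + n` more
bits. -/
theorem WeightedAutomaton.natAbs_intWord_le {k n : ℕ} (A : WeightedAutomaton k n) {B : ℕ}
    (hB : ∀ σ i j, (A.intTrans σ i j).natAbs ≤ 2 ^ B) (w : Word k) (i j : Fin n) :
    (A.intWord w i j).natAbs ≤ 2 ^ (w.length * (B + n)) := by
  induction w generalizing i j with
  | nil => by_cases h : i = j <;> simp [WeightedAutomaton.intWord, h]
  | cons σ w ih =>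
    have h1 : A.intWord (σ :: w) = A.intTrans σ * A.intWord w := by
      simp [WeightedAutomaton.intWord]
    rw [h1, Matrix.mul_apply]
    refine (natAbs_sum_le _ _ (2 ^ B * 2 ^ (w.length * (B + n))) fun l _ => ?_).trans ?_
    · rw [Int.natAbs_mul]; exact Nat.mul_le_mul (hB _ _ _) (ih _ _)
    · rw [Finset.card_univ, Fintype.card_fin, List.length_cons, add_mul, one_mul, pow_add, pow_add]
      calc n * (2 ^ B * 2 ^ (w.length * (B + n)))
          ≤ 2 ^ n * (2 ^ B * 2 ^ (w.length * (B + n))) :=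
            Nat.mul_le_mul_right _ Nat.lt_two_pow_self.le
        _ = _ := by ring

/-! ### Words and automata computed in polynomial time -/

section

variable {X : Type} {e : X → Data} {k n : X → ℕ}

theorem PolyTime.wordLength {w : (x : X) → Word (k x)} (hw : PolyTime e fun x => .ofWord (w x)) :
    PolyTimeNat e fun x => (w x).length := by
  have h := PolyTime.length (l := fun x => (w x).map fun σ => .int (σ.val : ℤ)) hw
  exact h.congr fun x => by simp

theorem PolyTime.letter {w : (x : X) → Word (k x)} (hw : PolyTime e fun x => .ofWord (w x)) :
    PolyTimeInt (withIndex e fun x => (w x).length) fun p => (((w p.1).get p.2 : ℕ) : ℤ) := by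
  refine PolyTime.nthFn_index (g := fun x i => .int (((w x).get i : ℕ) : ℤ)) (hw.congr fun x => ?_)
  rw [Data.ofWord]
  congr 1
  conv_lhs => rw [← List.ofFn_get (w x), List.map_ofFn]
  rfl

theorem PolyTime.wordsLength {W : (x : X) → List (Word (k x))}
    (hW : PolyTime e fun x => encodeWords (W x)) : PolyTimeNat e fun x => (W x).length := by
  have h := PolyTime.length (l := fun x => (W x).map Data.ofWord) hW
  exact h.congr fun x => by simp

theorem PolyTime.wordsFn {W : (x : X) → List (Word (k x))}
    (hW : PolyTime e fun x => encodeWords (W x)) :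
    PolyTime e fun x => .ofList (List.ofFn fun i => .ofWord ((W x).get i)) := by
  refine hW.congr fun x => ?_
  rw [encodeWords]
  congr 1
  conv_lhs => rw [← List.ofFn_get (W x), List.map_ofFn]
  rfl

theorem PolyTime.wordsGet {W : (x : X) → List (Word (k x))}
    (hW : PolyTime e fun x => encodeWords (W x)) :
    PolyTime (withIndex e fun x => (W x).length) fun p => .ofWord ((W p.1).get p.2) :=
  PolyTime.nthFn_index (g := fun x i => .ofWord ((W x).get i)) hW.wordsFn

theorem PolyTime.wordAppend {v w : (x : X) → Word (k x)} (hv : PolyTime e fun x => .ofWord (v x))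
    (hw : PolyTime e fun x => .ofWord (w x)) : PolyTime e fun x => .ofWord (v x ++ w x) :=
  (PolyTime.append (l₁ := fun x => (v x).map fun σ => .int (σ.val : ℤ))
    (l₂ := fun x => (w x).map fun σ => .int (σ.val : ℤ)) hv hw).congr fun x => by
      simp [Data.ofWord]

theorem PolyTime.wordSnoc {v : (x : X) → Word (k x)} (hv : PolyTime e fun x => .ofWord (v x))
    {σ : (x : X) → Fin (k x)} (hσ : PolyTimeInt e fun x => ((σ x : ℕ) : ℤ)) :
    PolyTime e fun x => .ofWord (v x ++ [σ x]) :=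
  hv.wordAppend (w := fun x => [σ x]) (hσ.pair (PolyTime.const (.int 0)))

theorem PolyTime.wordCons {v : (x : X) → Word (k x)} (hv : PolyTime e fun x => .ofWord (v x))
    {σ : (x : X) → Fin (k x)} (hσ : PolyTimeInt e fun x => ((σ x : ℕ) : ℤ)) :
    PolyTime e fun x => .ofWord (σ x :: v x) := hσ.pair hv

/-- The entries of a rational vector. -/
theorem PolyTime.vectorEntry {v : (x : X) → Fin (n x) → ℚ}
    (hv : PolyTime e fun x => .ofVector (v x)) :
    PolyTime (withIndex e n) fun p => .ofRat (v p.1 p.2) :=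
  PolyTime.nthFn_index (g := fun x i => .ofRat (v x i)) hv

theorem PolyTime.scaleRat {D : X → ℤ} (hD : PolyTimeInt e D) {q : X → ℚ}
    (hq : PolyTime e fun x => .ofRat (q x)) : PolyTimeInt e fun x => scaleRat (D x) (q x) :=
  PolyTimeInt.mul hq.fst (hD.div hq.snd)

variable {A : (x : X) → WeightedAutomaton (k x) (n x)}

namespace PolyTime

theorem automatonInit (hA : PolyTime e fun x => .ofAutomaton (A x)) :
    PolyTime e fun x => .ofVector (A x).init := hA.snd.snd.fst

theorem automatonFin (hA : PolyTime e fun x => .ofAutomaton (A x)) :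
    PolyTime e fun x => .ofVector (A x).fin := hA.snd.snd.snd.snd.fst

theorem automatonTransList (hA : PolyTime e fun x => .ofAutomaton (A x)) :
    PolyTime e fun x => .ofList (List.ofFn fun σ => .ofMatrix ((A x).trans σ)) := hA.snd.snd.snd.fst

/-- The number of letters itself, and not only its digits, is bounded by the length of the encoding:
one matrix is listed per letter, even in dimension zero. -/
theorem automatonLetters (hA : PolyTime e fun x => .ofAutomaton (A x)) : PolyTimeNat e k :=
  ⟨hA.fst, hA.automatonTransList.size.mono fun x => by
    have h := Data.length_le_size_ofList (List.ofFn fun σ => Data.ofMatrix ((A x).trans σ))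
    rwa [List.length_ofFn] at h⟩

theorem automatonDim (hA : PolyTime e fun x => .ofAutomaton (A x)) : PolyTimeNat e n :=
  ⟨hA.snd.fst, hA.automatonInit.size.mono fun x => by
    have h := Data.length_le_size_ofList (List.ofFn fun i => Data.ofRat ((A x).init i))
    rwa [List.length_ofFn] at h⟩

theorem automatonTrans (hA : PolyTime e fun x => .ofAutomaton (A x)) :
    PolyTime (withIndex e k) fun p => .ofMatrix ((A p.1).trans p.2) :=
  PolyTime.nthFn_index (g := fun x σ => .ofMatrix ((A x).trans σ)) hA.automatonTransList

theorem automatonTransEntry (hA : PolyTime e fun x => .ofAutomaton (A x)) :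
    PolyTime (withIndex (withIndex (withIndex e k) fun p => n p.1) fun p => n p.1.1) fun p =>
      .ofRat ((A p.1.1.1).trans p.1.1.2 p.1.2 p.2) :=
  PolyTime.vectorEntry (v := fun (p : Σ p : Σ x, Fin (k x), Fin (n p.1)) i => (A p.1.1).trans p.1.2 p.2 i)
    (PolyTime.nthFn_index (g := fun (p : Σ x, Fin (k x)) i => .ofVector ((A p.1).trans p.2 i)) hA.automatonTrans)

theorem automatonDenom (hA : PolyTime e fun x => .ofAutomaton (A x)) :
    PolyTimeInt e fun x => (A x).denom := by
  have hk := hA.automatonLetters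
  have hn := hA.automatonDim
  refine ((PolyTimeInt.prod hn (z := fun x i => ((A x).init i).den) ?_).mul
    (PolyTimeInt.prod hk (z := fun x σ => ∏ i, ∏ j, (((A x).trans σ i j).den : ℤ)) ?_)).mul
      (PolyTimeInt.prod hn (z := fun x i => ((A x).fin i).den) ?_)
  · exact hA.automatonInit.vectorEntry.snd
  · refine PolyTimeInt.prod hn.indexed
      (z := fun (p : Σ x, Fin (k x)) i => ∏ j, (((A p.1).trans p.2 i j).den : ℤ)) ?_
    refine PolyTimeInt.prod hn.indexed.indexed
      (z := fun (p : Σ p : Σ x, Fin (k x), Fin (n p.1)) j => (((A p.1.1).trans p.1.2 p.2 j).den : ℤ)) ?_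
    exact hA.automatonTransEntry.snd
  · exact hA.automatonFin.vectorEntry.snd

theorem automatonIntInit (hA : PolyTime e fun x => .ofAutomaton (A x)) :
    PolyTimeVec e fun x => (A x).intInit :=
  PolyTimeVec.of_entries hA.automatonDim (v := fun x => (A x).intInit)
    (PolyTime.scaleRat hA.automatonDenom.indexed hA.automatonInit.vectorEntry)

theorem automatonIntFin (hA : PolyTime e fun x => .ofAutomaton (A x)) :
    PolyTimeVec e fun x => (A x).intFin :=
  PolyTimeVec.of_entries hA.automatonDim (v := fun x => (A x).intFin)
    (PolyTime.scaleRat hA.automatonDenom.indexed hA.automatonFin.vectorEntry)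

theorem automatonIntTrans (hA : PolyTime e fun x => .ofAutomaton (A x)) :
    PolyTimeMat (withIndex e k) fun p => (A p.1).intTrans p.2 :=
  PolyTimeMat.of_entries hA.automatonDim.indexed hA.automatonDim.indexed
    (M := fun p : Σ x, Fin (k x) => (A p.1).intTrans p.2)
    (PolyTime.scaleRat hA.automatonDenom.indexed.indexed.indexed hA.automatonTransEntry)

theorem automatonIntWord (hA : PolyTime e fun x => .ofAutomaton (A x))
    {w : (x : X) → Word (k x)} (hw : PolyTime e fun x => .ofWord (w x)) :
    PolyTimeMat e fun x => (A x).intWord (w x) := by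
  have hn := hA.automatonDim
  have hl := hw.wordLength
  obtain ⟨B, hB, hAB⟩ := (PolyTime.size hA.automatonIntTrans).exists_bound hA.automatonLetters.2
  have h := PolyTime.iter hl (s := fun x i => encodeMat ((A x).intWord ((w x).take i))) (e := e)
    ((PolyTimeMat.scalar hn (.const 1)).congr fun x => by simp [WeightedAutomaton.intWord]) ?_ ?_
  · exact PolyTime.congr h fun x => by rw [List.take_length]
  · refine PolyBounded.sigma (B := fun x => 1 + n x * (2 + n x * ((w x).length * (B x + n x) + 3)))
      ((PolyBounded.const 1).add (hn.2.mul ((PolyBounded.const 2).add (hn.2.mul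
      ((hl.2.mul (hB.add hn.2)).add (.const 3)))))) ?_
    rintro x ⟨i, hi⟩
    refine size_encodeMat_le fun a b => ((A x).natAbs_intWord_le (B := B x) (fun σ i j =>
      (natAbs_lt_size_encodeMat _ i j).le.trans (Nat.pow_le_pow_right (by norm_num) (hAB x σ)))
      _ a b).trans (Nat.pow_le_pow_right (by norm_num) (Nat.mul_le_mul_right _ ?_))
    simp
  · have hid := PolyTime.id (fun q : Σ x, Fin (w x).length =>
      .pair (withIndex e (fun x => (w x).length) q)
        (encodeMat ((A q.1).intWord ((w q.1).take q.2))))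
    have hn' : PolyTimeNat _ fun q : Σ x, Fin (w x).length => n q.1 := hid.fst.trans_nat hn.indexed
    have hM : PolyTimeMat _ fun q : Σ x, Fin (w x).length =>
      (A q.1).intWord ((w q.1).take q.2) := hid.snd
    have hlet : PolyTimeInt _ fun q : Σ x, Fin (w x).length => (((w q.1).get q.2 : ℕ) : ℤ) :=
      hid.fst.trans hw.letter
    have hσ : PolyTime _ fun q : Σ x, Fin (w x).length => withIndex e k ⟨q.1, (w q.1).get q.2⟩ :=
      hid.fst.fst.pair hlet
    have hT : PolyTimeMat _ fun q : Σ x, Fin (w x).length =>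
      (A q.1).intTrans ((w q.1).get q.2) :=
      hσ.trans (PolyTime.reindex hA.automatonIntTrans fun q : Σ x, Fin (w x).length =>
        ⟨q.1, (w q.1).get q.2⟩)
    refine (hM.mul hn' hn' hn' hT).congr ?_
    rintro ⟨x, i, hi⟩
    simp only [WeightedAutomaton.intWord]
    rw [List.take_succ_eq_append_getElem hi, List.map_append, List.prod_append]
    simp

theorem automatonIntBackward (hA : PolyTime e fun x => .ofAutomaton (A x))
    {w : (x : X) → Word (k x)} (hw : PolyTime e fun x => .ofWord (w x)) :
    PolyTimeVec e fun x => (A x).intBackward (w x) :=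
  (hA.automatonIntWord hw).mulVec hA.automatonDim hA.automatonDim hA.automatonIntFin

theorem automatonNumer (hA : PolyTime e fun x => .ofAutomaton (A x))
    {w : (x : X) → Word (k x)} (hw : PolyTime e fun x => .ofWord (w x)) :
    PolyTimeInt e fun x => (A x).numer (w x) :=
  hA.automatonIntInit.dot hA.automatonDim (hA.automatonIntBackward hw)

end PolyTime

end

/-! ### Saturating a list of words -/

section

variable {k : ℕ}

/-- The words that a search tries to add to the list `W`. -/
def candidate (ext : Word k → Fin k → Word k) (W : List (Word k)) (i : Fin (W.length * k)) :
    Word k := ext (W.get i.divNat) i.modNat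

/-- Adds the first candidate that passes the test `T`, if there is one. -/
noncomputable def grow (T : List (Word k) → Word k → Prop) (ext : Word k → Fin k → Word k)
    (W : List (Word k)) : List (Word k) :=
  if h : firstIndex (fun i => T W (candidate ext W i)) < W.length * k then
    W ++ [candidate ext W ⟨_, h⟩] else W

theorem grow_cases (T : List (Word k) → Word k → Prop) (ext : Word k → Fin k → Word k)
    (W : List (Word k)) :
    (∃ w ∈ W, ∃ σ, T W (ext w σ) ∧ grow T ext W = W ++ [ext w σ]) ∨
      ((∀ w ∈ W, ∀ σ, ¬ T W (ext w σ)) ∧ grow T ext W = W) := by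
  by_cases h : firstIndex (fun i => T W (candidate ext W i)) < W.length * k
  · refine Or.inl ⟨_, List.get_mem W _, _, firstIndex_spec _ h, ?_⟩
    simp only [grow, dif_pos h]; rfl
  · refine Or.inr ⟨fun w hw σ hT => h ((firstIndex_lt_iff _).2 ?_), by simp only [grow, dif_neg h]⟩
    obtain ⟨i, rfl⟩ := List.get_of_mem hw
    -- Candidates are numbered by pairs of a position and a letter through `finProdFinEquiv`, whose
    -- inverse is division with remainder.
    refine ⟨finProdFinEquiv (i, σ), ?_⟩
    have h1 : (finProdFinEquiv (i, σ)).divNat = i :=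
      congrArg Prod.fst (finProdFinEquiv.symm_apply_apply (i, σ))
    have h2 : (finProdFinEquiv (i, σ)).modNat = σ :=
      congrArg Prod.snd (finProdFinEquiv.symm_apply_apply (i, σ))
    rw [candidate, h1, h2]; exact hT

/-- A new word is at most `c` longer than a word already present, so lengths grow linearly in the
number of rounds. -/
theorem size_grow_le {T : List (Word k) → Word k → Prop} {ext : Word k → Fin k → Word k} {c : ℕ}
    (hext : ∀ w σ, (Data.ofWord (ext w σ)).size ≤ (Data.ofWord w).size + c) (W : List (Word k))
    (i : ℕ) : ((grow T ext)^[i] W).length ≤ W.length + i ∧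
      ∀ w ∈ (grow T ext)^[i] W, (Data.ofWord w).size ≤ (encodeWords W).size + i * c := by
  induction i with
  | zero =>
    refine ⟨le_rfl, fun w hw => ?_⟩
    rw [zero_mul, add_zero]
    exact Data.size_le_of_mem (List.mem_map_of_mem hw)
  | succ i ih =>
    rw [Function.iterate_succ_apply']
    rcases grow_cases T ext ((grow T ext)^[i] W) with ⟨w, hw, σ, -, h⟩ | ⟨-, h⟩
    · rw [h]
      refine ⟨by simp; omega, fun u hu => ?_⟩
      rw [add_mul, one_mul]
      rcases List.mem_append.1 hu with hu | hu
      · have := ih.2 u hu; omega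
      · rw [List.mem_singleton.1 hu]
        have := ih.2 w hw; have := hext w σ; omega
    · rw [h]
      refine ⟨by omega, fun u hu => ?_⟩
      have := ih.2 u hu
      rw [add_mul]; omega

end

/-! ### Saturation in polynomial time -/

section

variable {X : Type} {e : X → Data} {k : X → ℕ}

/-- The context of a search: the list of words found so far is available. -/
def withWords (e : X → Data) (k : X → ℕ) (q : Σ x, List (Word (k x))) : Data :=
  .pair (e q.1) (encodeWords q.2)

/-- The context of a test: the list of words found so far and a word are available. -/
def withTest (e : X → Data) (k : X → ℕ) (q : Σ x, List (Word (k x)) × Word (k x)) : Data :=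
  .pair (.pair (e q.1) (encodeWords q.2.1)) (.ofWord q.2.2)

variable {T : (x : X) → List (Word (k x)) → Word (k x) → Prop}
  {ext : (x : X) → Word (k x) → Fin (k x) → Word (k x)}

theorem PolyTime.candidate (hk : PolyTimeNat e k)
    (hext : PolyTime (fun q : Σ x, Word (k x) × Fin (k x) =>
      .pair (.ofWord q.2.1) (.int ((q.2.2 : ℕ) : ℤ))) fun q => .ofWord (ext q.1 q.2.1 q.2.2)) :
    PolyTime (withIndex (withWords e k) fun q => q.2.length * k q.1) fun p =>
      .ofWord (candidate (ext p.1.1) p.1.2 p.2) := by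
  have hid := PolyTime.id (withWords e k)
  have hk' : PolyTimeNat (withWords e k) fun q => k q.1 :=
    hid.fst.trans_nat (hk.reindex Sigma.fst)
  have hW : PolyTime (withWords e k) fun q => encodeWords q.2 := hid.snd
  have hi := PolyTimeNat.index (hW.wordsLength.mul hk').2
  have hw : PolyTime (withIndex (withWords e k) fun q => q.2.length * k q.1) fun p =>
      .ofWord (p.1.2.get p.2.divNat) :=
    PolyTime.nthFn (g := fun (p : Σ q : Σ x, List (Word (k x)), Fin (q.2.length * k q.1))
      (i : Fin p.1.2.length) => .ofWord (p.1.2.get i)) (i := fun p => p.2.divNat)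
      hW.wordsFn.indexed ((hi.div hk'.indexed).1.congr fun p => by simp)
  have hσ : PolyTimeInt (withIndex (withWords e k) fun q => q.2.length * k q.1) fun p =>
      ((p.2.modNat : ℕ) : ℤ) := (hi.mod hk'.indexed).int.congr fun p => by simp
  exact (hw.pair hσ).trans (hext.reindex fun p :
    Σ q : Σ x, List (Word (k x)), Fin (q.2.length * k q.1) =>
      (⟨p.1.1, (p.1.2.get p.2.divNat, p.2.modNat)⟩ : Σ x, Word (k x) × Fin (k x)))

theorem PolyTimeDec.candidateTest (hk : PolyTimeNat e k)
    (hext : PolyTime (fun q : Σ x, Word (k x) × Fin (k x) =>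
      .pair (.ofWord q.2.1) (.int ((q.2.2 : ℕ) : ℤ))) fun q => .ofWord (ext q.1 q.2.1 q.2.2))
    (hT : PolyTimeDec (withTest e k) fun q => T q.1 q.2.1 q.2.2) :
    PolyTimeDec (withIndex (withWords e k) fun q => q.2.length * k q.1) fun p =>
      T p.1.1 p.1.2 (candidate (ext p.1.1) p.1.2 p.2) :=
  PolyTime.trans_dec ((PolyTime.id _).indexed.pair (PolyTime.candidate hk hext))
    (PolyTimeDec.reindex hT fun p : Σ q : Σ x, List (Word (k x)), Fin (q.2.length * k q.1) =>
      (⟨p.1.1, (p.1.2, candidate (ext p.1.1) p.1.2 p.2)⟩ :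
        Σ x, List (Word (k x)) × Word (k x)))

theorem PolyTime.candidateCount (hk : PolyTimeNat e k) :
    PolyTimeNat (withWords e k) fun q => q.2.length * k q.1 :=
  PolyTimeNat.mul (PolyTime.wordsLength (W := fun q : Σ x, List (Word (k x)) => q.2)
    (PolyTime.id (withWords e k)).snd) ((PolyTime.id (withWords e k)).fst.trans_nat
      (hk.reindex Sigma.fst))

theorem PolyTime.grow (hk : PolyTimeNat e k)
    (hext : PolyTime (fun q : Σ x, Word (k x) × Fin (k x) =>
      .pair (.ofWord q.2.1) (.int ((q.2.2 : ℕ) : ℤ))) fun q => .ofWord (ext q.1 q.2.1 q.2.2))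
    (hT : PolyTimeDec (withTest e k) fun q => T q.1 q.2.1 q.2.2) :
    PolyTime (withWords e k) fun q => encodeWords (grow (T q.1) (ext q.1) q.2) := by
  classical
  have hn := PolyTime.candidateCount hk
  have hf := PolyTimeDec.firstIndex hn
    (p := fun q i => T q.1 q.2 (_root_.candidate (ext q.1) q.2 i))
    (PolyTimeDec.candidateTest hk hext hT)
  have hW : PolyTime (withWords e k) fun q => encodeWords q.2 := (PolyTime.id _).snd
  let Y := {q : Σ x, List (Word (k x)) //
    firstIndex (fun i => T q.1 q.2 (_root_.candidate (ext q.1) q.2 i)) < q.2.length * k q.1}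
  have hc : PolyTime (fun q : Y => withWords e k q) fun q =>
      .ofWord (_root_.candidate (ext q.1.1) q.1.2 ⟨_, q.2⟩) :=
    ((PolyTime.id (fun q : Y => withWords e k q)).pair (hf.1.reindex Subtype.val)).trans
      ((PolyTime.candidate hk hext).reindex fun q : Y => ⟨q.1, ⟨_, q.2⟩⟩)
  have happ : PolyTime (fun q : Y => withWords e k q) fun q =>
      encodeWords (q.1.2 ++ [_root_.candidate (ext q.1.1) q.1.2 ⟨_, q.2⟩]) :=
    (PolyTime.append (l₁ := fun q : Y => q.1.2.map Data.ofWord)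
      (l₂ := fun q : Y => [.ofWord (_root_.candidate (ext q.1.1) q.1.2 ⟨_, q.2⟩)])
      (hW.reindex Subtype.val) (hc.pair (PolyTime.const (.int 0)))).congr fun q => by
        simp [encodeWords]
  refine ((hf.lt hn).ite (f := fun q => encodeWords (_root_.grow (T q.1) (ext q.1) q.2))
    (g := fun q => encodeWords q.2) (happ.congr fun q => ?_) (hW.reindex Subtype.val)).congr
      fun q => ?_
  · simp only [_root_.grow]; rw [dif_pos q.2]
  · split_ifs with h
    · rfl
    · simp only [_root_.grow]; rw [dif_neg h]

/-- Saturation of a list of words in polynomial time, when polynomially many rounds suffice. -/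
theorem PolyTime.iterate_grow (hk : PolyTimeNat e k)
    (hext : PolyTime (fun q : Σ x, Word (k x) × Fin (k x) =>
      .pair (.ofWord q.2.1) (.int ((q.2.2 : ℕ) : ℤ))) fun q => .ofWord (ext q.1 q.2.1 q.2.2))
    (hsize : ∀ x w σ, (Data.ofWord (ext x w σ)).size ≤ (Data.ofWord w).size + (k x + 2))
    (hT : PolyTimeDec (withTest e k) fun q => T q.1 q.2.1 q.2.2)
    {W : (x : X) → List (Word (k x))} (hW : PolyTime e fun x => encodeWords (W x))
    {K : X → ℕ} (hK : PolyBounded e K)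
    (hfixed : ∀ x, ∀ w ∈ (_root_.grow (T x) (ext x))^[K x] (W x), ∀ σ,
      ¬ T x ((_root_.grow (T x) (ext x))^[K x] (W x)) (ext x w σ)) :
    PolyTime e fun x => encodeWords ((_root_.grow (T x) (ext x))^[K x] (W x)) := by
  have hstep := PolyTime.grow hk hext hT
  have hcand := PolyTimeDec.exists (PolyTime.candidateCount hk)
    (p := fun q i => T q.1 q.2 (_root_.candidate (ext q.1) q.2 i))
    (PolyTimeDec.candidateTest hk hext hT)
  have hmem : ∀ x (V : List (Word (k x))), (∃ i, T x V (_root_.candidate (ext x) V i)) →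
      ∃ w ∈ V, ∃ σ, T x V (ext x w σ) := fun x V ⟨i, hi⟩ =>
    ⟨_, List.get_mem V _, _, hi⟩
  -- The loop stops as soon as no candidate passes; from then on `grow` does nothing, so the result
  -- is that of `K x` rounds.
  refine PolyTime.while_fixpoint hK
    (s := fun x i => encodeWords ((_root_.grow (T x) (ext x))^[i] (W x)))
    (p := fun x i => ∃ j, T x ((_root_.grow (T x) (ext x))^[i] (W x))
      (_root_.candidate (ext x) ((_root_.grow (T x) (ext x))^[i] (W x)) j)) hW ?_ ?_ ?_ ?_ ?_
  · have hl := hW.wordsLength.2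
    refine PolyBounded.sigma (B := fun x => 1 + ((W x).length + K x) *
      (1 + ((encodeWords (W x)).size + K x * (k x + 2))))
      ((PolyBounded.const 1).add ((hl.add hK).mul ((PolyBounded.const 1).add
        (hW.size.add (hK.mul (hk.2.add (.const 2))))))) ?_
    rintro x ⟨i, hi⟩
    have h := size_grow_le (T := T x) (hsize x) (W x) i
    refine (Data.size_ofList_le (B := (encodeWords (W x)).size + K x * (k x + 2)) ?_).trans ?_
    · intro d hd
      obtain ⟨w, hw, rfl⟩ := List.mem_map.1 hd
      exact (h.2 w hw).trans (Nat.add_le_add_left (Nat.mul_le_mul_right _ (by omega)) _)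
    · rw [List.length_map]
      exact Nat.add_le_add_left (Nat.mul_le_mul_right _ (by have := h.1; simp only; omega)) _
  · exact hcand.reindex fun q : Σ x, Fin (K x + 1) =>
      (⟨q.1, (_root_.grow (T q.1) (ext q.1))^[q.2] (W q.1)⟩ : Σ x, List (Word (k x)))
  · intro x i hi
    have : (_root_.grow (T x) (ext x))^[i + 1] (W x) = (_root_.grow (T x) (ext x))^[i] (W x) := by
      rw [Function.iterate_succ_apply']
      rcases grow_cases (T x) (ext x) ((_root_.grow (T x) (ext x))^[i] (W x)) with
        ⟨w, hw, σ, hT, h⟩ | ⟨-, h⟩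
      · refine absurd ?_ hi
        obtain ⟨j, rfl⟩ := List.get_of_mem hw
        refine ⟨finProdFinEquiv (j, σ), ?_⟩
        have h1 : (finProdFinEquiv (j, σ)).divNat = j :=
          congrArg Prod.fst (finProdFinEquiv.symm_apply_apply (j, σ))
        have h2 : (finProdFinEquiv (j, σ)).modNat = σ :=
          congrArg Prod.snd (finProdFinEquiv.symm_apply_apply (j, σ))
        rw [_root_.candidate, h1, h2]; exact hT
      · exact h
    rw [this]; exact ⟨rfl, hi⟩
  · intro x h
    obtain ⟨w, hw, σ, hT⟩ := hmem x _ h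
    exact hfixed x w hw σ hT
  · refine (hstep.reindex fun q : Σ x, Fin (K x) =>
      (⟨q.1, (_root_.grow (T q.1) (ext q.1))^[q.2] (W q.1)⟩ : Σ x, List (Word (k x)))).congr
        fun q => ?_
    rw [Function.iterate_succ_apply']

end

/-! ### The tests of the procedure on integer data -/

namespace WeightedAutomaton

variable {k n : ℕ} (A : WeightedAutomaton k n)

/-- The rows are multiples of the backward vectors of the words in `W`. -/
def backRows (W : List (Word k)) : Matrix (Fin W.length) (Fin n) ℤ :=
  fun i => A.intBackward (W.get i)

/-- A vector proportional (coordinatewise) to the forward vector of `w` in the conjugate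
automaton. -/
def numerVec (WB : List (Word k)) (w : Word k) : Fin WB.length → ℤ :=
  fun j => A.numer (w ++ WB.get j)

/-- The rows are the vectors `numerVec` of the words in `W`. -/
def numerRows (WB W : List (Word k)) : Matrix (Fin W.length) (Fin WB.length) ℤ :=
  fun i => A.numerVec WB (W.get i)

/-- The denominator of the weight of `w`. -/
def scaleAt (w : Word k) : ℤ := A.denom ^ (w.length + 2)

/-- The weight of `w`, if it is an integer. -/
def intWeight (w : Word k) : ℤ := A.numer w / A.scaleAt w

/-- The weights of the words `w ++ u` for `u` in `WB` are integers. -/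
def GoodWord (WB : List (Word k)) (w : Word k) : Prop :=
  ∀ j, A.scaleAt (w ++ WB.get j) ∣ A.numer (w ++ WB.get j)

/-- The forward vector of `w` in the conjugate automaton, if it is integral. -/
def weightVec (WB : List (Word k)) (w : Word k) : Fin WB.length → ℤ :=
  fun j => A.intWeight (w ++ WB.get j)

/-- The rows are the vectors `weightVec` of the words in `U`. -/
def weightRows (WB U : List (Word k)) : Matrix (Fin U.length) (Fin WB.length) ℤ :=
  fun i => A.weightVec WB (U.get i)

/-- The coordinates of the vectors `weightVec` of the words in `W`. -/
def latticeRows (WB U W : List (Word k)) : Matrix (Fin W.length) (Fin U.length) ℤ :=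
  fun i => (A.weightRows WB U).coords (A.weightVec WB (W.get i))

/-- The determinant that belongs to the words in `U`. -/
def latticeDet (WB U : List (Word k)) : ℤ := (A.weightRows WB U).gramDet

/-- A basis of the lattice of the coordinate vectors of the words in `W`. -/
def latticeBasis (WB U W : List (Word k)) : Matrix (Fin U.length) (Fin U.length) ℤ :=
  Hermite.basis (A.latticeDet WB U * A.latticeDet WB U) (A.latticeRows WB U W)

/-- The coordinate vector of `w` belongs to the lattice. -/
def LatticeTest (WB U W : List (Word k)) (w : Word k) : Prop :=
  ∀ j, (A.latticeBasis WB U W).pseudoDet ∣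
    ((A.weightRows WB U).coords (A.weightVec WB w) ᵥ* (A.latticeBasis WB U W).pseudoInv) j

/-- The test of the backward search. -/
def BackTest (W : List (Word k)) (w : Word k) : Prop :=
  ¬ (A.backRows W).SpanTest (A.intBackward w)

/-- The test of the search for words that increase the rank. -/
def RankTest (WB W : List (Word k)) (w : Word k) : Prop :=
  (∀ i, A.GoodWord WB (W.get i)) ∧ ¬ (A.numerRows WB W).SpanTest (A.numerVec WB w)

/-- The test of the search for words that augment the module. -/
def ModuleTest (WB U W : List (Word k)) (w : Word k) : Prop :=
  (∀ i, A.GoodWord WB (W.get i)) ∧ A.latticeDet WB U ≠ 0 ∧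
    ¬ (A.GoodWord WB w ∧ A.LatticeTest WB U W w)

end WeightedAutomaton

/-! ### Polynomial running time of the tests -/

section

variable {X : Type} {e : X → Data} {k n : X → ℕ} {A : (x : X) → WeightedAutomaton (k x) (n x)}
  {WB U W : (x : X) → List (Word (k x))} {w : (x : X) → Word (k x)}

theorem PolyTime.backRows (hA : PolyTime e fun x => .ofAutomaton (A x))
    (hW : PolyTime e fun x => encodeWords (W x)) : PolyTimeMat e fun x => (A x).backRows (W x) :=
  PolyTimeMat.of_rows hW.wordsLength (M := fun x => (A x).backRows (W x))
    (hA.indexed.automatonIntBackward hW.wordsGet)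

theorem PolyTime.backTest (hA : PolyTime e fun x => .ofAutomaton (A x))
    (hW : PolyTime e fun x => encodeWords (W x)) (hw : PolyTime e fun x => .ofWord (w x)) :
    PolyTimeDec e fun x => (A x).BackTest (W x) (w x) :=
  ((hA.backRows hW).spanTest hW.wordsLength hA.automatonDim (hA.automatonIntBackward hw)).not

theorem PolyTime.wordAppendGet (hWB : PolyTime e fun x => encodeWords (WB x))
    (hw : PolyTime e fun x => .ofWord (w x)) :
    PolyTime (withIndex e fun x => (WB x).length) fun p => .ofWord (w p.1 ++ (WB p.1).get p.2) :=
  hw.indexed.wordAppend hWB.wordsGet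

theorem PolyTime.numerVec (hA : PolyTime e fun x => .ofAutomaton (A x))
    (hWB : PolyTime e fun x => encodeWords (WB x)) (hw : PolyTime e fun x => .ofWord (w x)) :
    PolyTimeVec e fun x => (A x).numerVec (WB x) (w x) :=
  PolyTimeVec.of_entries hWB.wordsLength (v := fun x => (A x).numerVec (WB x) (w x))
    (hA.indexed.automatonNumer (hWB.wordAppendGet hw))

theorem PolyTime.numerRows (hA : PolyTime e fun x => .ofAutomaton (A x))
    (hWB : PolyTime e fun x => encodeWords (WB x)) (hW : PolyTime e fun x => encodeWords (W x)) :
    PolyTimeMat e fun x => (A x).numerRows (WB x) (W x) :=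
  PolyTimeMat.of_rows hW.wordsLength (M := fun x => (A x).numerRows (WB x) (W x))
    (hA.indexed.numerVec hWB.indexed hW.wordsGet)

theorem PolyTime.scaleAt (hA : PolyTime e fun x => .ofAutomaton (A x))
    (hw : PolyTime e fun x => .ofWord (w x)) : PolyTimeInt e fun x => (A x).scaleAt (w x) :=
  hA.automatonDenom.pow (hw.wordLength.add (.const 2))

theorem PolyTime.intWeight (hA : PolyTime e fun x => .ofAutomaton (A x))
    (hw : PolyTime e fun x => .ofWord (w x)) : PolyTimeInt e fun x => (A x).intWeight (w x) :=
  (hA.automatonNumer hw).div (hA.scaleAt hw)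

theorem PolyTime.integralAt (hA : PolyTime e fun x => .ofAutomaton (A x))
    (hWB : PolyTime e fun x => encodeWords (WB x)) (hw : PolyTime e fun x => .ofWord (w x)) :
    PolyTimeDec (withIndex e fun x => (WB x).length) fun p =>
      (A p.1).scaleAt (w p.1 ++ (WB p.1).get p.2) ∣ (A p.1).numer (w p.1 ++ (WB p.1).get p.2) :=
  (hA.indexed.scaleAt (hWB.wordAppendGet hw)).dvd
    (hA.indexed.automatonNumer (hWB.wordAppendGet hw))

theorem PolyTime.goodWord (hA : PolyTime e fun x => .ofAutomaton (A x))
    (hWB : PolyTime e fun x => encodeWords (WB x)) (hw : PolyTime e fun x => .ofWord (w x)) :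
    PolyTimeDec e fun x => (A x).GoodWord (WB x) (w x) :=
  PolyTimeDec.forall hWB.wordsLength (p := fun x j =>
    (A x).scaleAt (w x ++ (WB x).get j) ∣ (A x).numer (w x ++ (WB x).get j))
    (hA.integralAt hWB hw)

theorem PolyTime.goodAt (hA : PolyTime e fun x => .ofAutomaton (A x))
    (hWB : PolyTime e fun x => encodeWords (WB x)) (hW : PolyTime e fun x => encodeWords (W x)) :
    PolyTimeDec (withIndex e fun x => (W x).length) fun p =>
      (A p.1).GoodWord (WB p.1) ((W p.1).get p.2) :=
  hA.indexed.goodWord hWB.indexed hW.wordsGet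

theorem PolyTime.goodWords (hA : PolyTime e fun x => .ofAutomaton (A x))
    (hWB : PolyTime e fun x => encodeWords (WB x)) (hW : PolyTime e fun x => encodeWords (W x)) :
    PolyTimeDec e fun x => ∀ i, (A x).GoodWord (WB x) ((W x).get i) :=
  PolyTimeDec.forall hW.wordsLength (p := fun x i => (A x).GoodWord (WB x) ((W x).get i))
    (hA.goodAt hWB hW)

theorem PolyTime.rankTest (hA : PolyTime e fun x => .ofAutomaton (A x))
    (hWB : PolyTime e fun x => encodeWords (WB x)) (hW : PolyTime e fun x => encodeWords (W x))
    (hw : PolyTime e fun x => .ofWord (w x)) :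
    PolyTimeDec e fun x => (A x).RankTest (WB x) (W x) (w x) :=
  (hA.goodWords hWB hW).and ((hA.numerRows hWB hW).spanTest hW.wordsLength hWB.wordsLength
    (hA.numerVec hWB hw)).not

theorem PolyTime.weightVec (hA : PolyTime e fun x => .ofAutomaton (A x))
    (hWB : PolyTime e fun x => encodeWords (WB x)) (hw : PolyTime e fun x => .ofWord (w x)) :
    PolyTimeVec e fun x => (A x).weightVec (WB x) (w x) :=
  PolyTimeVec.of_entries hWB.wordsLength (v := fun x => (A x).weightVec (WB x) (w x))
    (hA.indexed.intWeight (hWB.wordAppendGet hw))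

theorem PolyTime.weightRows (hA : PolyTime e fun x => .ofAutomaton (A x))
    (hWB : PolyTime e fun x => encodeWords (WB x)) (hU : PolyTime e fun x => encodeWords (U x)) :
    PolyTimeMat e fun x => (A x).weightRows (WB x) (U x) :=
  PolyTimeMat.of_rows hU.wordsLength (M := fun x => (A x).weightRows (WB x) (U x))
    (hA.indexed.weightVec hWB.indexed hU.wordsGet)

theorem PolyTime.latticeDet (hA : PolyTime e fun x => .ofAutomaton (A x))
    (hWB : PolyTime e fun x => encodeWords (WB x)) (hU : PolyTime e fun x => encodeWords (U x)) :
    PolyTimeInt e fun x => (A x).latticeDet (WB x) (U x) :=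
  (hA.weightRows hWB hU).gramDet hU.wordsLength hWB.wordsLength

theorem PolyTime.weightCoords (hA : PolyTime e fun x => .ofAutomaton (A x))
    (hWB : PolyTime e fun x => encodeWords (WB x)) (hU : PolyTime e fun x => encodeWords (U x))
    (hw : PolyTime e fun x => .ofWord (w x)) :
    PolyTimeVec e fun x => ((A x).weightRows (WB x) (U x)).coords ((A x).weightVec (WB x) (w x)) :=
  (hA.weightRows hWB hU).coords hU.wordsLength hWB.wordsLength (hA.weightVec hWB hw)

theorem PolyTime.latticeRows (hA : PolyTime e fun x => .ofAutomaton (A x))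
    (hWB : PolyTime e fun x => encodeWords (WB x)) (hU : PolyTime e fun x => encodeWords (U x))
    (hW : PolyTime e fun x => encodeWords (W x)) :
    PolyTimeMat e fun x => (A x).latticeRows (WB x) (U x) (W x) :=
  PolyTimeMat.of_rows hW.wordsLength (M := fun x => (A x).latticeRows (WB x) (U x) (W x))
    (hA.indexed.weightCoords hWB.indexed hU.indexed hW.wordsGet)

theorem PolyTime.latticeBasis (hA : PolyTime e fun x => .ofAutomaton (A x))
    (hWB : PolyTime e fun x => encodeWords (WB x)) (hU : PolyTime e fun x => encodeWords (U x))
    (hW : PolyTime e fun x => encodeWords (W x)) (h0 : ∀ x, (A x).latticeDet (WB x) (U x) ≠ 0) :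
    PolyTimeMat e fun x => (A x).latticeBasis (WB x) (U x) (W x) :=
  Hermite.polyTime_basis hU.wordsLength ((hA.latticeDet hWB hU).mul (hA.latticeDet hWB hU))
    (fun x => mul_self_pos.2 (h0 x)) hW.wordsLength (hA.latticeRows hWB hU hW)

theorem PolyTime.latticeTest (hA : PolyTime e fun x => .ofAutomaton (A x))
    (hWB : PolyTime e fun x => encodeWords (WB x)) (hU : PolyTime e fun x => encodeWords (U x))
    (hW : PolyTime e fun x => encodeWords (W x)) (hw : PolyTime e fun x => .ofWord (w x))
    (h0 : ∀ x, (A x).latticeDet (WB x) (U x) ≠ 0) :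
    PolyTimeDec e fun x => (A x).LatticeTest (WB x) (U x) (W x) (w x) := by
  have hl := hU.wordsLength
  have hH := hA.latticeBasis hWB hU hW h0
  exact PolyTimeDec.forall hl (p := fun x j => ((A x).latticeBasis (WB x) (U x) (W x)).pseudoDet ∣
    (((A x).weightRows (WB x) (U x)).coords ((A x).weightVec (WB x) (w x)) ᵥ*
      ((A x).latticeBasis (WB x) (U x) (W x)).pseudoInv) j)
    ((hH.pseudoDet hl).indexed.dvd (PolyTimeVec.entry
      (PolyTimeMat.vecMul hl hl (hA.weightCoords hWB hU hw) (hH.pseudoInv hl))))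

theorem PolyTime.moduleTest (hA : PolyTime e fun x => .ofAutomaton (A x))
    (hWB : PolyTime e fun x => encodeWords (WB x)) (hU : PolyTime e fun x => encodeWords (U x))
    (hW : PolyTime e fun x => encodeWords (W x)) (hw : PolyTime e fun x => .ofWord (w x)) :
    PolyTimeDec e fun x => (A x).ModuleTest (WB x) (U x) (W x) (w x) := by
  classical
  refine (hA.goodWords hWB hW).and ?_
  have h0 : PolyTimeDec e fun x => (A x).latticeDet (WB x) (U x) ≠ 0 :=
    ((hA.latticeDet hWB hU).eq (.const 0)).not
  -- The lattice basis is computed modulo the square of the determinant, so the test is run only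
  -- where the determinant is nonzero.
  let Y := {x : X // (A x).latticeDet (WB x) (U x) ≠ 0}
  have hT : PolyTimeDec (fun x : Y => e x) fun x => ¬ ((A x).GoodWord (WB x) (w x) ∧
      (A x).LatticeTest (WB x) (U x) (W x) (w x)) :=
    ((PolyTime.goodWord (A := fun x : Y => A x) (hA.reindex Subtype.val)
      (hWB.reindex Subtype.val) (hw.reindex Subtype.val)).and
      (PolyTime.latticeTest (A := fun x : Y => A x) (hA.reindex Subtype.val)
      (hWB.reindex Subtype.val) (hU.reindex Subtype.val) (hW.reindex Subtype.val)
      (hw.reindex Subtype.val) fun x => x.2)).not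
  refine PolyTime.congr (h0.ite (f := fun x => .int (if ¬ ((A x).GoodWord (WB x) (w x) ∧
    (A x).LatticeTest (WB x) (U x) (W x) (w x)) then 1 else 0))
    (g := fun _ => .int 0) ?_ (PolyTime.const _)) fun x => ?_
  · exact PolyTime.congr hT fun x => by congr
  · by_cases h : (A x).latticeDet (WB x) (U x) = 0 <;> simp [h]

end

/-! ### Conjugate automata -/

/-- The vectors `f w` for `w` in `W` are independent, unless all vectors are zero. -/
def IndepOrZero {k : ℕ} {V : Type*} [AddCommGroup V] [Module ℚ V] (f : Word k → V)
    (W : List (Word k)) : Prop :=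
  LinearIndependent ℚ (fun i => f (W.get i)) ∨ (W = [[]] ∧ ∀ w, f w = 0)

section

variable {k : ℕ} {V : Type*} [AddCommGroup V] [Module ℚ V] {f : Word k → V}

theorem setOf_mem_eq_range {S : Type*} (f : Word k → S) (W : List (Word k)) :
    {v | ∃ u ∈ W, v = f u} = Set.range fun i => f (W.get i) := by
  ext v
  constructor
  · rintro ⟨u, hu, rfl⟩
    obtain ⟨i, rfl⟩ := List.get_of_mem hu
    exact ⟨i, rfl⟩
  · rintro ⟨i, rfl⟩
    exact ⟨_, List.get_mem W i, rfl⟩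

theorem indepOrZero_nil (h : f [] = 0 → ∀ w, f w = 0) : IndepOrZero f [[]] := by
  by_cases h0 : f [] = 0
  · exact Or.inr ⟨rfl, h h0⟩
  · refine Or.inl ?_
    have : Unique (Fin ([[]] : List (Word k)).length) := inferInstanceAs (Unique (Fin 1))
    exact LinearIndependent.of_subsingleton (0 : Fin 1) h0

/-- In the exceptional case all vectors are zero, hence in the span, so nothing can be added. -/
theorem IndepOrZero.append {W : List (Word k)} (hW : IndepOrZero f W) {w : Word k}
    (hw : f w ∉ Submodule.span ℚ {v | ∃ u ∈ W, v = f u}) : IndepOrZero f (W ++ [w]) := by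
  rcases hW with hW | ⟨-, h0⟩
  · refine Or.inl ?_
    rw [setOf_mem_eq_range] at hw
    have h := linearIndependent_finSnoc.2 ⟨hW, hw⟩
    have hl : (W ++ [w]).length = W.length + 1 := by simp
    have h2 := h.comp (Fin.cast hl) (Fin.cast_injective hl)
    suffices h3 : (fun i => f ((W ++ [w]).get i)) =
        Fin.snoc (α := fun _ => V) (fun i => f (W.get i)) (f w) ∘ Fin.cast hl by
      rw [h3]; exact h2
    ext i
    refine Fin.lastCases (motive := fun j => ∀ i : Fin (W ++ [w]).length, Fin.cast hl i = j →
      f ((W ++ [w]).get i) = Fin.snoc (α := fun _ => V) (fun i => f (W.get i)) (f w) j)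
      ?_ ?_ (Fin.cast hl i) i rfl
    · intro i hi
      have hi' : (i : ℕ) = W.length := by simpa using congrArg Fin.val hi
      rw [Fin.snoc_last]
      congr 1
      simp [hi']
    · intro j i hi
      have hi' : (i : ℕ) = j := by simpa using congrArg Fin.val hi
      rw [Fin.snoc_castSucc]
      congr 1
      simp [hi', List.getElem_append_left]
  · exact absurd (by rw [h0]; exact zero_mem _) hw

/-- The extra `1` is for the exceptional list `[[]]`, which occurs even in dimension zero. -/
theorem IndepOrZero.length_le [FiniteDimensional ℚ V] {W : List (Word k)} (hW : IndepOrZero f W) :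
    W.length ≤ Module.finrank ℚ V + 1 := by
  rcases hW with hW | ⟨rfl, -⟩
  · have := hW.fintype_card_le_finrank
    rw [Fintype.card_fin] at this; omega
  · simp

end

namespace WeightedAutomaton

variable {k n m : ℕ} (A : WeightedAutomaton k n)

theorem backward_cons (σ : Fin k) (w : Word k) :
    A.backward (σ :: w) = A.trans σ *ᵥ A.backward w := by
  simp [backward, transWord]

theorem forward_snoc (w : Word k) (σ : Fin k) :
    A.forward (w ++ [σ]) = A.forward w ᵥ* A.trans σ := by
  simp [forward, transWord]

theorem forward_nil : A.forward [] = A.init := by simp [forward, transWord]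

theorem backward_nil : A.backward [] = A.fin := by simp [backward, transWord]

theorem weight_append (u v : Word k) : A.weight (u ++ v) = A.forward u ⬝ᵥ A.backward v := by
  rw [weight, forward, forward, backward, Matrix.dotProduct_mulVec, Matrix.vecMul_vecMul]
  simp [transWord]

theorem backward_eq_zero (h : A.backward [] = 0) (w : Word k) : A.backward w = 0 := by
  rw [backward_nil] at h
  rw [backward, h, Matrix.mulVec_zero]

theorem forward_eq_zero (h : A.forward [] = 0) (w : Word k) : A.forward w = 0 := by
  rw [forward_nil] at h
  rw [forward, h, Matrix.zero_vecMul]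

/-- The forward vector of `w` in any conjugate automaton. -/
def conjForward (WB : List (Word k)) (w : Word k) : Fin WB.length → ℚ :=
  fun j => A.weight (w ++ WB.get j)

variable {A}

section BackwardConjugate

variable {WB : List (Word k)} {A' : WeightedAutomaton k WB.length}

/-- Induction gives `α' μ'(w) = α μ(w) B`, and the `j`-th column of `B` is the backward vector of
the `j`-th word. So the forward vectors are read off from weights of `A`, independently of the
choice of `A'`, and the program need not construct `A'`. -/
theorem BackwardConjugate.forward (h : A.BackwardConjugate (A.backwardMatrix WB) A') (w : Word k) :
    A'.forward w = A.conjForward WB w := by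
  have h1 : A'.forward w = A.forward w ᵥ* A.backwardMatrix WB := by
    induction w using List.reverseRecOn with
    | nil => rw [forward_nil, forward_nil, h.1]
    | append_singleton w σ ih =>
      rw [forward_snoc, forward_snoc, ih, Matrix.vecMul_vecMul, h.2.2, Matrix.vecMul_vecMul]
  rw [h1]
  ext j
  rw [conjForward, weight_append]
  rfl

theorem BackwardConjugate.equivalent (h : A.BackwardConjugate (A.backwardMatrix WB) A') :
    A.Equivalent A' := by
  intro w
  have h1 : A'.forward w = A.forward w ᵥ* A.backwardMatrix WB := by
    rw [h.forward]
    ext j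
    rw [conjForward, weight_append]
    rfl
  rw [weight, weight, h1, ← Matrix.dotProduct_mulVec, h.2.1]

theorem backwardSpan_eq (WB : List (Word k)) :
    A.backwardSpan WB = LinearMap.range (Matrix.mulVecLin (A.backwardMatrix WB)) := by
  rw [backwardSpan, setOf_mem_eq_range, Matrix.range_mulVecLin]
  rfl

/-- Closedness says that the columns of `A.trans σ * B` lie in the column space of `B`; their
coefficients form the new transition matrices. The final vector is a combination of the columns
because the empty word is listed. -/
theorem exists_backwardConjugate (hnil : [] ∈ WB)
    (hclosed : ∀ w ∈ WB, ∀ σ : Fin k, A.backward (σ :: w) ∈ A.backwardSpan WB) :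
    ∃ A' : WeightedAutomaton k WB.length, A.BackwardConjugate (A.backwardMatrix WB) A' := by
  have h1 : ∀ σ (j : Fin WB.length), ∃ c, A.backwardMatrix WB *ᵥ c = A.backward (σ :: WB.get j) := by
    intro σ j
    have := hclosed _ (List.get_mem WB j) σ
    rwa [backwardSpan_eq] at this
  have h2 : ∃ c, A.backwardMatrix WB *ᵥ c = A.fin := by
    have : A.backward [] ∈ A.backwardSpan WB := Submodule.subset_span ⟨[], hnil, rfl⟩
    rwa [backwardSpan_eq, backward_nil] at this
  choose c hc using h1
  obtain ⟨b, hb⟩ := h2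
  refine ⟨⟨A.init ᵥ* A.backwardMatrix WB, fun σ => Matrix.of fun i j => c σ j i, b⟩, rfl, hb, ?_⟩
  intro σ
  ext i j
  have := congrFun (hc σ j) i
  rw [backward_cons] at this
  exact this

end BackwardConjugate

section Closed

variable (A)

theorem forward_mem_forwardSpan {W : List (Word k)} (hnil : [] ∈ W)
    (hclosed : ∀ w ∈ W, ∀ σ : Fin k, A.forward (w ++ [σ]) ∈ A.forwardSpan W) (w : Word k) :
    A.forward w ∈ A.forwardSpan W := by
  induction w using List.reverseRecOn with
  | nil => exact Submodule.subset_span ⟨[], hnil, rfl⟩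
  | append_singleton w σ ih =>
    rw [forward_snoc]
    have : A.forwardSpan W ≤ (A.forwardSpan W).comap (Matrix.vecMulLinear (A.trans σ)) := by
      refine Submodule.span_le.2 ?_
      rintro _ ⟨u, hu, rfl⟩
      have := hclosed u hu σ
      rw [forward_snoc] at this
      exact this
    exact this ih

theorem vecMul_mem_forwardModule {W : List (Word k)}
    (hclosed : ∀ w ∈ W, ∀ σ : Fin k, A.forward (w ++ [σ]) ∈ A.forwardModule W) {v : Fin n → ℚ}
    (hv : v ∈ A.forwardModule W) (σ : Fin k) : v ᵥ* A.trans σ ∈ A.forwardModule W := by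
  have : A.forwardModule W ≤ (A.forwardModule W).comap
      ((Matrix.vecMulLinear (A.trans σ)).restrictScalars ℤ) := by
    refine Submodule.span_le.2 ?_
    rintro _ ⟨u, hu, rfl⟩
    have := hclosed u hu σ
    rw [forward_snoc] at this
    exact this
  exact this hv

theorem forward_mem_forwardModule {W : List (Word k)} (hnil : [] ∈ W)
    (hclosed : ∀ w ∈ W, ∀ σ : Fin k, A.forward (w ++ [σ]) ∈ A.forwardModule W) (w : Word k) :
    A.forward w ∈ A.forwardModule W := by
  induction w using List.reverseRecOn with
  | nil => exact Submodule.subset_span ⟨[], hnil, rfl⟩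
  | append_singleton w σ ih =>
    rw [forward_snoc]
    exact A.vecMul_mem_forwardModule hclosed ih σ

variable {A} {W : List (Word k)} {l : ℕ} {F : Matrix (Fin l) (Fin n) ℚ}

theorem mem_span_row_iff {v : Fin n → ℚ} :
    v ∈ Submodule.span ℤ (Set.range F.row) ↔ ∃ c : Fin l → ℤ, (fun i => (c i : ℚ)) ᵥ* F = v := by
  rw [Submodule.mem_span_range_iff_exists_fun]
  refine exists_congr fun c => ?_
  rw [show ∑ i, c i • F.row i = (fun i => (c i : ℚ)) ᵥ* F by
    ext j; simp [Matrix.vecMul, dotProduct, Finset.sum_apply]]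

/-- If the rows of `F` generate a forward module, then there is a conjugate automaton with
integer initial vector and integer transition matrices. -/
theorem exists_forwardConjugate (hnil : [] ∈ W)
    (hclosed : ∀ w ∈ W, ∀ σ : Fin k, A.forward (w ++ [σ]) ∈ A.forwardModule W)
    (hspan : Submodule.span ℤ (Set.range F.row) = A.forwardModule W) :
    ∃ (a : Fin l → ℤ) (M : Fin k → Matrix (Fin l) (Fin l) ℤ),
      A.ForwardConjugate F ⟨fun i => a i, fun σ => (M σ).map (Int.cast : ℤ → ℚ), F *ᵥ A.fin⟩ := by
  have h1 : ∃ a : Fin l → ℤ, (fun i => (a i : ℚ)) ᵥ* F = A.init := by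
    rw [← mem_span_row_iff, hspan, ← forward_nil]
    exact Submodule.subset_span ⟨[], hnil, rfl⟩
  have h2 : ∀ σ i, ∃ c : Fin l → ℤ, (fun i => (c i : ℚ)) ᵥ* F = F.row i ᵥ* A.trans σ := by
    intro σ i
    rw [← mem_span_row_iff, hspan]
    refine A.vecMul_mem_forwardModule hclosed ?_ σ
    rw [← hspan]
    exact Submodule.subset_span ⟨i, rfl⟩
  obtain ⟨a, ha⟩ := h1
  choose c hc using h2
  refine ⟨a, fun σ => Matrix.of fun i j => c σ i j, ha, rfl, fun σ => ?_⟩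
  ext i j
  exact congrFun (hc σ i) j

theorem ForwardConjugate.forward {A'' : WeightedAutomaton k l} (h : A.ForwardConjugate F A'')
    (w : Word k) : A''.forward w ᵥ* F = A.forward w := by
  induction w using List.reverseRecOn with
  | nil => rw [forward_nil, forward_nil, h.1]
  | append_singleton w σ ih =>
    rw [forward_snoc, forward_snoc, ← ih, Matrix.vecMul_vecMul, h.2.2, Matrix.vecMul_vecMul]

theorem ForwardConjugate.equivalent {A'' : WeightedAutomaton k l} (h : A.ForwardConjugate F A'') :
    A.Equivalent A'' := by
  intro w
  rw [weight, weight, h.2.1, Matrix.dotProduct_mulVec, h.forward]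

end Closed

theorem isInteger_intCast (z : ℤ) : IsInteger z := ⟨z, rfl⟩

theorem isInteger_add {a b : ℚ} (ha : IsInteger a) (hb : IsInteger b) : IsInteger (a + b) := by
  obtain ⟨x, rfl⟩ := ha
  obtain ⟨y, rfl⟩ := hb
  exact ⟨x + y, by push_cast; rfl⟩

theorem linearIndependent_row_iff {l : ℕ} {F : Matrix (Fin l) (Fin n) ℚ} :
    LinearIndependent ℤ F.row ↔ LinearIndependent ℚ F.row :=
  LinearIndependent.iff_fractionRing ℤ ℚ

/-- The outputs of the procedure are correct. -/
theorem correct_of_forwardConjugate {WB W : List (Word k)} {A' : WeightedAutomaton k WB.length}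
    (hWB : [] ∈ WB) (hconj : A.BackwardConjugate (A.backwardMatrix WB) A') (hnil : [] ∈ W)
    (hgood : ∀ w ∈ W, A'.ForwardIntegral w)
    (hclosed : ∀ w ∈ W, ∀ σ : Fin k, A'.forward (w ++ [σ]) ∈ A'.forwardModule W) {l : ℕ}
    {F : Matrix (Fin l) (Fin WB.length) ℚ} {A'' : WeightedAutomaton k l}
    (hindep : LinearIndependent ℤ F.row)
    (hspan : Submodule.span ℤ (Set.range F.row) = A'.forwardModule W)
    (hF : A'.ForwardConjugate F A'') : (Outcome.automaton l A'').Correct A := by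
  have hindepQ := linearIndependent_row_iff.1 hindep
  -- Multiplication by `F` is injective, so the given initial vector and transition matrices must be
  -- the integral ones from `exists_forwardConjugate`.
  have hinj : Function.Injective fun v : Fin l → ℚ => v ᵥ* F :=
    Matrix.vecMul_injective_iff.2 hindepQ
  have heq : A.Equivalent A'' := fun w => (hconj.equivalent w).trans (hF.equivalent w)
  refine ⟨⟨?_, ?_, ?_⟩, heq, ?_⟩
  · obtain ⟨a, M, h⟩ := exists_forwardConjugate hnil hclosed hspan
    intro i
    have : A''.init = fun i => (a i : ℚ) := hinj (hF.1.trans h.1.symm)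
    rw [this]; exact isInteger_intCast _
  · obtain ⟨a, M, h⟩ := exists_forwardConjugate hnil hclosed hspan
    intro σ i j
    have h1 : (A''.trans σ).row i = ((M σ).map (Int.cast : ℤ → ℚ)).row i := by
      apply hinj
      exact congrFun ((hF.2.2 σ).trans (h.2.2 σ).symm) i
    have h2 : A''.trans σ i j = (M σ i j : ℚ) := congrFun h1 j
    rw [h2]; exact isInteger_intCast _
  · intro i
    rw [hF.2.1]
    -- A final entry is a row of `F`, hence an integer combination of forward vectors, paired with
    -- `A'.fin`. On a forward vector this pairing is a weight, and the weight is itself an entry of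
    -- that vector since the empty word is in `WB`.
    have hmem : F.row i ∈ A'.forwardModule W := by
      rw [← hspan]; exact Submodule.subset_span ⟨i, rfl⟩
    change IsInteger (F.row i ⬝ᵥ A'.fin)
    refine Submodule.span_induction (p := fun v _ => IsInteger (v ⬝ᵥ A'.fin)) ?_ ?_ ?_ ?_ hmem
    · rintro _ ⟨u, hu, rfl⟩
      change IsInteger (A'.weight u)
      rw [← hconj.equivalent u]
      obtain ⟨j, hj⟩ := List.get_of_mem hWB
      have := hgood u hu j
      rwa [hconj.forward, conjForward, hj, List.append_nil] at this
    · rw [zero_dotProduct]; exact ⟨0, by simp⟩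
    · intro x y _ _ hx hy
      rw [add_dotProduct]; exact isInteger_add hx hy
    · rintro z x - ⟨y, hy⟩
      rw [smul_dotProduct, hy]; exact ⟨z * y, by simp⟩
  · intro d C hC
    -- Minimality: every forward vector factors through the `d` states of `C` by the matrix `BC`, so
    -- the `l` independent rows of `F` lie in a space of dimension at most `d`.
    let BC : Matrix (Fin d) (Fin WB.length) ℚ := Matrix.of fun i j => C.backward (WB.get j) i
    have h1 : ∀ w, A'.forward w = C.forward w ᵥ* BC := by
      intro w
      rw [hconj.forward]
      ext j
      rw [conjForward, heq, hC, weight_append]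
      rfl
    have h2 : ∀ v ∈ A'.forwardModule W, v ∈ LinearMap.range (Matrix.vecMulLinear BC) := by
      intro v hv
      refine Submodule.span_induction (p := fun v _ => v ∈ LinearMap.range (Matrix.vecMulLinear BC))
        ?_ (zero_mem _) (fun x y _ _ hx hy => add_mem hx hy) (fun z x _ hx => ?_) hv
      · rintro _ ⟨u, hu, rfl⟩
        exact ⟨C.forward u, (h1 u).symm⟩
      · rw [← Int.cast_smul_eq_zsmul ℚ]; exact Submodule.smul_mem _ _ hx
    have h3 : Submodule.span ℚ (Set.range F.row) ≤ LinearMap.range (Matrix.vecMulLinear BC) := by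
      refine Submodule.span_le.2 ?_
      rintro _ ⟨i, rfl⟩
      apply h2
      rw [← hspan]; exact Submodule.subset_span ⟨i, rfl⟩
    have h4 := finrank_span_eq_card hindepQ
    rw [Fintype.card_fin] at h4
    have h5 := Submodule.finrank_mono h3
    have h6 := LinearMap.finrank_range_le (Matrix.vecMulLinear BC)
    rw [Module.finrank_fin_fun] at h6
    omega

/-- A forward module has a basis. -/
theorem exists_basis_forwardModule (W : List (Word k)) :
    ∃ (l : ℕ) (F : Matrix (Fin l) (Fin n) ℚ), LinearIndependent ℤ F.row ∧
      Submodule.span ℤ (Set.range F.row) = A.forwardModule W := by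
  -- A finitely generated torsion-free module over `ℤ` is free.
  have : Module.Finite ℤ (A.forwardModule W) := by
    rw [Module.Finite.iff_fg]
    rw [forwardModule, setOf_mem_eq_range]
    exact Submodule.fg_span (Set.finite_range _)
  have : Module.IsTorsionFree ℤ (A.forwardModule W) := inferInstance
  let b := Module.finBasis ℤ (A.forwardModule W)
  refine ⟨_, Matrix.of fun i => (b i : Fin n → ℚ), ?_, ?_⟩
  · exact b.linearIndependent.map' (A.forwardModule W).subtype (Submodule.ker_subtype _)
  · have h := congrArg (Submodule.map (A.forwardModule W).subtype) b.span_eq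
    rw [Submodule.map_span, Submodule.map_top, Submodule.range_subtype, ← Set.range_comp] at h
    exact h

end WeightedAutomaton

/-! ### The meaning of the integer tests -/

section

variable {k d : ℕ} {V V' : Type*} [AddCommGroup V] [Module ℚ V] [AddCommGroup V'] [Module ℚ V']
  {f : Word k → V} {g : Word k → V'} {φ : V →ₗ[ℚ] V'} {c : Word k → ℚ}

/-- Neither nonzero factors that vary from word to word nor an injective linear map affect
membership in spans. This transfers statements about rational vectors to their integer multiples. -/
theorem mem_span_scale_iff (hφ : Function.Injective φ) (hc : ∀ w, c w ≠ 0)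
    (hg : ∀ w, g w = c w • φ (f w)) (W : List (Word k)) (w : Word k) :
    g w ∈ Submodule.span ℚ {v | ∃ u ∈ W, v = g u} ↔
      f w ∈ Submodule.span ℚ {v | ∃ u ∈ W, v = f u} := by
  have h : Submodule.span ℚ {v | ∃ u ∈ W, v = g u} =
      (Submodule.span ℚ {v | ∃ u ∈ W, v = f u}).map φ := by
    apply le_antisymm
    · refine Submodule.span_le.2 ?_
      rintro _ ⟨u, hu, rfl⟩
      rw [hg]
      exact Submodule.smul_mem _ _ (Submodule.mem_map_of_mem (Submodule.subset_span ⟨u, hu, rfl⟩))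
    · rw [Submodule.map_span_le]
      rintro _ ⟨u, hu, rfl⟩
      refine (Submodule.smul_mem_iff _ (hc u)).1 ?_
      rw [← hg]
      exact Submodule.subset_span ⟨u, hu, rfl⟩
  rw [h, hg, Submodule.smul_mem_iff _ (hc w), Submodule.mem_map]
  constructor
  · rintro ⟨y, hy, hy'⟩
    rwa [← hφ hy']
  · exact fun hw => ⟨_, hw, rfl⟩

theorem IndepOrZero.scale (hφ : Function.Injective φ) (hc : ∀ w, c w ≠ 0)
    (hg : ∀ w, g w = c w • φ (f w)) {W : List (Word k)} (hW : IndepOrZero f W) :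
    IndepOrZero g W := by
  rcases hW with hW | ⟨h1, h0⟩
  · refine Or.inl ?_
    have h1 := (hW.map' φ (LinearMap.ker_eq_bot.2 hφ)).units_smul
      (fun i => Units.mk0 (c (W.get i)) (hc _))
    have h2 : (fun i => g (W.get i)) =
        (fun i => Units.mk0 (c (W.get i)) (hc _)) • (φ ∘ fun i => f (W.get i)) := by
      ext i
      exact hg _
    rw [h2]
    exact h1
  · exact Or.inr ⟨h1, fun w => by rw [hg, h0, map_zero, smul_zero]⟩

/-- In the exceptional case the tested vector is zero; then the test and the membership both hold,
even if the determinant vanishes. -/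
theorem IndepOrZero.spanTest_iff {h : Word k → Fin d → ℤ} {W : List (Word k)}
    (hW : IndepOrZero (fun w j => (h w j : ℚ)) W) {M : Matrix (Fin W.length) (Fin d) ℤ}
    (hM : ∀ i, M i = h (W.get i)) (w : Word k) : M.SpanTest (h w) ↔
      (fun j => (h w j : ℚ)) ∈ Submodule.span ℚ {v | ∃ u ∈ W, v = fun j => (h u j : ℚ)} := by
  rw [setOf_mem_eq_range (f := fun u j => (h u j : ℚ))]
  rcases hW with hW | ⟨-, h0⟩
  · obtain rfl : M = fun i => h (W.get i) := funext hM
    exact Matrix.spanTest_iff _ (Matrix.gramDet_ne_zero _ hW) _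
  · have h1 : h w = 0 := by
      ext j
      have h2 : (h w j : ℚ) = 0 := congrFun (h0 w) j
      exact_mod_cast h2
    have h3 : (fun j => (h w j : ℚ)) = 0 := h0 w
    refine iff_of_true ?_ (by rw [h3]; exact zero_mem _)
    rw [Matrix.SpanTest, ← Matrix.coordsHom_apply, h1, map_zero, smul_zero, Matrix.zero_vecMul]

end

namespace WeightedAutomaton

variable {k n : ℕ} {A : WeightedAutomaton k n} {WB : List (Word k)}

theorem denom_ne_zero : (A.denom : ℚ) ≠ 0 := by exact_mod_cast A.denom_pos.ne'

theorem backTest_iff {W : List (Word k)} (hW : IndepOrZero A.backward W) (w : Word k) :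
    A.BackTest W w ↔ A.backward w ∉ A.backwardSpan W := by
  have hc : ∀ w : Word k, (A.denom : ℚ) ^ (w.length + 1) ≠ 0 := fun w => pow_ne_zero _ denom_ne_zero
  have hg : ∀ w : Word k, (fun j => (A.intBackward w j : ℚ)) =
      (A.denom : ℚ) ^ (w.length + 1) • (LinearMap.id : _ →ₗ[ℚ] Fin n → ℚ) (A.backward w) := by
    intro w
    ext j
    exact A.cast_intBackward w j
  have h := hW.scale (φ := LinearMap.id) Function.injective_id hc hg
  exact not_congr ((h.spanTest_iff (h := A.intBackward) (fun _ => rfl) w).trans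
    (mem_span_scale_iff (φ := LinearMap.id) Function.injective_id hc hg W w))

theorem not_spanTest_numerRows_iff {W : List (Word k)} (hW : IndepOrZero (A.conjForward WB) W)
    (w : Word k) : ¬ (A.numerRows WB W).SpanTest (A.numerVec WB w) ↔
      A.conjForward WB w ∉ Submodule.span ℚ {v | ∃ u ∈ W, v = A.conjForward WB u} := by
  have hc : ∀ w : Word k, (A.denom : ℚ) ^ (w.length + 2) ≠ 0 := fun w => pow_ne_zero _ denom_ne_zero
  -- The entry `j` for the word `w` is scaled by `denom` to the power `|w| + |w_j| + 2`. The part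
  -- that depends on `j` is a diagonal map, the rest is a factor for the word.
  let φ : (Fin WB.length → ℚ) →ₗ[ℚ] Fin WB.length → ℚ :=
    LinearMap.pi fun j => (A.denom : ℚ) ^ (WB.get j).length • LinearMap.proj j
  have hφ : Function.Injective φ := by
    intro x y hxy
    ext j
    have h1 : (A.denom : ℚ) ^ (WB.get j).length * x j = (A.denom : ℚ) ^ (WB.get j).length * y j :=
      congrFun hxy j
    exact mul_left_cancel₀ (pow_ne_zero _ denom_ne_zero) h1
  have hg : ∀ w : Word k, (fun j => (A.numerVec WB w j : ℚ)) =
      (A.denom : ℚ) ^ (w.length + 2) • φ (A.conjForward WB w) := by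
    intro w
    ext j
    change (A.numer (w ++ WB.get j) : ℚ) =
      (A.denom : ℚ) ^ (w.length + 2) * ((A.denom : ℚ) ^ (WB.get j).length * A.weight (w ++ WB.get j))
    rw [A.cast_numer, List.length_append]
    ring
  have h := hW.scale hφ hc hg
  exact not_congr ((h.spanTest_iff (h := A.numerVec WB) (fun _ => rfl) w).trans
    (mem_span_scale_iff hφ hc hg W w))

theorem dvd_numer_iff (w : Word k) : A.scaleAt w ∣ A.numer w ↔ IsInteger (A.weight w) := by
  have h0 : ((A.scaleAt w : ℤ) : ℚ) ≠ 0 := by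
    rw [scaleAt]; push_cast; exact pow_ne_zero _ denom_ne_zero
  have h1 : (A.numer w : ℚ) = A.scaleAt w * A.weight w := by
    rw [A.cast_numer, scaleAt]; push_cast; ring
  constructor
  · rintro ⟨z, hz⟩
    refine ⟨z, mul_left_cancel₀ h0 ?_⟩
    rw [← h1, hz]; push_cast; ring
  · rintro ⟨z, hz⟩
    refine ⟨z, ?_⟩
    rw [hz] at h1
    exact_mod_cast h1

theorem cast_intWeight {w : Word k} (hw : IsInteger (A.weight w)) :
    (A.intWeight w : ℚ) = A.weight w := by
  have h0 : A.scaleAt w ≠ 0 := pow_ne_zero _ A.denom_pos.ne'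
  obtain ⟨z, hz⟩ := hw
  have h1 : A.numer w = A.scaleAt w * z := by
    have : (A.numer w : ℚ) = A.scaleAt w * z := by
      rw [A.cast_numer, scaleAt, hz]; push_cast; ring
    exact_mod_cast this
  rw [intWeight, h1, Int.mul_ediv_cancel_left _ h0, hz]

theorem goodWord_iff {w : Word k} : A.GoodWord WB w ↔ ∀ j, IsInteger (A.conjForward WB w j) :=
  forall_congr' fun _ => dvd_numer_iff _

theorem GoodWord.cast_weightVec {w : Word k} (hw : A.GoodWord WB w) :
    (fun j => (A.weightVec WB w j : ℚ)) = A.conjForward WB w := by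
  ext j
  exact cast_intWeight (goodWord_iff.1 hw j)

end WeightedAutomaton

/-! ### Membership in lattices by divisibility -/

namespace Matrix

/-- The embedding of integer vectors in rational vectors. -/
def castHom (m : ℕ) : (Fin m → ℤ) →ₗ[ℤ] (Fin m → ℚ) where
  toFun v j := v j
  map_add' v w := by ext j; simp
  map_smul' z v := by ext j; simp

@[simp] theorem castHom_apply {m : ℕ} (v : Fin m → ℤ) (j : Fin m) : castHom m v j = v j := rfl

theorem castHom_injective (m : ℕ) : Function.Injective (castHom m) := by
  intro v w h
  ext j
  have h1 : (v j : ℚ) = w j := congrFun h j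
  exact_mod_cast h1

variable {r : ℕ} {H : Matrix (Fin r) (Fin r) ℤ}

theorem mem_span_row_int_iff {l n : ℕ} {F : Matrix (Fin l) (Fin n) ℤ} {v : Fin n → ℤ} :
    v ∈ Submodule.span ℤ (Set.range F.row) ↔ ∃ c : Fin l → ℤ, c ᵥ* F = v := by
  rw [Submodule.mem_span_range_iff_exists_fun]
  refine exists_congr fun c => ?_
  rw [show ∑ i, c i • F.row i = c ᵥ* F by
    ext j; simp [Matrix.vecMul, dotProduct, Finset.sum_apply]]

/-- A vector in the kernel of `H` is orthogonal to the row lattice, which contains a nonzero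
multiple of every unit vector. -/
theorem pseudoDet_ne_zero_of_smul_mem {d : ℤ} (hd : d ≠ 0)
    (h : ∀ j, Pi.single j d ∈ Submodule.span ℤ (Set.range H.row)) : H.pseudoDet ≠ 0 := by
  rw [pseudoDet_ne_zero_iff]
  intro h0
  obtain ⟨v, hv0, hv⟩ := exists_mulVec_eq_zero_iff.2 h0
  apply hv0
  ext j
  obtain ⟨c, hc⟩ := mem_span_row_int_iff.1 (h j)
  have h1 : Pi.single j d ⬝ᵥ v = 0 := by
    rw [← hc, ← dotProduct_mulVec, hv, dotProduct_zero]
  rw [single_dotProduct] at h1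
  exact (mul_eq_zero.1 h1).resolve_left hd

/-- With `N` the pseudo-inverse and `δ` the pseudo-determinant, `x = c H` is equivalent to `x N = δ
c`. -/
theorem mem_span_row_iff_dvd (h0 : H.pseudoDet ≠ 0) (x : Fin r → ℤ) :
    x ∈ Submodule.span ℤ (Set.range H.row) ↔ ∀ j, H.pseudoDet ∣ (x ᵥ* H.pseudoInv) j := by
  rw [mem_span_row_int_iff]
  constructor
  · rintro ⟨c, rfl⟩ j
    rw [vecMul_vecMul, mul_pseudoInv, vecMul_smul, vecMul_one]
    exact ⟨c j, rfl⟩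
  · intro h
    choose c hc using h
    refine ⟨c, ?_⟩
    have h1 : x ᵥ* H.pseudoInv = H.pseudoDet • c := by ext j; exact hc j
    have h2 := congrArg (· ᵥ* H) h1
    simp only [vecMul_vecMul, pseudoInv_mul, vecMul_smul, vecMul_one, smul_vecMul] at h2
    exact (smul_right_injective _ h0 h2).symm

/-- The vectors in the span of the rows of `V`. -/
def spanTestSubmodule {n : ℕ} (V : Matrix (Fin r) (Fin n) ℤ) : Submodule ℤ (Fin n → ℤ) :=
  LinearMap.eqLocus (V.gramDet • LinearMap.id) ((Matrix.vecMulLinear V).comp V.coordsHom)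

/-- The passed test recovers a nonzero multiple of `v` from its coordinates. -/
theorem coords_injOn {n : ℕ} {V : Matrix (Fin r) (Fin n) ℤ} (h0 : V.gramDet ≠ 0) {v w : Fin n → ℤ}
    (hv : V.SpanTest v) (hw : V.SpanTest w) (h : V.coords v = V.coords w) : v = w := by
  rw [SpanTest] at hv hw
  refine smul_right_injective _ h0 ?_
  change V.gramDet • v = V.gramDet • w
  rw [hv, hw, h]

theorem coords_row {n : ℕ} (V : Matrix (Fin r) (Fin n) ℤ) (i : Fin r) :
    V.coords (V i) = Pi.single i V.gramDet := by
  have h : V i = Pi.single i 1 ᵥ* V := by rw [single_one_vecMul]; rfl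
  rw [h, coords_vecMul]
  ext j
  simp [Pi.single_apply]

end Matrix

/-! ### The forward module as a lattice of coordinate vectors -/

namespace WeightedAutomaton

variable {k n : ℕ} {A : WeightedAutomaton k n} {WB U W : List (Word k)}

/-- The lattice of the coordinate vectors of the words in `W`. -/
def lattice (A : WeightedAutomaton k n) (WB U W : List (Word k)) :
    Submodule ℤ (Fin U.length → ℤ) := Submodule.span ℤ (Set.range (A.latticeRows WB U W).row)

theorem coords_mem_lattice {w : Word k} (hw : w ∈ W) :
    (A.weightRows WB U).coords (A.weightVec WB w) ∈ A.lattice WB U W := by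
  obtain ⟨i, rfl⟩ := List.get_of_mem hw
  exact Submodule.subset_span ⟨i, rfl⟩

theorem single_mem_lattice (hUW : U ⊆ W) (j : Fin U.length) :
    Pi.single j (A.latticeDet WB U) ∈ A.lattice WB U W := by
  have := coords_mem_lattice (A := A) (WB := WB) (U := U) (hUW (List.get_mem U j))
  rwa [show A.weightVec WB (U.get j) = A.weightRows WB U j from rfl, Matrix.coords_row] at this

/-- The multiples of unit vectors that `Hermite.basis` adds are already in the lattice by
`single_mem_lattice`. The square of the determinant serves as modulus because it is positive
whatever the sign. -/
theorem span_latticeBasis (h0 : A.latticeDet WB U ≠ 0) (hUW : U ⊆ W) :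
    Submodule.span ℤ (Set.range (A.latticeBasis WB U W).row) = A.lattice WB U W := by
  rw [latticeBasis, Hermite.span_basis (mul_self_pos.2 h0), Submodule.span_union, lattice,
    sup_eq_right, Submodule.span_le]
  rintro _ ⟨j, rfl⟩
  have h := Submodule.smul_mem _ (A.latticeDet WB U) (single_mem_lattice (A := A) (WB := WB) hUW j)
  rw [← Pi.single_smul] at h
  exact h

theorem pseudoDet_latticeBasis_ne_zero (h0 : A.latticeDet WB U ≠ 0) (hUW : U ⊆ W) :
    (A.latticeBasis WB U W).pseudoDet ≠ 0 := by
  refine Matrix.pseudoDet_ne_zero_of_smul_mem h0 fun j => ?_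
  rw [span_latticeBasis h0 hUW]
  exact single_mem_lattice hUW j

theorem latticeTest_iff (h0 : A.latticeDet WB U ≠ 0) (hUW : U ⊆ W) (w : Word k) :
    A.LatticeTest WB U W w ↔
      (A.weightRows WB U).coords (A.weightVec WB w) ∈ A.lattice WB U W := by
  rw [← span_latticeBasis h0 hUW,
    Matrix.mem_span_row_iff_dvd (pseudoDet_latticeBasis_ne_zero h0 hUW)]
  rfl

/-- The `ℤ`-span of the integral forward vectors. -/
def weightModule (A : WeightedAutomaton k n) (WB W : List (Word k)) :
    Submodule ℤ (Fin WB.length → ℤ) := Submodule.span ℤ {v | ∃ u ∈ W, v = A.weightVec WB u}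

theorem map_castHom_weightModule (hW : ∀ w ∈ W, A.GoodWord WB w) :
    (A.weightModule WB W).map (Matrix.castHom _) =
      Submodule.span ℤ {v | ∃ u ∈ W, v = A.conjForward WB u} := by
  rw [weightModule, Submodule.map_span]
  congr 1
  ext v
  constructor
  · rintro ⟨_, ⟨u, hu, rfl⟩, rfl⟩
    exact ⟨u, hu, (hW u hu).cast_weightVec⟩
  · rintro ⟨u, hu, rfl⟩
    exact ⟨_, ⟨u, hu, rfl⟩, (hW u hu).cast_weightVec⟩

theorem map_coordsHom_weightModule :
    (A.weightModule WB W).map (A.weightRows WB U).coordsHom = A.lattice WB U W := by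
  rw [weightModule, Submodule.map_span, lattice, setOf_mem_eq_range, ← Set.range_comp]
  rfl

theorem spanTest_weightVec (hU : ∀ w ∈ U, A.GoodWord WB w) {w : Word k} (hw : A.GoodWord WB w)
    (hmem : A.conjForward WB w ∈ Submodule.span ℚ {v | ∃ u ∈ U, v = A.conjForward WB u}) :
    (A.weightRows WB U).SpanTest (A.weightVec WB w) := by
  refine Matrix.spanTest_of_mem_span _ ?_
  rw [hw.cast_weightVec]
  rw [setOf_mem_eq_range] at hmem
  convert hmem using 3
  ext i : 1
  exact (hU _ (List.get_mem U i)).cast_weightVec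

theorem latticeDet_ne_zero (hU : ∀ w ∈ U, A.GoodWord WB w)
    (h : LinearIndependent ℚ fun i => A.conjForward WB (U.get i)) : A.latticeDet WB U ≠ 0 := by
  refine Matrix.gramDet_ne_zero _ ?_
  convert h using 1
  ext i : 1
  exact (hU _ (List.get_mem U i)).cast_weightVec

/-- On the rational span of the vectors of `U` the map `coords` is injective, so membership can be
decided on coordinate vectors. -/
theorem weightVec_mem_iff (hU : ∀ w ∈ U, A.GoodWord WB w) (hW : ∀ w ∈ W, A.GoodWord WB w)
    (hspan : ∀ w, A.conjForward WB w ∈ Submodule.span ℚ {v | ∃ u ∈ U, v = A.conjForward WB u})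
    (h0 : A.latticeDet WB U ≠ 0) {w : Word k} (hw : A.GoodWord WB w) :
    A.weightVec WB w ∈ A.weightModule WB W ↔
      (A.weightRows WB U).coords (A.weightVec WB w) ∈ A.lattice WB U W := by
  rw [← map_coordsHom_weightModule]
  refine ⟨fun h => Submodule.mem_map_of_mem h, ?_⟩
  rintro ⟨v, hv, hvw⟩
  have hle : A.weightModule WB W ≤ (A.weightRows WB U).spanTestSubmodule := by
    refine Submodule.span_le.2 ?_
    rintro _ ⟨u, hu, rfl⟩
    exact spanTest_weightVec hU (hW u hu) (hspan u)
  rwa [← Matrix.coords_injOn h0 (hle hv) (spanTest_weightVec hU hw (hspan w)) hvw]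

/-- A vector in the `ℤ`-span of integral vectors is integral, so testing integrality before
membership loses nothing. -/
theorem conjForward_mem_iff (hW : ∀ w ∈ W, A.GoodWord WB w) {w : Word k} :
    A.conjForward WB w ∈ Submodule.span ℤ {v | ∃ u ∈ W, v = A.conjForward WB u} ↔
      A.GoodWord WB w ∧ A.weightVec WB w ∈ A.weightModule WB W := by
  rw [← map_castHom_weightModule hW]
  constructor
  · rintro ⟨v, hv, hvw⟩
    have hw : A.GoodWord WB w := by
      rw [goodWord_iff, ← hvw]
      exact fun j => isInteger_intCast _
    refine ⟨hw, ?_⟩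
    have : v = A.weightVec WB w := by
      apply Matrix.castHom_injective
      rw [hvw, ← hw.cast_weightVec]
      rfl
    rwa [← this]
  · rintro ⟨hw, h⟩
    exact ⟨_, h, hw.cast_weightVec⟩

/-- The hypotheses under which the test of the module search is correct. -/
structure RankBasis (A : WeightedAutomaton k n) (WB U : List (Word k)) : Prop where
  nil_mem : [] ∈ U
  good : ∀ w ∈ U, A.GoodWord WB w
  indep : IndepOrZero (A.conjForward WB) U
  span : ∀ w, A.conjForward WB w ∈ Submodule.span ℚ {v | ∃ u ∈ U, v = A.conjForward WB u}

theorem RankBasis.eq_zero (hU : A.RankBasis WB U) (h0 : A.latticeDet WB U = 0) (w : Word k) :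
    A.conjForward WB w = 0 := by
  rcases hU.indep with h | ⟨-, h⟩
  · exact absurd h0 (latticeDet_ne_zero hU.good h)
  · exact h w

theorem RankBasis.mem_iff (hU : A.RankBasis WB U) (hUW : U ⊆ W) (hW : ∀ w ∈ W, A.GoodWord WB w)
    (h0 : A.latticeDet WB U ≠ 0) {w : Word k} :
    A.conjForward WB w ∈ Submodule.span ℤ {v | ∃ u ∈ W, v = A.conjForward WB u} ↔
      A.GoodWord WB w ∧ A.LatticeTest WB U W w := by
  rw [conjForward_mem_iff hW, latticeTest_iff h0 hUW]
  exact and_congr_right fun hw => weightVec_mem_iff hU.good hW hU.span h0 hw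

/-- When the determinant is zero, all forward vectors vanish and neither side holds. -/
theorem RankBasis.moduleTest_iff (hU : A.RankBasis WB U) (hUW : U ⊆ W)
    (hW : ∀ w ∈ W, A.GoodWord WB w) {w : Word k} : A.ModuleTest WB U W w ↔
      A.conjForward WB w ∉ Submodule.span ℤ {v | ∃ u ∈ W, v = A.conjForward WB u} := by
  by_cases h0 : A.latticeDet WB U = 0
  · rw [hU.eq_zero h0 w]
    constructor
    · exact fun h => absurd h0 h.2.1
    · exact fun h => absurd (zero_mem _) h
  · rw [hU.mem_iff hUW hW h0]
    exact ⟨fun h => h.2.2, fun h => ⟨fun i => hW _ (List.get_mem W i), h0, h⟩⟩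

/-! ### Progress of the module search -/

/-- The number of classes of the lattice of `W` modulo `latticeDet`. -/
noncomputable def latticeCard (A : WeightedAutomaton k n) (WB U W : List (Word k)) : ℕ :=
  Nat.card ((A.lattice WB U W).toAddSubgroup.map
    (AddMonoidHom.compLeft (Int.castAddHom (ZMod (A.latticeDet WB U).natAbs)) (Fin U.length)))

theorem latticeCard_pos (h0 : A.latticeDet WB U ≠ 0) : 0 < A.latticeCard WB U W := by
  have : NeZero (A.latticeDet WB U).natAbs := ⟨Int.natAbs_ne_zero.2 h0⟩
  exact Nat.card_pos

theorem latticeCard_le (h0 : A.latticeDet WB U ≠ 0) :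
    A.latticeCard WB U W ≤ (A.latticeDet WB U).natAbs ^ U.length := by
  have : NeZero (A.latticeDet WB U).natAbs := ⟨Int.natAbs_ne_zero.2 h0⟩
  refine (Nat.card_le_card_of_injective _ Subtype.val_injective).trans ?_
  rw [Nat.card_eq_fintype_card, Fintype.card_fun, ZMod.card, Fintype.card_fin]

theorem lattice_append (w : Word k) : A.lattice WB U W ≤ A.lattice WB U (W ++ [w]) := by
  rw [← map_coordsHom_weightModule, ← map_coordsHom_weightModule]
  refine Submodule.map_mono (Submodule.span_mono ?_)
  rintro _ ⟨u, hu, rfl⟩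
  exact ⟨u, List.mem_append_left _ hu, rfl⟩

/-- The lattice contains `latticeDet` times every integer vector, so membership is detected modulo
`latticeDet`. -/
theorem mem_of_map_eq (hUW : U ⊆ W) {x : Fin U.length → ℤ}
    (hx : AddMonoidHom.compLeft (Int.castAddHom (ZMod (A.latticeDet WB U).natAbs)) (Fin U.length) x ∈
      (A.lattice WB U W).toAddSubgroup.map (AddMonoidHom.compLeft
        (Int.castAddHom (ZMod (A.latticeDet WB U).natAbs)) (Fin U.length))) :
    x ∈ A.lattice WB U W := by
  obtain ⟨y, hy, hyx⟩ := hx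
  have h1 : ∀ j, ∃ c, x j - y j = A.latticeDet WB U * c := by
    intro j
    have h2 : ((y j : ℤ) : ZMod (A.latticeDet WB U).natAbs) = (x j : ℤ) := congrFun hyx j
    exact Int.natAbs_dvd.1 ((ZMod.intCast_eq_intCast_iff_dvd_sub _ _ _).1 h2)
  choose c hc using h1
  have h2 : x = y + ∑ j, c j • Pi.single j (A.latticeDet WB U) := by
    ext j
    rw [Pi.add_apply, Finset.sum_apply, Finset.sum_eq_single j]
    · simp only [Pi.smul_apply, Pi.single_eq_same, smul_eq_mul]
      linarith [hc j, mul_comm (c j) (A.latticeDet WB U)]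
    · intro i _ hij
      simp [hij.symm]
    · simp
  rw [h2]
  exact add_mem hy (sum_mem fun j _ => Submodule.smul_mem _ _ (single_mem_lattice hUW j))

/-- The new vector enlarges the lattice and hence its image modulo `latticeDet`. By Lagrange's
theorem a proper subgroup of a finite group has index at least two. -/
theorem RankBasis.latticeCard_append (hU : A.RankBasis WB U) (hUW : U ⊆ W)
    (hW : ∀ w ∈ W, A.GoodWord WB w) (h0 : A.latticeDet WB U ≠ 0) {w : Word k}
    (hw : A.GoodWord WB w)
    (hnew : A.conjForward WB w ∉ Submodule.span ℤ {v | ∃ u ∈ W, v = A.conjForward WB u}) :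
    2 * A.latticeCard WB U W ≤ A.latticeCard WB U (W ++ [w]) := by
  have : NeZero (A.latticeDet WB U).natAbs := ⟨Int.natAbs_ne_zero.2 h0⟩
  rw [conjForward_mem_iff hW, weightVec_mem_iff hU.good hW hU.span h0 hw] at hnew
  have hle := AddSubgroup.map_mono (f := AddMonoidHom.compLeft
    (Int.castAddHom (ZMod (A.latticeDet WB U).natAbs)) (Fin U.length))
    (Submodule.toAddSubgroup_mono (lattice_append (A := A) (WB := WB) (U := U) (W := W) w))
  obtain ⟨c, hc⟩ := AddSubgroup.card_dvd_of_le hle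
  have hpos := latticeCard_pos (A := A) (WB := WB) (U := U) (W := W) h0
  have hpos' := latticeCard_pos (A := A) (WB := WB) (U := U) (W := W ++ [w]) h0
  change A.latticeCard WB U (W ++ [w]) = A.latticeCard WB U W * c at hc
  have hc2 : 2 ≤ c := by
    by_contra hlt
    have hc' : c = 0 ∨ c = 1 := by omega
    rcases hc' with rfl | rfl
    · simp at hc; omega
    · refine hnew ⟨hw, mem_of_map_eq hUW ?_⟩
      rw [mul_one] at hc
      rw [AddSubgroup.eq_of_le_of_card_ge hle hc.le]
      exact ⟨_, coords_mem_lattice (by simp), rfl⟩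
  rw [hc, mul_comm]
  exact Nat.mul_le_mul_left _ hc2

end WeightedAutomaton

/-! ### Invariants of the procedure -/

namespace WeightedAutomaton

variable {k n : ℕ} {A : WeightedAutomaton k n} {WB U W : List (Word k)}
  {A' : WeightedAutomaton k WB.length}

theorem BackwardConjugate.forward_eq (h : A.BackwardConjugate (A.backwardMatrix WB) A') :
    A'.forward = A.conjForward WB := funext h.forward

theorem BackwardConjugate.goodWord_iff (h : A.BackwardConjugate (A.backwardMatrix WB) A')
    {w : Word k} : A.GoodWord WB w ↔ A'.ForwardIntegral w := by
  rw [WeightedAutomaton.goodWord_iff, ForwardIntegral, h.forward_eq]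

theorem BackwardConjugate.forwardSpan_eq (h : A.BackwardConjugate (A.backwardMatrix WB) A') :
    A'.forwardSpan W = Submodule.span ℚ {v | ∃ u ∈ W, v = A.conjForward WB u} := by
  rw [forwardSpan, h.forward_eq]

theorem BackwardConjugate.forwardModule_eq (h : A.BackwardConjugate (A.backwardMatrix WB) A') :
    A'.forwardModule W = Submodule.span ℤ {v | ∃ u ∈ W, v = A.conjForward WB u} := by
  rw [forwardModule, h.forward_eq]

/-- The invariant of a search for independent vectors `f w`. -/
structure SearchInv {V : Type*} [AddCommGroup V] [Module ℚ V] (f : Word k → V)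
    (W : List (Word k)) : Prop where
  nil_mem : [] ∈ W
  short : ∀ w ∈ W, w.length < W.length
  indep : IndepOrZero f W

section

variable {V : Type*} [AddCommGroup V] [Module ℚ V] {f : Word k → V}

theorem searchInv_nil (h : f [] = 0 → ∀ w, f w = 0) : SearchInv f [[]] :=
  ⟨by simp, by simp, indepOrZero_nil h⟩

/-- A new word is one letter longer than an old one, so words stay shorter than the list; this keeps
the data polynomially short. -/
theorem SearchInv.append (hW : SearchInv f W) {u w : Word k} (hu : u ∈ W)
    (hlen : w.length = u.length + 1) (hw : f w ∉ Submodule.span ℚ {v | ∃ u ∈ W, v = f u}) :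
    SearchInv f (W ++ [w]) := by
  refine ⟨List.mem_append_left _ hW.nil_mem, fun x hx => ?_, hW.indep.append hw⟩
  rw [List.length_append, List.length_singleton]
  rcases List.mem_append.1 hx with hx | hx
  · have := hW.short x hx; omega
  · rw [List.mem_singleton.1 hx, hlen]
    have := hW.short u hu; omega

end

/-- The words and the automaton that the backward search produces. -/
structure ConjInv (A : WeightedAutomaton k n) (WB : List (Word k))
    (A' : WeightedAutomaton k WB.length) : Prop where
  search : SearchInv A.backward WB
  conj : A.BackwardConjugate (A.backwardMatrix WB) A'

theorem ConjInv.conjForward_eq_zero (h : A.ConjInv WB A') (h0 : A.conjForward WB [] = 0)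
    (w : Word k) : A.conjForward WB w = 0 := by
  rw [← h.conj.forward_eq] at h0 ⊢
  exact A'.forward_eq_zero h0 w

/-- A bound for the number of words that the module search adds to `U`. -/
def moduleBound (A : WeightedAutomaton k n) (WB U : List (Word k)) : ℕ :=
  U.length * (A.latticeDet WB U).natAbs.size

/-- The invariant of the module search. -/
structure ModuleInv (A : WeightedAutomaton k n) (WB U W : List (Word k)) : Prop where
  subset : U ⊆ W
  good : ∀ w ∈ W, A.GoodWord WB w
  le : U.length ≤ W.length
  progress : (A.latticeDet WB U = 0 ∧ W.length = U.length) ∨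
    (A.latticeDet WB U ≠ 0 ∧ 2 ^ (W.length - U.length) ≤ A.latticeCard WB U W)

theorem moduleInv_self (hU : ∀ w ∈ U, A.GoodWord WB w) : A.ModuleInv WB U U := by
  refine ⟨List.Subset.refl _, hU, le_rfl, ?_⟩
  by_cases h : A.latticeDet WB U = 0
  · exact Or.inl ⟨h, rfl⟩
  · refine Or.inr ⟨h, ?_⟩
    rw [Nat.sub_self, pow_zero]
    exact latticeCard_pos h

theorem ModuleInv.append (hW : A.ModuleInv WB U W) (hU : A.RankBasis WB U) {w : Word k}
    (hw : A.GoodWord WB w)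
    (hnew : A.conjForward WB w ∉ Submodule.span ℤ {v | ∃ u ∈ W, v = A.conjForward WB u}) :
    A.ModuleInv WB U (W ++ [w]) := by
  refine ⟨fun x hx => List.mem_append_left _ (hW.subset hx), fun x hx => ?_, ?_, Or.inr ?_⟩
  · rcases List.mem_append.1 hx with hx | hx
    · exact hW.good x hx
    · rwa [List.mem_singleton.1 hx]
  · have := hW.le
    rw [List.length_append]; omega
  · rcases hW.progress with ⟨h0, -⟩ | ⟨h0, hp⟩
    · exact absurd (by rw [hU.eq_zero h0 w]; exact zero_mem _) hnew
    · refine ⟨h0, le_trans ?_ (hU.latticeCard_append hW.subset hW.good h0 hw hnew)⟩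
      have hle := hW.le
      rw [List.length_append, List.length_singleton,
        show W.length + 1 - U.length = W.length - U.length + 1 by omega, pow_succ, mul_comm]
      exact Nat.mul_le_mul_left _ hp

/-- There are at most `|latticeDet| ^ U.length` classes modulo `latticeDet`, and `W.length -
U.length` doublings have to fit below that. -/
theorem ModuleInv.length_le (hW : A.ModuleInv WB U W) :
    W.length ≤ U.length + A.moduleBound WB U := by
  rcases hW.progress with ⟨-, h⟩ | ⟨h0, h⟩
  · omega
  · have h1 : 2 ^ (W.length - U.length) ≤ 2 ^ (A.moduleBound WB U) := by
      refine (h.trans (latticeCard_le h0)).trans ?_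
      rw [moduleBound, mul_comm, pow_mul]
      exact Nat.pow_le_pow_left (Nat.lt_size_self _).le _
    have h2 := (Nat.pow_le_pow_iff_right (by norm_num : 1 < 2)).1 h1
    omega

end WeightedAutomaton

namespace ZCompute

open WeightedAutomaton

variable {k n : ℕ} {A : WeightedAutomaton k n}

/-- An invariant of the states that are reached in `t` steps. -/
def StateInv (A : WeightedAutomaton k n) (t : ℕ) : State k → Prop
  | .backwardLoop WB => t + 1 = WB.length ∧ SearchInv A.backward WB
  | .conjugated WB A' => t = WB.length ∧ A.ConjInv WB A'
  | .rankLoop WB A' W => t = WB.length + W.length ∧ A.ConjInv WB A' ∧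
      SearchInv (A.conjForward WB) W ∧ ∀ w ∈ W, A.GoodWord WB w
  | .moduleLoop WB A' W => t = WB.length + W.length + 1 ∧ A.ConjInv WB A' ∧
      ∃ U, SearchInv (A.conjForward WB) U ∧ A.RankBasis WB U ∧ A.ModuleInv WB U W
  | .nonInteger WB A' w => A.ConjInv WB A' ∧ ¬ A.GoodWord WB w ∧
      ∃ U, SearchInv (A.conjForward WB) U ∧
        t ≤ WB.length + (U.length + A.moduleBound WB U) + 2
  | .generators WB A' W => A.ConjInv WB A' ∧ [] ∈ W ∧ (∀ w ∈ W, A'.ForwardIntegral w) ∧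
      (∀ w ∈ W, ∀ σ : Fin k, A'.forward (w ++ [σ]) ∈ A'.forwardModule W) ∧
      ∃ U, SearchInv (A.conjForward WB) U ∧
        t ≤ WB.length + (U.length + A.moduleBound WB U) + 2
  | .output r => r.Correct A ∧ ∃ WB U, SearchInv A.backward WB ∧
      SearchInv (A.conjForward WB) U ∧ t ≤ WB.length + (U.length + A.moduleBound WB U) + 3

theorem rankBasis_of_closed {WB W : List (Word k)} {A' : WeightedAutomaton k WB.length}
    (hA' : A.ConjInv WB A') (hW : SearchInv (A.conjForward WB) W)
    (hgood : ∀ w ∈ W, A.GoodWord WB w)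
    (hclosed : ∀ w ∈ W, ∀ σ : Fin k, A'.forward (w ++ [σ]) ∈ A'.forwardSpan W) :
    A.RankBasis WB W := by
  refine ⟨hW.nil_mem, hgood, hW.indep, fun w => ?_⟩
  have := A'.forward_mem_forwardSpan hW.nil_mem hclosed w
  rwa [hA'.conj.forwardSpan_eq, hA'.conj.forward] at this

theorem stateInv_start : StateInv A 0 (start k) :=
  ⟨rfl, searchInv_nil A.backward_eq_zero⟩

/-- The counter is tied to the lengths of the lists, since each addition of a word and each change
of stage costs one step. Bounds for these lengths then bound all executions, whatever choices are
made. -/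
theorem StateInv.step {t : ℕ} {s s' : State k} (h : StateInv A t s) (hs : Step A s s') :
    StateInv A (t + 1) s' := by
  cases hs with
  | backwardAdd WB w σ hw hnew =>
    exact ⟨by rw [List.length_append, List.length_singleton, ← h.1], h.2.append hw rfl hnew⟩
  | backwardDone WB A' hclosed hconj => exact ⟨h.1, h.2, hconj⟩
  | emptyWordBad WB A' hbad =>
    -- No rank search has taken place; the one-word list serves as the witness, as only its
    -- invariant matters.
    refine ⟨h.2, fun hg => hbad (h.2.conj.goodWord_iff.1 hg), [[]],
      searchInv_nil h.2.conjForward_eq_zero, ?_⟩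
    have := h.1
    omega
  | emptyWordGood WB A' hgood =>
    refine ⟨?_, h.2, searchInv_nil h.2.conjForward_eq_zero, ?_⟩
    · have := h.1
      simp [this]
    · intro w hw
      rw [List.mem_singleton.1 hw]
      exact h.2.conj.goodWord_iff.2 hgood
  | rankBad WB A' W w σ hw hnew hbad =>
    refine ⟨h.2.1, fun hg => hbad (h.2.1.conj.goodWord_iff.1 hg), W, h.2.2.1, ?_⟩
    have := h.1
    omega
  | rankAdd WB A' W w σ hw hnew hgood =>
    rw [h.2.1.conj.forwardSpan_eq, h.2.1.conj.forward] at hnew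
    refine ⟨?_, h.2.1, h.2.2.1.append hw (by simp) hnew, fun x hx => ?_⟩
    · rw [h.1, List.length_append, List.length_singleton, add_assoc]
    · rcases List.mem_append.1 hx with hx | hx
      · exact h.2.2.2 x hx
      · rw [List.mem_singleton.1 hx]
        exact h.2.1.conj.goodWord_iff.2 hgood
  | rankDone WB A' W hclosed =>
    exact ⟨by rw [h.1], h.2.1, W, h.2.2.1, rankBasis_of_closed h.2.1 h.2.2.1 h.2.2.2 hclosed,
      moduleInv_self h.2.2.2⟩
  | moduleBad WB A' W w σ hw hnew hbad =>
    obtain ⟨ht, hA', U, hU, -, hW⟩ := h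
    refine ⟨hA', fun hg => hbad (hA'.conj.goodWord_iff.1 hg), U, hU, ?_⟩
    have := hW.length_le
    omega
  | moduleAdd WB A' W w σ hw hnew hgood =>
    obtain ⟨ht, hA', U, hU, hU', hW⟩ := h
    rw [hA'.conj.forwardModule_eq, hA'.conj.forward] at hnew
    refine ⟨?_, hA', U, hU, hU', hW.append hU' (hA'.conj.goodWord_iff.2 hgood) hnew⟩
    rw [ht, List.length_append, List.length_singleton]; omega
  | moduleDone WB A' W hclosed =>
    obtain ⟨ht, hA', U, hU, hU', hW⟩ := h
    refine ⟨hA', hW.subset hU.nil_mem, fun w hw => hA'.conj.goodWord_iff.1 (hW.good w hw), hclosed,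
      U, hU, ?_⟩
    have := hW.length_le
    omega
  | returnWord WB A' w i hi =>
    obtain ⟨hA', -, U, hU, ht⟩ := h
    refine ⟨?_, WB, U, hA'.search, hU, by omega⟩
    rwa [hA'.conj.forward] at hi
  | returnAutomaton WB A' W l F A'' hindep hspan hconj =>
    obtain ⟨hA', hnil, hgood, hclosed, U, hU, ht⟩ := h
    exact ⟨correct_of_forwardConjugate hA'.search.nil_mem hA'.conj hnil hgood hclosed hindep hspan
      hconj, WB, U, hA'.search, hU, by omega⟩

theorem stateInv_of_steps {N : ℕ} {s : ℕ → State k} (h0 : s 0 = start k)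
    (hs : ∀ i < N, Step A (s i) (s (i + 1))) : StateInv A N (s N) := by
  have h : ∀ i ≤ N, StateInv A i (s i) := by
    intro i hi
    induction i with
    | zero => rw [h0]; exact stateInv_start
    | succ i ih => exact (ih (by omega)).step (hs i (by omega))
  exact h N le_rfl

theorem exists_stateInv {s : State k} (hs : Relation.ReflTransGen (Step A) (start k) s) :
    ∃ t, StateInv A t s := by
  induction hs with
  | refl => exact ⟨0, stateInv_start⟩
  | tail _ hs ih => exact ⟨_, ih.choose_spec.step hs⟩

/-- The procedure never gets stuck. -/
theorem StateInv.progress {t : ℕ} {s : State k} (h : StateInv A t s) :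
    (∃ s', Step A s s') ∨ ∃ r : Outcome k, s = State.output r ∧ r.Correct A := by
  cases s with
  | backwardLoop WB =>
    left
    by_cases hclosed : ∀ w ∈ WB, ∀ σ : Fin k, A.backward (σ :: w) ∈ A.backwardSpan WB
    · obtain ⟨A', hA'⟩ := exists_backwardConjugate h.2.nil_mem hclosed
      exact ⟨_, .backwardDone WB A' hclosed hA'⟩
    · push Not at hclosed
      obtain ⟨w, hw, σ, hnew⟩ := hclosed
      exact ⟨_, .backwardAdd WB w σ hw hnew⟩
  | conjugated WB A' =>
    left
    by_cases hgood : A'.ForwardIntegral []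
    · exact ⟨_, .emptyWordGood WB A' hgood⟩
    · exact ⟨_, .emptyWordBad WB A' hgood⟩
  | rankLoop WB A' W =>
    left
    by_cases hclosed : ∀ w ∈ W, ∀ σ : Fin k, A'.forward (w ++ [σ]) ∈ A'.forwardSpan W
    · exact ⟨_, .rankDone WB A' W hclosed⟩
    · push Not at hclosed
      obtain ⟨w, hw, σ, hnew⟩ := hclosed
      by_cases hgood : A'.ForwardIntegral (w ++ [σ])
      · exact ⟨_, .rankAdd WB A' W w σ hw hnew hgood⟩
      · exact ⟨_, .rankBad WB A' W w σ hw hnew hgood⟩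
  | moduleLoop WB A' W =>
    left
    by_cases hclosed : ∀ w ∈ W, ∀ σ : Fin k, A'.forward (w ++ [σ]) ∈ A'.forwardModule W
    · exact ⟨_, .moduleDone WB A' W hclosed⟩
    · push Not at hclosed
      obtain ⟨w, hw, σ, hnew⟩ := hclosed
      by_cases hgood : A'.ForwardIntegral (w ++ [σ])
      · exact ⟨_, .moduleAdd WB A' W w σ hw hnew hgood⟩
      · exact ⟨_, .moduleBad WB A' W w σ hw hnew hgood⟩
  | nonInteger WB A' w =>
    left
    have hbad := h.2.1
    rw [h.1.conj.goodWord_iff, ForwardIntegral] at hbad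
    push Not at hbad
    obtain ⟨i, hi⟩ := hbad
    exact ⟨_, .returnWord WB A' w i hi⟩
  | generators WB A' W =>
    left
    obtain ⟨hA', hnil, hgood, hclosed, -⟩ := h
    obtain ⟨l, F, hindep, hspan⟩ := exists_basis_forwardModule (A := A') W
    obtain ⟨a, M, hconj⟩ := exists_forwardConjugate hnil hclosed hspan
    exact ⟨_, .returnAutomaton WB A' W l F _ hindep hspan hconj⟩
  | output r => exact Or.inr ⟨r, rfl, h.1⟩

end ZCompute

/-! ### The output automaton -/

namespace WeightedAutomaton

variable {k n : ℕ}

/-- The automaton with the given integer entries. -/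
def ofInt {r : ℕ} (a : Fin r → ℤ) (M : Fin k → Matrix (Fin r) (Fin r) ℤ) (b : Fin r → ℤ) :
    WeightedAutomaton k r :=
  ⟨fun i => a i, fun σ => (M σ).map (Int.cast : ℤ → ℚ), fun i => b i⟩

variable (A : WeightedAutomaton k n) (WB U W : List (Word k))

/-- The initial vector of the output automaton. -/
def outInit : Fin U.length → ℤ := fun i =>
  ((A.weightRows WB U).coords (A.weightVec WB []) ᵥ* (A.latticeBasis WB U W).pseudoInv) i /
    (A.latticeBasis WB U W).pseudoDet

/-- The rows are the coordinate vectors of the words `u ++ [σ]` for `u` in `U`. -/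
def extensionRows (σ : Fin k) : Matrix (Fin U.length) (Fin U.length) ℤ := fun i =>
  (A.weightRows WB U).coords (A.weightVec WB (U.get i ++ [σ]))

/-- The transition matrices of the output automaton. -/
def outTrans (σ : Fin k) : Matrix (Fin U.length) (Fin U.length) ℤ := fun i j =>
  (A.latticeBasis WB U W * A.extensionRows WB U σ * (A.latticeBasis WB U W).pseudoInv) i j /
    (A.latticeDet WB U * (A.latticeBasis WB U W).pseudoDet)

/-- The final vector of the output automaton. -/
def outFin : Fin U.length → ℤ := fun i =>
  (A.latticeBasis WB U W *ᵥ fun j => A.intWeight (U.get j)) i / A.latticeDet WB U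

/-- The output automaton. -/
def outAutomaton : WeightedAutomaton k U.length :=
  ofInt (A.outInit WB U W) (A.outTrans WB U W) (A.outFin WB U W)

variable {A WB U W}

theorem RankBasis.spanTest (hU : A.RankBasis WB U) {w : Word k} (hw : A.GoodWord WB w) :
    (A.weightRows WB U).SpanTest (A.weightVec WB w) := spanTest_weightVec hU.good hw (hU.span w)

theorem RankBasis.weightModule_le (hU : A.RankBasis WB U) (hW : ∀ w ∈ W, A.GoodWord WB w) :
    A.weightModule WB W ≤ (A.weightRows WB U).spanTestSubmodule := by
  refine Submodule.span_le.2 ?_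
  rintro _ ⟨u, hu, rfl⟩
  exact hU.spanTest (hW u hu)

/-- A basis of the forward module, as an integer matrix. -/
theorem RankBasis.exists_basis (hU : A.RankBasis WB U) (hUW : U ⊆ W)
    (hW : ∀ w ∈ W, A.GoodWord WB w) (h0 : A.latticeDet WB U ≠ 0) :
    ∃ F : Matrix (Fin U.length) (Fin WB.length) ℤ,
      (∀ i, (A.weightRows WB U).coords (F i) = A.latticeBasis WB U W i) ∧
      (∀ i, (A.weightRows WB U).SpanTest (F i)) ∧
      LinearIndependent ℤ F.row ∧
      Submodule.span ℤ (Set.range F.row) = A.weightModule WB W := by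
  -- The rows of the triangular basis are coordinate vectors of elements of the module; lifting them
  -- gives the rows of `F`. Independence and generation carry over because `coords` is linear and
  -- injective on the module.
  have h1 : ∀ i, ∃ v ∈ A.weightModule WB W,
      (A.weightRows WB U).coords v = A.latticeBasis WB U W i := by
    intro i
    have h2 : A.latticeBasis WB U W i ∈ A.lattice WB U W := by
      rw [← span_latticeBasis h0 hUW]
      exact Submodule.subset_span ⟨i, rfl⟩
    rw [← map_coordsHom_weightModule] at h2
    exact h2
  choose F' hF hFH using h1
  let F : Matrix (Fin U.length) (Fin WB.length) ℤ := F'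
  replace hF : ∀ i, F i ∈ A.weightModule WB W := hF
  replace hFH : ∀ i, (A.weightRows WB U).coords (F i) = A.latticeBasis WB U W i := hFH
  have hle := hU.weightModule_le hW
  have hrow : (A.weightRows WB U).coordsHom ∘ F.row = (A.latticeBasis WB U W).row :=
    funext hFH
  have hspan_le : Submodule.span ℤ (Set.range (F.row)) ≤ A.weightModule WB W := by
    refine Submodule.span_le.2 ?_
    rintro _ ⟨i, rfl⟩
    exact hF i
  refine ⟨F, hFH, fun i => hle (hF i), ?_, le_antisymm hspan_le fun v hv => ?_⟩
  · refine LinearIndependent.of_comp (A.weightRows WB U).coordsHom ?_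
    rw [hrow, ← Matrix.vecMul_injective_iff]
    have hd := pseudoDet_latticeBasis_ne_zero h0 hUW
    intro x y hxy
    have h2 := congrArg (· ᵥ* (A.latticeBasis WB U W).pseudoInv) hxy
    simp only [Matrix.vecMul_vecMul, Matrix.mul_pseudoInv, Matrix.vecMul_smul,
      Matrix.vecMul_one] at h2
    exact smul_right_injective _ hd h2
  · have h2 : (A.weightRows WB U).coordsHom v ∈
        (Submodule.span ℤ (Set.range (F.row))).map (A.weightRows WB U).coordsHom := by
      rw [Submodule.map_span, ← Set.range_comp, hrow, span_latticeBasis h0 hUW,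
        ← map_coordsHom_weightModule]
      exact Submodule.mem_map_of_mem hv
    obtain ⟨u, hu, huv⟩ := h2
    have h3 : u = v := Matrix.coords_injOn h0 (hle (hspan_le hu)) (hle hv) huv
    exact h3 ▸ hu

theorem map_castHom_span_row {l m : ℕ} (F : Matrix (Fin l) (Fin m) ℤ) :
    (Submodule.span ℤ (Set.range F.row)).map (Matrix.castHom m) =
      Submodule.span ℤ (Set.range (F.map (Int.cast : ℤ → ℚ)).row) := by
  rw [Submodule.map_span, ← Set.range_comp]
  rfl

theorem castHom_vecMul {l m : ℕ} (F : Matrix (Fin l) (Fin m) ℤ) (c : Fin l → ℤ) :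
    Matrix.castHom m (c ᵥ* F) = (fun i => (c i : ℚ)) ᵥ* F.map (Int.cast : ℤ → ℚ) :=
  funext (Matrix.vecMul_map_intCast F c)

theorem _root_.Matrix.coords_vecMul_eq {l r m : ℕ} {V : Matrix (Fin r) (Fin m) ℤ}
    {F : Matrix (Fin l) (Fin m) ℤ} {H : Matrix (Fin l) (Fin r) ℤ}
    (h : ∀ i, V.coords (F i) = H i) (c : Fin l → ℤ) : V.coords (c ᵥ* F) = c ᵥ* H := by
  have h1 : ∀ {m : ℕ} (G : Matrix (Fin l) (Fin m) ℤ), c ᵥ* G = ∑ i, c i • G i := by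
    intro m G
    ext j
    simp [Matrix.vecMul, dotProduct, Finset.sum_apply]
  rw [h1, h1, ← Matrix.coordsHom_apply, map_sum]
  exact Finset.sum_congr rfl fun i _ => by rw [map_smul, Matrix.coordsHom_apply, h]

/-- The output automaton is a forward conjugate. -/
theorem outAutomaton_forwardConjugate {A' : WeightedAutomaton k WB.length} (hWB : [] ∈ WB)
    (hconj : A.BackwardConjugate (A.backwardMatrix WB) A') (hU : A.RankBasis WB U) (hUW : U ⊆ W)
    (hW : ∀ w ∈ W, A.GoodWord WB w) (h0 : A.latticeDet WB U ≠ 0)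
    (hclosed : ∀ w ∈ W, ∀ σ : Fin k, A'.forward (w ++ [σ]) ∈ A'.forwardModule W) :
    ∃ F : Matrix (Fin U.length) (Fin WB.length) ℚ, LinearIndependent ℤ F.row ∧
      Submodule.span ℤ (Set.range F.row) = A'.forwardModule W ∧
      A'.ForwardConjugate F (A.outAutomaton WB U W) := by
  obtain ⟨F, hFH, hFV, hF, hspan⟩ := hU.exists_basis hUW hW h0
  have hd := pseudoDet_latticeBasis_ne_zero h0 hUW
  have hnil := hUW hU.nil_mem
  have hspan' : Submodule.span ℤ (Set.range (F.map (Int.cast : ℤ → ℚ)).row) =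
      A'.forwardModule W := by
    rw [← map_castHom_span_row, hspan, map_castHom_weightModule hW, hconj.forwardModule_eq]
  have hindep : LinearIndependent ℤ (F.map (Int.cast : ℤ → ℚ)).row :=
    hF.map' (Matrix.castHom _) (LinearMap.ker_eq_bot.2 (Matrix.castHom_injective _))
  -- The closed module contains all forward vectors, so every word is good and `weightVec` is the
  -- true forward vector also for words outside `W`.
  have hgood : ∀ w, A.GoodWord WB w := by
    intro w
    have h1 := A'.forward_mem_forwardModule hnil hclosed w
    rw [hconj.forwardModule_eq, hconj.forward, conjForward_mem_iff hW] at h1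
    exact h1.1
  have hforward : ∀ w, Matrix.castHom _ (A.weightVec WB w) = A'.forward w := fun w => by
    rw [hconj.forward, ← (hgood w).cast_weightVec]; rfl
  -- The rows of `F` in terms of the vectors of `U`: the coefficients are the lattice basis, up to
  -- the factor `latticeDet` carried by `coords`.
  have hcast : ∀ i, (A.latticeDet WB U : ℚ) • (F.map (Int.cast : ℤ → ℚ)) i =
      ∑ j, (A.latticeBasis WB U W i j : ℚ) • A'.forward (U.get j) := by
    intro i
    have h1 := congrArg (Matrix.castHom _) (hFV i)
    rw [hFH] at h1
    ext m
    have h2 := congrFun h1 m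
    rw [castHom_vecMul, map_zsmul] at h2
    simp only [← hforward]
    refine (show _ from ?_ : _ = _).trans (h2.trans ?_)
    · simp [latticeDet]
    · simp [Matrix.vecMul, dotProduct, Finset.sum_apply, weightRows]
  obtain ⟨a, M, h⟩ := exists_forwardConjugate hnil hclosed hspan'
  refine ⟨_, hindep, hspan', ?_⟩
  have hcorrect := correct_of_forwardConjugate hWB hconj hnil
    (fun w hw => hconj.goodWord_iff.1 (hW w hw)) hclosed hindep hspan' h
  have hinit : A.outInit WB U W = a := by
    have h1 : a ᵥ* F = A.weightVec WB [] := by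
      apply Matrix.castHom_injective
      rw [castHom_vecMul, hforward, forward_nil]
      exact h.1
    ext i
    rw [outInit, ← h1, Matrix.coords_vecMul_eq hFH, Matrix.vecMul_vecMul, Matrix.mul_pseudoInv,
      Matrix.vecMul_smul, Matrix.vecMul_one]
    exact Int.mul_ediv_cancel_left _ hd
  have htrans : A.outTrans WB U W = M := by
    ext σ i j
    -- With `H` the lattice basis, `E` the extension rows and `δ = latticeDet`, taking coordinates
    -- here gives `δ M H = H E`. Multiplication by the pseudo-inverse of `H` yields `δ · pseudoDet H
    -- · M`, the numerator in `outTrans`, so the division there is exact.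
    have h1 : A.latticeDet WB U • (M σ i ᵥ* F) =
        ∑ j, A.latticeBasis WB U W i j • A.weightVec WB (U.get j ++ [σ]) := by
      apply Matrix.castHom_injective
      have h2 : (fun j => (M σ i j : ℚ)) ᵥ* F.map (Int.cast : ℤ → ℚ) =
          (F.map (Int.cast : ℤ → ℚ)) i ᵥ* A'.trans σ := congrFun (h.2.2 σ) i
      rw [map_zsmul, castHom_vecMul, h2, ← Int.cast_smul_eq_zsmul ℚ, ← Matrix.smul_vecMul, hcast,
        map_sum, Matrix.sum_vecMul]
      refine Finset.sum_congr rfl fun j _ => ?_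
      rw [Matrix.smul_vecMul, ← forward_snoc, map_zsmul, hforward, Int.cast_smul_eq_zsmul]
    have h3 : A.latticeDet WB U • (M σ i ᵥ* A.latticeBasis WB U W) =
        A.latticeBasis WB U W i ᵥ* A.extensionRows WB U σ := by
      have h4 := congrArg (A.weightRows WB U).coordsHom h1
      rw [map_smul, Matrix.coordsHom_apply, Matrix.coords_vecMul_eq hFH, map_sum] at h4
      simp only [map_smul] at h4
      rw [h4]
      ext j
      simp [Matrix.vecMul, dotProduct, Finset.sum_apply, extensionRows]
    have h5 : (A.latticeBasis WB U W * A.extensionRows WB U σ *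
        (A.latticeBasis WB U W).pseudoInv) i j =
        (A.latticeBasis WB U W i ᵥ* A.extensionRows WB U σ ᵥ*
        (A.latticeBasis WB U W).pseudoInv) j := rfl
    rw [outTrans, h5, ← h3, Matrix.smul_vecMul, Matrix.vecMul_vecMul, Matrix.mul_pseudoInv,
      Matrix.vecMul_smul, Matrix.vecMul_one, smul_smul]
    exact Int.mul_ediv_cancel_left _ (mul_ne_zero h0 hd)
  have hfin : (fun i => (A.outFin WB U W i : ℚ)) = F.map (Int.cast : ℤ → ℚ) *ᵥ A'.fin := by
    ext i
    -- The division in `outFin` is exact because the final vector is already known to be integral.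
    obtain ⟨z, hz⟩ := hcorrect.1.2.2 i
    change (F.map (Int.cast : ℤ → ℚ) *ᵥ A'.fin) i = z at hz
    rw [hz]
    have h1 : (A.latticeBasis WB U W *ᵥ fun j => A.intWeight (U.get j)) i =
        A.latticeDet WB U * z := by
      have h2 := congrArg (· ⬝ᵥ A'.fin) (hcast i)
      simp only [smul_dotProduct, sum_dotProduct] at h2
      have h3 : (F.map (Int.cast : ℤ → ℚ)) i ⬝ᵥ A'.fin = z := hz
      rw [h3] at h2
      have h4 : ∀ j, A'.forward (U.get j) ⬝ᵥ A'.fin = A.intWeight (U.get j) := by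
        intro j
        obtain ⟨i, hi⟩ := List.get_of_mem hWB
        have h5 := goodWord_iff.1 (hgood (U.get j)) i
        rw [conjForward, hi, List.append_nil] at h5
        rw [cast_intWeight h5, hconj.equivalent]
        rfl
      simp only [h4, smul_eq_mul] at h2
      have h6 : ((A.latticeBasis WB U W *ᵥ fun j => A.intWeight (U.get j)) i : ℚ) =
          A.latticeDet WB U * z := by
        rw [h2]
        simp [Matrix.mulVec, dotProduct]
      exact_mod_cast h6
    rw [outFin, h1, Int.mul_ediv_cancel_left _ h0]
  rw [outAutomaton, ofInt, hinit, htrans, hfin]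
  exact h

/-- If the forward vectors are zero, there is a conjugate automaton of dimension zero. -/
theorem forwardConjugate_zero {A' : WeightedAutomaton k n} (h : ∀ w, A'.forward w = 0) :
    ∃ F : Matrix (Fin 0) (Fin n) ℚ, LinearIndependent ℤ F.row ∧
      Submodule.span ℤ (Set.range F.row) = A'.forwardModule W ∧
      A'.ForwardConjugate F (ofInt 0 0 0) := by
  refine ⟨0, linearIndependent_empty_type, ?_, ?_, Subsingleton.elim _ _, fun σ =>
    Subsingleton.elim _ _⟩
  · rw [Set.range_eq_empty, Submodule.span_empty, eq_comm, eq_bot_iff, forwardModule,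
      Submodule.span_le]
    rintro _ ⟨u, -, rfl⟩
    exact h u
  · rw [Matrix.vecMul_zero, ← forward_nil, h]

end WeightedAutomaton

/-! ### A deterministic execution -/

section

variable {k : ℕ} {T : List (Word k) → Word k → Prop} {ext : Word k → Fin k → Word k}

/-- As long as some candidate passes, a round adds a word. A bound on the length of the list
therefore proves saturation. -/
theorem saturated_or_length_iterate_grow (W : List (Word k)) (K : ℕ) :
    (∀ w ∈ (grow T ext)^[K] W, ∀ σ, ¬ T ((grow T ext)^[K] W) (ext w σ)) ∨
      ((grow T ext)^[K] W).length = W.length + K := by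
  induction K with
  | zero => exact Or.inr rfl
  | succ K ih =>
    rw [Function.iterate_succ_apply']
    rcases grow_cases T ext ((grow T ext)^[K] W) with ⟨w, hw, σ, hT, h⟩ | ⟨hsat, h⟩
    · refine Or.inr ?_
      rcases ih with ih | ih
      · exact absurd hT (ih w hw σ)
      · rw [h, List.length_append, List.length_singleton, ih, add_assoc]
    · rw [h]
      exact Or.inl hsat

/-- Used when a bad word has been appended: the rank and module tests then reject everything, which
freezes the list with the bad word at its end. -/
theorem grow_eq_self {W : List (Word k)} (h : ∀ w, ¬ T W w) : grow T ext W = W := by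
  rcases grow_cases T ext W with ⟨w, -, σ, hT, -⟩ | ⟨-, h⟩
  · exact absurd hT (h _)
  · exact h

end

namespace ZCompute

open WeightedAutomaton

variable {k n : ℕ} (A : WeightedAutomaton k n)

/-- The state `s` can be reached from the initial state. -/
def Reaches (s : State k) : Prop := Relation.ReflTransGen (Step A) (start k) s

/-- The words found by the backward search. -/
noncomputable def backWords : List (Word k) :=
  (grow A.BackTest fun w σ => σ :: w)^[n + 1] [[]]

/-- The words found by the search for words that increase the rank. -/
noncomputable def rankWords (WB : List (Word k)) : List (Word k) :=
  (grow (A.RankTest WB) fun w σ => w ++ [σ])^[WB.length + 2] [[]]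

/-- The words found by the search for words that augment the module. -/
noncomputable def moduleWords (WB U : List (Word k)) : List (Word k) :=
  (grow (A.ModuleTest WB U) fun w σ => w ++ [σ])^[A.moduleBound WB U + 2] U

/-- The last word of the list has been found to be bad. -/
def FoundBad (WB : List (Word k)) (A' : WeightedAutomaton k WB.length) (L : ℕ)
    (W : List (Word k)) : Prop :=
  ∃ V w, W = V ++ [w] ∧ V.length ≤ L ∧ (∀ v ∈ V, A.GoodWord WB v) ∧ ¬ A.GoodWord WB w ∧
    Reaches A (.nonInteger WB A' w)

variable {A}

theorem SearchInv.length_back_le {WB : List (Word k)} (h : SearchInv A.backward WB) :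
    WB.length ≤ n + 1 := by
  simpa using h.indep.length_le

theorem SearchInv.length_forward_le {WB W : List (Word k)}
    (h : SearchInv (A.conjForward WB) W) : W.length ≤ WB.length + 1 := by
  simpa using h.indep.length_le

theorem backWords_spec : (SearchInv A.backward (backWords A) ∧
    Reaches A (.backwardLoop (backWords A))) ∧
      ∀ w ∈ backWords A, ∀ σ, ¬ A.BackTest (backWords A) (σ :: w) := by
  have h1 : SearchInv A.backward (backWords A) ∧ Reaches A (.backwardLoop (backWords A)) := by
    refine Function.Iterate.rec
      (fun W => SearchInv A.backward W ∧ Reaches A (.backwardLoop W)) ?_ ?_ _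
    rotate_left
    · rintro W ⟨h, hr⟩
      rcases grow_cases A.BackTest (fun w σ => σ :: w) W with ⟨w, hw, σ, hT, hg⟩ | ⟨-, hg⟩
      · rw [hg]
        have hnew := (backTest_iff h.indep _).1 hT
        exact ⟨h.append hw rfl hnew, hr.tail (.backwardAdd W w σ hw hnew)⟩
      · rw [hg]; exact ⟨h, hr⟩
    · exact ⟨searchInv_nil A.backward_eq_zero, .refl⟩
  refine ⟨h1, ?_⟩
  rcases saturated_or_length_iterate_grow (T := A.BackTest) (ext := fun w σ => σ :: w) [[]]
    (n + 1) with h | h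
  · exact h
  · have h2 := SearchInv.length_back_le h1.1
    -- Without saturation there would be `n + 2` words, against a bound of `n + 1`.
    rw [backWords, h, List.length_singleton] at h2
    omega

theorem exists_conjugated : ∃ A' : WeightedAutomaton k (backWords A).length,
    A.ConjInv (backWords A) A' ∧ Reaches A (.conjugated (backWords A) A') := by
  obtain ⟨⟨h, hr⟩, hsat⟩ := backWords_spec (A := A)
  have hclosed : ∀ w ∈ backWords A, ∀ σ : Fin k,
      A.backward (σ :: w) ∈ A.backwardSpan (backWords A) := by
    intro w hw σ
    have := hsat w hw σ
    rwa [backTest_iff h.indep, not_not] at this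
  obtain ⟨A', hA'⟩ := exists_backwardConjugate h.nil_mem hclosed
  exact ⟨A', ⟨h, hA'⟩, hr.tail (.backwardDone _ A' hclosed hA')⟩

section

variable {WB U : List (Word k)} {A' : WeightedAutomaton k WB.length}

theorem FoundBad.not_good {L : ℕ} {W : List (Word k)} (h : FoundBad A WB A' L W) :
    ¬ ∀ i, A.GoodWord WB (W.get i) := by
  obtain ⟨V, w, rfl, -, -, hw, -⟩ := h
  intro hall
  obtain ⟨i, hi⟩ := List.get_of_mem (show w ∈ V ++ [w] by simp)
  exact hw (hi ▸ hall i)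

theorem FoundBad.length_le {L : ℕ} {W : List (Word k)} (h : FoundBad A WB A' L W) :
    W.length ≤ L + 1 := by
  obtain ⟨V, w, rfl, hL, -⟩ := h
  rw [List.length_append, List.length_singleton]
  omega

theorem rankWords_spec (hA' : A.ConjInv WB A') (hr : Reaches A (.conjugated WB A')) :
    (FoundBad A WB A' (WB.length + 1) (rankWords A WB) ∨
      SearchInv (A.conjForward WB) (rankWords A WB) ∧
        (∀ w ∈ rankWords A WB, A.GoodWord WB w) ∧
        Reaches A (.rankLoop WB A' (rankWords A WB))) ∧
      ∀ w ∈ rankWords A WB, ∀ σ, ¬ A.RankTest WB (rankWords A WB) (w ++ [σ]) := by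
  have h1 : FoundBad A WB A' (WB.length + 1) (rankWords A WB) ∨
      SearchInv (A.conjForward WB) (rankWords A WB) ∧
        (∀ w ∈ rankWords A WB, A.GoodWord WB w) ∧
        Reaches A (.rankLoop WB A' (rankWords A WB)) := by
    refine Function.Iterate.rec (fun W => FoundBad A WB A' (WB.length + 1) W ∨
      SearchInv (A.conjForward WB) W ∧ (∀ w ∈ W, A.GoodWord WB w) ∧
        Reaches A (.rankLoop WB A' W)) ?_ ?_ _
    rotate_left
    · rintro W (h | ⟨h, hgood, hr⟩)
      · rw [grow_eq_self fun w hw => h.not_good hw.1]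
        exact Or.inl h
      · rcases grow_cases (A.RankTest WB) (fun w σ => w ++ [σ]) W with
          ⟨w, hw, σ, hT, hg⟩ | ⟨-, hg⟩
        · rw [hg]
          have hnew := (not_spanTest_numerRows_iff h.indep _).1 hT.2
          have hnew' : A'.forward (w ++ [σ]) ∉ A'.forwardSpan W := by
            rwa [hA'.conj.forwardSpan_eq, hA'.conj.forward]
          by_cases hw' : A.GoodWord WB (w ++ [σ])
          · refine Or.inr ⟨h.append hw (by simp) hnew, fun x hx => ?_,
              hr.tail (.rankAdd WB A' W w σ hw hnew' (hA'.conj.goodWord_iff.1 hw'))⟩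
            rcases List.mem_append.1 hx with hx | hx
            · exact hgood x hx
            · rwa [List.mem_singleton.1 hx]
          · exact Or.inl ⟨W, _, rfl, SearchInv.length_forward_le h, hgood, hw',
              hr.tail (.rankBad WB A' W w σ hw hnew' fun hi => hw' (hA'.conj.goodWord_iff.2 hi))⟩
        · rw [hg]; exact Or.inr ⟨h, hgood, hr⟩
    · by_cases hnil : A.GoodWord WB []
      · refine Or.inr ⟨searchInv_nil hA'.conjForward_eq_zero, by simpa using hnil,
          hr.tail (.emptyWordGood WB A' (hA'.conj.goodWord_iff.1 hnil))⟩
      · exact Or.inl ⟨[], [], rfl, by simp, by simp, hnil,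
          hr.tail (.emptyWordBad WB A' fun hi => hnil (hA'.conj.goodWord_iff.2 hi))⟩
  refine ⟨h1, ?_⟩
  rcases saturated_or_length_iterate_grow (T := A.RankTest WB) (ext := fun w σ => w ++ [σ]) [[]]
    (WB.length + 2) with h | h
  · exact h
  -- The bound is `WB.length + 1` for a search without bad words, and one more for a bad word at the
  -- end; without saturation there would be `WB.length + 3` words.
  · have h2 : (rankWords A WB).length ≤ WB.length + 2 := by
      rcases h1 with h1 | h1
      · exact h1.length_le
      · exact (SearchInv.length_forward_le h1.1).trans (by omega)
    rw [rankWords, h, List.length_singleton] at h2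
    omega

/-- The state of the search before the module loop. -/
theorem rankBasis_rankWords (hA' : A.ConjInv WB A') (hr : Reaches A (.conjugated WB A')) :
    FoundBad A WB A' (WB.length + 1) (rankWords A WB) ∨
      A.RankBasis WB (rankWords A WB) ∧
        Reaches A (.moduleLoop WB A' (rankWords A WB)) := by
  obtain ⟨h | ⟨h, hgood, hr⟩, hsat⟩ := rankWords_spec hA' hr
  · exact Or.inl h
  · have hclosed : ∀ w ∈ rankWords A WB, ∀ σ : Fin k,
        A'.forward (w ++ [σ]) ∈ A'.forwardSpan (rankWords A WB) := by
      intro w hw σ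
      by_contra hnew
      rw [hA'.conj.forwardSpan_eq, hA'.conj.forward] at hnew
      exact hsat w hw σ ⟨fun i => hgood _ (List.get_mem _ i),
        (not_spanTest_numerRows_iff h.indep _).2 hnew⟩
    exact Or.inr ⟨rankBasis_of_closed hA' h hgood hclosed, hr.tail (.rankDone WB A' _ hclosed)⟩

theorem moduleWords_spec (hA' : A.ConjInv WB A') {L : ℕ}
    (hU : FoundBad A WB A' L U ∨ A.RankBasis WB U ∧ Reaches A (.moduleLoop WB A' U)) :
    ((∃ L, FoundBad A WB A' L (moduleWords A WB U)) ∨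
      A.RankBasis WB U ∧ A.ModuleInv WB U (moduleWords A WB U) ∧
        Reaches A (.moduleLoop WB A' (moduleWords A WB U))) ∧
      ∀ w ∈ moduleWords A WB U, ∀ σ, ¬ A.ModuleTest WB U (moduleWords A WB U) (w ++ [σ]) := by
  rcases hU with hU | ⟨hU, hr⟩
  · have h1 : moduleWords A WB U = U :=
      Function.iterate_fixed (grow_eq_self fun w hw => hU.not_good hw.1) _
    rw [h1]
    exact ⟨Or.inl ⟨L, hU⟩, fun w _ σ hT => hU.not_good hT.1⟩
  have h1 : FoundBad A WB A' (U.length + A.moduleBound WB U) (moduleWords A WB U) ∨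
      A.ModuleInv WB U (moduleWords A WB U) ∧
        Reaches A (.moduleLoop WB A' (moduleWords A WB U)) := by
    refine Function.Iterate.rec (fun W => FoundBad A WB A' (U.length + A.moduleBound WB U) W ∨
      A.ModuleInv WB U W ∧ Reaches A (.moduleLoop WB A' W)) ?_ ?_ _
    rotate_left
    · rintro W (h | ⟨h, hr⟩)
      · rw [grow_eq_self fun w hw => h.not_good hw.1]
        exact Or.inl h
      · rcases grow_cases (A.ModuleTest WB U) (fun w σ => w ++ [σ]) W with
          ⟨w, hw, σ, hT, hg⟩ | ⟨-, hg⟩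
        · rw [hg]
          have hnew := (hU.moduleTest_iff h.subset h.good).1 hT
          have hnew' : A'.forward (w ++ [σ]) ∉ A'.forwardModule W := by
            rwa [hA'.conj.forwardModule_eq, hA'.conj.forward]
          by_cases hw' : A.GoodWord WB (w ++ [σ])
          · exact Or.inr ⟨h.append hU hw' hnew,
              hr.tail (.moduleAdd WB A' W w σ hw hnew' (hA'.conj.goodWord_iff.1 hw'))⟩
          · exact Or.inl ⟨W, _, rfl, h.length_le, h.good, hw',
              hr.tail (.moduleBad WB A' W w σ hw hnew' fun hi =>
                hw' (hA'.conj.goodWord_iff.2 hi))⟩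
        · rw [hg]; exact Or.inr ⟨h, hr⟩
    · exact Or.inr ⟨moduleInv_self hU.good, hr⟩
  refine ⟨h1.imp (fun h => ⟨_, h⟩) (fun h => ⟨hU, h⟩), ?_⟩
  rcases saturated_or_length_iterate_grow (T := A.ModuleTest WB U) (ext := fun w σ => w ++ [σ]) U
    (A.moduleBound WB U + 2) with h | h
  · exact h
  · have h2 : (moduleWords A WB U).length ≤ U.length + A.moduleBound WB U + 1 := by
      rcases h1 with h1 | h1
      · exact h1.length_le
      · exact h1.1.length_le.trans (by omega)
    rw [moduleWords, h] at h2
    omega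

end

variable (A)

/-- The first bad word of the list `W`. -/
noncomputable def badWord (WB W : List (Word k)) : Word k :=
  W.getD (firstIndex fun i : Fin W.length => ¬ A.GoodWord WB (W.get i)) []

/-- A word of non-integer weight, if there is a bad word in `W`. -/
noncomputable def outWord (WB W : List (Word k)) : Word k :=
  badWord A WB W ++ WB.getD (firstIndex fun j : Fin WB.length =>
    ¬ A.scaleAt (badWord A WB W ++ WB.get j) ∣ A.numer (badWord A WB W ++ WB.get j)) []

open Classical in
/-- The output of the execution. -/
noncomputable def outcome (WB U W : List (Word k)) : Outcome k :=
  if ∀ i, A.GoodWord WB (W.get i) then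
    if A.latticeDet WB U = 0 then .automaton 0 (ofInt 0 0 0)
    else .automaton U.length (A.outAutomaton WB U W)
  else .word (outWord A WB W)

variable {A}

/-- All words before the last are good, so the first bad word is the one at which the search
stopped. -/
theorem FoundBad.badWord_eq {WB W : List (Word k)} {A' : WeightedAutomaton k WB.length} {L : ℕ}
    (h : FoundBad A WB A' L W) :
    ¬ A.GoodWord WB (badWord A WB W) ∧ Reaches A (.nonInteger WB A' (badWord A WB W)) := by
  have hlt := (firstIndex_lt_iff fun i : Fin W.length => ¬ A.GoodWord WB (W.get i)).2
    (not_forall.1 h.not_good)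
  have hspec := firstIndex_spec _ hlt
  have hget : badWord A WB W = W.get ⟨_, hlt⟩ := List.getD_eq_getElem _ _ hlt
  rw [← hget] at hspec
  refine ⟨hspec, ?_⟩
  obtain ⟨V, w, rfl, -, hgood, hw, hr⟩ := h
  have hmem : badWord A WB (V ++ [w]) ∈ V ++ [w] := by rw [hget]; exact List.get_mem _ _
  rcases List.mem_append.1 hmem with hV | hV
  · exact absurd (hgood _ hV) hspec
  · rwa [List.mem_singleton.1 hV]

theorem FoundBad.reaches_output {WB W : List (Word k)} {A' : WeightedAutomaton k WB.length} {L : ℕ}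
    (hA' : A.ConjInv WB A') (h : FoundBad A WB A' L W) :
    Reaches A (.output (.word (outWord A WB W))) := by
  obtain ⟨hbad, hr⟩ := h.badWord_eq
  have hlt := (firstIndex_lt_iff fun j : Fin WB.length =>
    ¬ A.scaleAt (badWord A WB W ++ WB.get j) ∣ A.numer (badWord A WB W ++ WB.get j)).2
    (not_forall.1 hbad)
  have hspec := firstIndex_spec _ hlt
  rw [dvd_numer_iff] at hspec
  have hget : outWord A WB W = badWord A WB W ++ WB.get ⟨_, hlt⟩ := by
    rw [outWord, List.getD_eq_getElem _ _ hlt]; rfl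
  rw [hget]
  refine hr.tail (.returnWord WB A' _ _ ?_)
  rwa [hA'.conj.forward]

/-- The execution reaches its output. -/
theorem reaches_outcome : Reaches A (.output (outcome A (backWords A) (rankWords A (backWords A))
    (moduleWords A (backWords A) (rankWords A (backWords A))))) := by
  obtain ⟨A', hA', hr⟩ := exists_conjugated (A := A)
  generalize backWords A = WB at *
  have hU := rankBasis_rankWords hA' hr
  generalize rankWords A WB = U at *
  obtain ⟨⟨L, hbad⟩ | ⟨hU, hW, hr⟩, hsat⟩ := moduleWords_spec hA' hU
  · rw [outcome, if_neg hbad.not_good]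
    exact hbad.reaches_output hA'
  generalize moduleWords A WB U = W at *
  rw [outcome, if_pos fun i => hW.good _ (List.get_mem _ _)]
  have hclosed : ∀ w ∈ W, ∀ σ : Fin k, A'.forward (w ++ [σ]) ∈ A'.forwardModule W := by
    intro w hw σ
    have := hsat w hw σ
    rwa [hU.moduleTest_iff hW.subset hW.good, not_not, ← hA'.conj.forward,
      ← hA'.conj.forwardModule_eq] at this
  have hr' : Reaches A (.generators WB A' W) := hr.tail (.moduleDone WB A' W hclosed)
  -- A vanishing determinant means that all forward vectors are zero, and then the automaton without
  -- states is the output.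
  split_ifs with h0
  · obtain ⟨F, hF, hspan, hconj⟩ := forwardConjugate_zero (A' := A') (W := W)
      fun w => by rw [hA'.conj.forward, hU.eq_zero h0]
    exact hr'.tail (.returnAutomaton WB A' W _ F _ hF hspan hconj)
  · obtain ⟨F, hF, hspan, hconj⟩ := outAutomaton_forwardConjugate hA'.search.nil_mem hA'.conj hU
      hW.subset hW.good h0 hclosed
    exact hr'.tail (.returnAutomaton WB A' W _ F _ hF hspan hconj)

end ZCompute

/-! ### The running time of the execution -/

theorem Data.ofRat_intCast (z : ℤ) : Data.ofRat z = .pair (.int z) (.int 1) := by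
  simp [Data.ofRat]

section

variable {X : Type} {e : X → Data} {k n r : X → ℕ} {A : (x : X) → WeightedAutomaton (k x) (n x)}
  {WB U W : (x : X) → List (Word (k x))}

theorem PolyTimeVec.ofVector (hr : PolyTimeNat e r) {a : (x : X) → Fin (r x) → ℤ}
    (ha : PolyTimeVec e a) : PolyTime e fun x => .ofVector fun i => (a x i : ℚ) :=
  PolyTime.tabulate hr (g := fun x i => .ofRat (a x i : ℚ))
    ((PolyTime.pair ha.entry (PolyTime.const (.int 1))).congr fun _ => (Data.ofRat_intCast _).symm)

theorem PolyTime.ofInt (hk : PolyTimeNat e k) (hr : PolyTimeNat e r)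
    {a b : (x : X) → Fin (r x) → ℤ} (ha : PolyTimeVec e a)
    {M : (x : X) → Fin (k x) → Matrix (Fin (r x)) (Fin (r x)) ℤ}
    (hM : PolyTimeMat (withIndex e k) fun p => M p.1 p.2) (hb : PolyTimeVec e b) :
    PolyTime e fun x => .ofAutomaton (WeightedAutomaton.ofInt (a x) (M x) (b x)) := by
  have hM' : PolyTime (withIndex e k) fun p => .ofMatrix ((M p.1 p.2).map (Int.cast : ℤ → ℚ)) :=
    PolyTime.tabulate hr.indexed
      (g := fun (p : Σ x, Fin (k x)) i => .ofVector ((M p.1 p.2).map (Int.cast : ℤ → ℚ) i))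
      (hM.row.ofVector hr.indexed.indexed)
  exact hk.1.pair (hr.1.pair ((ha.ofVector hr).pair ((PolyTime.tabulate hk
    (g := fun x σ => .ofMatrix ((M x σ).map (Int.cast : ℤ → ℚ))) hM').pair
      ((hb.ofVector hr).pair (PolyTime.const (.int 0))))))

theorem PolyTime.wordNil : PolyTime e fun x => .ofWord ([] : Word (k x)) :=
  PolyTime.const (.int 0)

theorem PolyTime.wordsGetD (hW : PolyTime e fun x => encodeWords (W x)) {i : X → ℕ}
    (hi : PolyTimeNat e i) : PolyTime e fun x => .ofWord ((W x).getD (i x) []) := by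
  refine (PolyTime.nth (l := fun x => (W x).map Data.ofWord) hW hi).congr fun x => ?_
  exact List.getD_map (W x) [] Data.ofWord

theorem PolyTime.outInit (hA : PolyTime e fun x => .ofAutomaton (A x))
    (hWB : PolyTime e fun x => encodeWords (WB x)) (hU : PolyTime e fun x => encodeWords (U x))
    (hW : PolyTime e fun x => encodeWords (W x)) (h0 : ∀ x, (A x).latticeDet (WB x) (U x) ≠ 0) :
    PolyTimeVec e fun x => (A x).outInit (WB x) (U x) (W x) := by
  have hl := hU.wordsLength
  have hH := hA.latticeBasis hWB hU hW h0
  exact PolyTimeVec.of_entries hl (v := fun x => (A x).outInit (WB x) (U x) (W x))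
    ((PolyTimeMat.vecMul hl hl (hA.weightCoords hWB hU PolyTime.wordNil)
      (hH.pseudoInv hl)).entry.div (hH.pseudoDet hl).indexed)

theorem PolyTime.extensionRows (hA : PolyTime e fun x => .ofAutomaton (A x))
    (hWB : PolyTime e fun x => encodeWords (WB x)) (hU : PolyTime e fun x => encodeWords (U x)) :
    PolyTimeMat (withIndex e k) fun p => (A p.1).extensionRows (WB p.1) (U p.1) p.2 := by
  have hσ : PolyTimeInt (withIndex e k) fun p => ((p.2 : ℕ) : ℤ) := (PolyTime.id _).snd
  exact PolyTimeMat.of_rows hU.wordsLength.indexed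
    (M := fun p : Σ x, Fin (k x) => (A p.1).extensionRows (WB p.1) (U p.1) p.2)
    (hA.indexed.indexed.weightCoords hWB.indexed.indexed hU.indexed.indexed
      (PolyTime.wordSnoc (hU.indexed (n := k)).wordsGet hσ.indexed))

theorem PolyTime.outTrans (hA : PolyTime e fun x => .ofAutomaton (A x))
    (hWB : PolyTime e fun x => encodeWords (WB x)) (hU : PolyTime e fun x => encodeWords (U x))
    (hW : PolyTime e fun x => encodeWords (W x)) (h0 : ∀ x, (A x).latticeDet (WB x) (U x) ≠ 0) :
    PolyTimeMat (withIndex e k) fun p => (A p.1).outTrans (WB p.1) (U p.1) (W p.1) p.2 := by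
  have hl := hU.wordsLength
  have hH := hA.latticeBasis hWB hU hW h0
  have hl' : PolyTimeNat (withIndex e k) fun p => (U p.1).length := hl.indexed
  have hH' : PolyTimeMat (withIndex e k) fun p =>
    (A p.1).latticeBasis (WB p.1) (U p.1) (W p.1) := hH.indexed
  have hprod := (hH'.mul hl' hl' hl' (hA.extensionRows hWB hU)).mul hl' hl' hl'
    (hH.pseudoInv hl).indexed
  exact PolyTimeMat.of_entries hl' hl'
    (M := fun p : Σ x, Fin (k x) => (A p.1).outTrans (WB p.1) (U p.1) (W p.1) p.2)
    ((hprod.entry hl'.2 hl').div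
      ((hA.latticeDet hWB hU).mul (hH.pseudoDet hl)).indexed.indexed.indexed)

theorem PolyTime.outFin (hA : PolyTime e fun x => .ofAutomaton (A x))
    (hWB : PolyTime e fun x => encodeWords (WB x)) (hU : PolyTime e fun x => encodeWords (U x))
    (hW : PolyTime e fun x => encodeWords (W x)) (h0 : ∀ x, (A x).latticeDet (WB x) (U x) ≠ 0) :
    PolyTimeVec e fun x => (A x).outFin (WB x) (U x) (W x) := by
  have hl := hU.wordsLength
  have hH := hA.latticeBasis hWB hU hW h0
  have hw : PolyTimeVec e fun x (j : Fin (U x).length) => (A x).intWeight ((U x).get j) :=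
    PolyTimeVec.of_entries hl (v := fun x (j : Fin (U x).length) => (A x).intWeight ((U x).get j))
      (hA.indexed.intWeight hU.wordsGet)
  exact PolyTimeVec.of_entries hl (v := fun x => (A x).outFin (WB x) (U x) (W x))
    ((hH.mulVec hl hl hw).entry.div (hA.latticeDet hWB hU).indexed)

theorem PolyTime.outAutomaton (hA : PolyTime e fun x => .ofAutomaton (A x))
    (hWB : PolyTime e fun x => encodeWords (WB x)) (hU : PolyTime e fun x => encodeWords (U x))
    (hW : PolyTime e fun x => encodeWords (W x)) (h0 : ∀ x, (A x).latticeDet (WB x) (U x) ≠ 0) :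
    PolyTime e fun x => .ofAutomaton ((A x).outAutomaton (WB x) (U x) (W x)) :=
  PolyTime.ofInt hA.automatonLetters hU.wordsLength (hA.outInit hWB hU hW h0)
    (hA.outTrans hWB hU hW h0) (hA.outFin hWB hU hW h0)

open ZCompute

theorem PolyTime.badWord (hA : PolyTime e fun x => .ofAutomaton (A x))
    (hWB : PolyTime e fun x => encodeWords (WB x)) (hW : PolyTime e fun x => encodeWords (W x)) :
    PolyTime e fun x => .ofWord (badWord (A x) (WB x) (W x)) :=
  hW.wordsGetD (PolyTimeDec.firstIndex hW.wordsLength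
    (p := fun x i => ¬ (A x).GoodWord (WB x) ((W x).get i)) (hA.goodAt hWB hW).not)

theorem PolyTime.outWord (hA : PolyTime e fun x => .ofAutomaton (A x))
    (hWB : PolyTime e fun x => encodeWords (WB x)) (hW : PolyTime e fun x => encodeWords (W x)) :
    PolyTime e fun x => .ofWord (outWord (A x) (WB x) (W x)) :=
  (hA.badWord hWB hW).wordAppend (hWB.wordsGetD (PolyTimeDec.firstIndex hWB.wordsLength
    (p := fun x j => ¬ (A x).scaleAt (ZCompute.badWord (A x) (WB x) (W x) ++ (WB x).get j) ∣
      (A x).numer (ZCompute.badWord (A x) (WB x) (W x) ++ (WB x).get j))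
    (hA.integralAt hWB (hA.badWord hWB hW)).not))

theorem PolyTime.outcome (hA : PolyTime e fun x => .ofAutomaton (A x))
    (hWB : PolyTime e fun x => encodeWords (WB x)) (hU : PolyTime e fun x => encodeWords (U x))
    (hW : PolyTime e fun x => encodeWords (W x)) :
    PolyTime e fun x => .ofOutcome (outcome (A x) (WB x) (U x) (W x)) := by
  classical
  have hdet : PolyTimeDec e fun x => (A x).latticeDet (WB x) (U x) = 0 :=
    (hA.latticeDet hWB hU).eq (.const 0)
  have hzero : PolyTime e fun x => .ofAutomaton
      (WeightedAutomaton.ofInt (k := k x) (0 : Fin 0 → ℤ) 0 0) :=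
    PolyTime.ofInt (r := fun _ => 0) (a := fun _ => 0) (b := fun _ => 0) (M := fun _ => 0)
      hA.automatonLetters (.const 0) (PolyTime.const (.int 0)) (PolyTime.const (.int 0))
      (PolyTime.const (.int 0))
  let Y := {x : X // ¬ (A x).latticeDet (WB x) (U x) = 0}
  have hout : PolyTime (fun x : Y => e x) fun x =>
      .ofAutomaton ((A x).outAutomaton (WB x) (U x) (W x)) :=
    PolyTime.outAutomaton (A := fun x : Y => A x) (hA.reindex Subtype.val)
      (hWB.reindex Subtype.val) (hU.reindex Subtype.val) (hW.reindex Subtype.val) fun x => x.2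
  have haut := (PolyTime.const (.int 1)).pair (hdet.ite (hzero.reindex Subtype.val) hout
    (f := fun x => .ofAutomaton (WeightedAutomaton.ofInt (k := k x) (0 : Fin 0 → ℤ) 0 0))
    (g := fun x => .ofAutomaton ((A x).outAutomaton (WB x) (U x) (W x))))
  refine ((hA.goodWords hWB hW).ite' haut
    ((PolyTime.const (.int 0)).pair (hA.outWord hWB hW))).congr fun x => ?_
  rw [ZCompute.outcome]
  split_ifs <;> rfl

end

/-! ### Bounds for all executions and for the program -/

namespace ZCompute

open WeightedAutomaton

/-- An input of the procedure. -/
structure Input where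
  /-- the number of letters -/
  letters : ℕ
  /-- the number of states -/
  dim : ℕ
  /-- the automaton -/
  aut : WeightedAutomaton letters dim

/-- The encoding of an input. -/
def Input.encode (x : Input) : Data := .ofAutomaton x.aut

/-- The results of the searches for independent vectors. -/
structure Searches extends Input where
  /-- the words found by the backward search -/
  back : List (Word letters)
  /-- the words found by the rank search -/
  rank : List (Word letters)
  back_inv : SearchInv aut.backward back
  rank_inv : SearchInv (aut.conjForward back) rank

theorem size_ofWord_le {k : ℕ} (w : Word k) :
    (Data.ofWord w).size ≤ 1 + w.length * (1 + (1 + k)) := by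
  refine (Data.size_ofList_le (B := 1 + k) fun d hd => ?_).trans (by rw [List.length_map])
  obtain ⟨σ, -, rfl⟩ := List.mem_map.1 hd
  have h1 := Nat.size_le_self (σ : ℕ)
  have h2 := σ.2
  simp only [Data.size, Int.natAbs_natCast]
  omega

theorem _root_.WeightedAutomaton.SearchInv.size_le {k : ℕ} {V : Type*} [AddCommGroup V]
    [Module ℚ V] {f : Word k → V} {W : List (Word k)} (hW : SearchInv f W) {L : ℕ}
    (hL : W.length ≤ L) : (encodeWords W).size ≤ 1 + L * (1 + (1 + L * (1 + (1 + k)))) := by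
  refine (Data.size_ofList_le (B := 1 + L * (1 + (1 + k))) fun d hd => ?_).trans ?_
  · obtain ⟨w, hw, rfl⟩ := List.mem_map.1 hd
    refine (size_ofWord_le w).trans (Nat.add_le_add_left (Nat.mul_le_mul_right _ ?_) _)
    exact (hW.short w hw).le.trans hL
  · rw [List.length_map]
    exact Nat.add_le_add_left (Nat.mul_le_mul_right _ hL) _

/-- The number of steps of an execution is polynomially bounded. -/
theorem polyBounded_steps : PolyBounded (fun y : Searches => y.toInput.encode) fun y =>
    y.back.length + (y.rank.length + y.aut.moduleBound y.back y.rank) + 3 := by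
  have hid := PolyTime.id fun y : Searches => y.toInput.encode
  have hk : PolyBounded (fun y : Searches => y.toInput.encode) fun y => y.letters :=
    (PolyTime.automatonLetters (A := fun y : Searches => y.aut) hid).2
  have hn : PolyBounded (fun y : Searches => y.toInput.encode) fun y => y.dim :=
    (PolyTime.automatonDim (A := fun y : Searches => y.aut) hid).2
  have hlen1 : ∀ y : Searches, y.back.length ≤ y.dim + 2 := fun y =>
    (SearchInv.length_back_le y.back_inv).trans (by omega)
  have hlen2 : ∀ y : Searches, y.rank.length ≤ y.dim + 2 := fun y =>
    (SearchInv.length_forward_le y.rank_inv).trans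
      (Nat.add_le_add_right (SearchInv.length_back_le y.back_inv) 1)
  have hL := hn.add (.const 2)
  have hB := (PolyBounded.const (e := fun y : Searches => y.toInput.encode) 1).add
    (hL.mul ((PolyBounded.const 1).add ((PolyBounded.const 1).add
      (hL.mul ((PolyBounded.const 1).add ((PolyBounded.const 1).add hk))))))
  -- The determinant is computable in polynomial time from the automaton and the two lists, so its
  -- number of digits is polynomial in the length of `e'`. This covers the lists of every execution,
  -- not only those of the program, since only the search invariants are used.
  let e' : Searches → Data := fun y =>
    .pair (.pair y.toInput.encode (encodeWords y.back)) (encodeWords y.rank)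
  have he' : PolyBounded (fun y : Searches => y.toInput.encode) fun y => (e' y).size :=
    ((PolyBounded.const 1).add (((PolyBounded.const 1).add (hid.size.add
      (hB.mono fun y => y.back_inv.size_le (hlen1 y)))).add
        (hB.mono fun y => y.rank_inv.size_le (hlen2 y)))).mono fun y => by
          simp only [e', Data.size]; omega
  have hdet := (PolyTime.latticeDet (e := e') (A := fun y : Searches => y.aut)
    (WB := fun y => y.back) (U := fun y => y.rank) (PolyTime.id e').fst.fst
    (PolyTime.id e').fst.snd (PolyTime.id e').snd).size.of_size_le he'
  have hbound : PolyBounded (fun y : Searches => y.toInput.encode) fun y =>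
      y.aut.moduleBound y.back y.rank :=
    (hL.mul hdet).mono fun y => Nat.mul_le_mul (hlen2 y) (by simp only [Data.size]; omega)
  exact (((hL.mono hlen1).add ((hL.mono hlen2).add hbound)).add (.const 3))

theorem size_cons_le {k : ℕ} (w : Word k) (σ : Fin k) :
    (Data.ofWord (σ :: w)).size ≤ (Data.ofWord w).size + (k + 2) := by
  have h1 := Nat.size_le_self (σ : ℕ)
  have h2 := σ.2
  have h3 : (Data.ofWord (σ :: w)).size = 1 + (1 + (σ : ℕ).size) + (Data.ofWord w).size := rfl
  omega

theorem size_snoc_le {k : ℕ} (w : Word k) (σ : Fin k) :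
    (Data.ofWord (w ++ [σ])).size ≤ (Data.ofWord w).size + (k + 2) := by
  have h1 : (Data.ofWord (w ++ [σ])).size = (Data.ofWord (σ :: w)).size := by
    simp only [Data.ofWord, Data.size_ofList, List.map_append, List.map_cons, List.map_nil,
      List.sum_append, List.sum_cons, List.sum_nil]
    omega
  rw [h1]
  exact size_cons_le w σ

theorem polyTime_letters : PolyTimeNat Input.encode Input.letters :=
  PolyTime.automatonLetters (A := fun x : Input => x.aut) (PolyTime.id Input.encode)

theorem polyTime_snoc : PolyTime (fun q : Σ x : Input, Word x.letters × Fin x.letters =>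
    .pair (.ofWord q.2.1) (.int ((q.2.2 : ℕ) : ℤ))) fun q => .ofWord (q.2.1 ++ [q.2.2]) :=
  PolyTime.wordSnoc (v := fun q : Σ x : Input, Word x.letters × Fin x.letters => q.2.1)
    (σ := fun q => q.2.2) (PolyTime.id _).fst (PolyTime.id _).snd

theorem polyTime_nil : PolyTime Input.encode fun x => encodeWords ([[]] : List (Word x.letters)) :=
  PolyTime.const (.pair (.int 0) (.int 0))

theorem polyTime_backWords : PolyTime Input.encode fun x => encodeWords (backWords x.aut) := by
  have hn := (PolyTime.automatonDim (A := fun x : Input => x.aut) (PolyTime.id Input.encode)).2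
  refine PolyTime.iterate_grow (T := fun x : Input => x.aut.BackTest)
    (ext := fun _ w σ => σ :: w) (W := fun _ => [[]]) (K := fun x => x.dim + 1) polyTime_letters
    ?_ (fun _ => size_cons_le) ?_ polyTime_nil (hn.add (.const 1)) fun x => backWords_spec.2
  · exact PolyTime.wordCons (v := fun q : Σ x : Input, Word x.letters × Fin x.letters => q.2.1)
      (σ := fun q => q.2.2) (PolyTime.id _).fst (PolyTime.id _).snd
  · have hq := PolyTime.id (withTest Input.encode Input.letters)
    exact PolyTime.backTest (A := fun q : Σ x : Input, List (Word x.letters) × Word x.letters =>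
      q.1.aut) (W := fun q => q.2.1) (w := fun q => q.2.2) hq.fst.fst hq.fst.snd hq.snd

theorem polyTime_rankWords :
    PolyTime Input.encode fun x => encodeWords (rankWords x.aut (backWords x.aut)) := by
  have hK := (polyTime_backWords.wordsLength.add (.const 2)).2
  refine PolyTime.iterate_grow (T := fun x : Input => x.aut.RankTest (backWords x.aut))
    (ext := fun _ w σ => w ++ [σ]) (W := fun _ => [[]]) polyTime_letters
    polyTime_snoc (fun _ => size_snoc_le) ?_ polyTime_nil hK fun x => ?_
  · have hq := PolyTime.id (withTest Input.encode Input.letters)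
    exact PolyTime.rankTest (A := fun q : Σ x : Input, List (Word x.letters) × Word x.letters =>
      q.1.aut) (WB := fun q => backWords q.1.aut) (W := fun q => q.2.1) (w := fun q => q.2.2)
      hq.fst.fst (hq.fst.fst.trans (polyTime_backWords.reindex Sigma.fst)) hq.fst.snd hq.snd
  · obtain ⟨A', hA', hr⟩ := exists_conjugated (A := x.aut)
    exact (rankWords_spec hA' hr).2

theorem polyTime_moduleWords : PolyTime Input.encode fun x =>
    encodeWords (moduleWords x.aut (backWords x.aut) (rankWords x.aut (backWords x.aut))) := by
  have hdet := (PolyTime.latticeDet (A := fun x : Input => x.aut) (PolyTime.id Input.encode)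
    polyTime_backWords polyTime_rankWords).size
  have hK : PolyBounded Input.encode fun x =>
      x.aut.moduleBound (backWords x.aut) (rankWords x.aut (backWords x.aut)) + 2 :=
    ((polyTime_rankWords.wordsLength.2.mul hdet).mono fun x =>
      Nat.mul_le_mul_left _ (by simp only [Data.size]; omega)).add (.const 2)
  refine PolyTime.iterate_grow (T := fun x : Input =>
      x.aut.ModuleTest (backWords x.aut) (rankWords x.aut (backWords x.aut)))
    (ext := fun _ w σ => w ++ [σ]) polyTime_letters
    polyTime_snoc (fun _ => size_snoc_le) ?_ polyTime_rankWords hK fun x => ?_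
  · have hq := PolyTime.id (withTest Input.encode Input.letters)
    exact PolyTime.moduleTest (A := fun q : Σ x : Input, List (Word x.letters) × Word x.letters =>
      q.1.aut) (WB := fun q => backWords q.1.aut)
      (U := fun q => rankWords q.1.aut (backWords q.1.aut)) (W := fun q => q.2.1)
      (w := fun q => q.2.2) hq.fst.fst (hq.fst.fst.trans (polyTime_backWords.reindex Sigma.fst))
      (hq.fst.fst.trans (polyTime_rankWords.reindex Sigma.fst)) hq.fst.snd hq.snd
  · obtain ⟨A', hA', hr⟩ := exists_conjugated (A := x.aut)
    exact (moduleWords_spec hA' (rankBasis_rankWords hA' hr)).2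

/-- In the backward loop there is no conjugate automaton yet to supply the invariant of a forward
search, whence the separate case `t ≤ n`. -/
theorem StateInv.le {k n : ℕ} {A : WeightedAutomaton k n} {t : ℕ} {s : State k}
    (h : StateInv A t s) : t ≤ n ∨ ∃ WB U, SearchInv A.backward WB ∧
      SearchInv (A.conjForward WB) U ∧
        t ≤ WB.length + (U.length + A.moduleBound WB U) + 3 := by
  cases s with
  | backwardLoop WB =>
    have h1 := h.1
    have h2 := SearchInv.length_back_le h.2
    exact Or.inl (by omega)
  | conjugated WB A' =>
    have h1 := h.1
    exact Or.inr ⟨WB, [[]], h.2.search, searchInv_nil h.2.conjForward_eq_zero, by omega⟩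
  | rankLoop WB A' W =>
    have h1 := h.1
    exact Or.inr ⟨WB, W, h.2.1.search, h.2.2.1, by omega⟩
  | moduleLoop WB A' W =>
    obtain ⟨ht, hA', U, hU, -, hW⟩ := h
    have := hW.length_le
    exact Or.inr ⟨WB, U, hA'.search, hU, by omega⟩
  | nonInteger WB A' w =>
    obtain ⟨hA', -, U, hU, ht⟩ := h
    exact Or.inr ⟨WB, U, hA'.search, hU, by omega⟩
  | generators WB A' W =>
    obtain ⟨hA', -, -, -, U, hU, ht⟩ := h
    exact Or.inr ⟨WB, U, hA'.search, hU, by omega⟩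
  | output r => exact Or.inr h.2

end ZCompute

theorem mainTheorem3 :
    ∃ (P : Prog) (p : Polynomial ℕ), ∀ (k n : ℕ) (A : WeightedAutomaton k n),
      -- every execution of the procedure has polynomially many steps
      (∀ (N : ℕ) (s : ℕ → ZCompute.State k), s 0 = ZCompute.start k →
        (∀ i < N, ZCompute.Step A (s i) (s (i + 1))) →
        N ≤ p.eval (Data.ofAutomaton A).size) ∧
      -- an execution never gets stuck, and it stops only with a correct output
      (∀ s : ZCompute.State k, Relation.ReflTransGen (ZCompute.Step A) (ZCompute.start k) s →
        (∃ s', ZCompute.Step A s s') ∨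
          ∃ r : Outcome k, s = ZCompute.State.output r ∧ r.Correct A) ∧
      -- the program carries out such an execution in polynomial time
      (∃ (r : Outcome k) (t : ℕ),
        Relation.ReflTransGen (ZCompute.Step A) (ZCompute.start k) (ZCompute.State.output r) ∧
        P.Runs (Data.ofAutomaton A) (Data.ofOutcome r) t ∧
        t ≤ p.eval (Data.ofAutomaton A).size) := by
  obtain ⟨P, p, hP⟩ := PolyTime.outcome (A := fun x : ZCompute.Input => x.aut)
    (PolyTime.id ZCompute.Input.encode) ZCompute.polyTime_backWords ZCompute.polyTime_rankWords
    ZCompute.polyTime_moduleWords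
  obtain ⟨q, hq⟩ := ZCompute.polyBounded_steps
  obtain ⟨d, hd⟩ := (PolyTime.automatonDim (A := fun x : ZCompute.Input => x.aut)
    (PolyTime.id ZCompute.Input.encode)).2
  -- `p` bounds the time of the program, `q` the steps of executions that have left the backward
  -- loop, and `d` the dimension, for executions still inside it.
  refine ⟨P, p + q + d, fun k n A => ⟨fun N s h0 hs => ?_, fun s hs => ?_, ?_⟩⟩
  · simp only [Polynomial.eval_add]
    rcases (ZCompute.stateInv_of_steps h0 hs).le with h | ⟨WB, U, hWB, hU, h⟩
    · have h1 : n ≤ d.eval (Data.ofAutomaton A).size := hd ⟨k, n, A⟩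
      omega
    · have h1 : WB.length + (U.length + A.moduleBound WB U) + 3 ≤
        q.eval (Data.ofAutomaton A).size := hq ⟨⟨k, n, A⟩, WB, U, hWB, hU⟩
      omega
  · exact (ZCompute.exists_stateInv hs).choose_spec.progress
  · obtain ⟨t, ht, htp⟩ := hP ⟨k, n, A⟩
    refine ⟨_, t, ZCompute.reaches_outcome, ht, ?_⟩
    have h1 : t ≤ p.eval (Data.ofAutomaton A).size := htp
    simp only [Polynomial.eval_add]
    omega
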